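/- Let $(M,\omega)$ be a connected (smooth, Hausdorff, second countable) symplectic manifold of dimension $2n$ without boundary that is a forward complete Liouville manifold, i.e. $M$ admits a smooth vector field $X$ with $\mathcal L_X\omega=\omega$ (where $\mathcal L_X$ is the Lie derivative) whose time-$t$ flow map is defined on all of $M$ for every $t\ge 0$. For $b>0$ let $B^{2n}(b)\subset\mathbb R^{2n}$ be the closed ball of radius $\sqrt{b/\pi}$ centred at the origin, where $\mathbb R^{2n}$, with coordinates $(x_1,y_1,\dots,x_n,y_n)$, carries the standard symplectic form $\omega_n=\sum_{j=1}^n dx_j\wedge dy_j$. Let $\mathrm{Emb}(B^{2n}(b),M,\omega)$ be the space of symplectic embeddings $\varphi\colon B^{2n}(b)\to (M,\omega)$, that is, of smooth (up to the boundary) embeddings with $\varphi^*\omega=\omega_n$, endowed with the $C^\infty$-topology. Then for every $b>0$ the space $\mathrm{Emb}(B^{2n}(b),M,\omega)$ is nonempty and path-connected. -/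

import Mathlib

open scoped Manifold ContDiff

noncomputable section

namespace SymplecticBall

/-- The space `ℝ²ⁿ`, with coordinates `(x₁, y₁, …, xₙ, yₙ)`. -/
abbrev Euc (n : ℕ) : Type := EuclideanSpace ℝ (Fin (2 * n))

/-- The standard symplectic form `ωₙ = ∑ⱼ dxⱼ ∧ dyⱼ` of `ℝ²ⁿ`. -/
def stdForm (n : ℕ) (u v : Euc n) : ℝ :=
  ∑ j : Fin n, (u ⟨2 * j, by omega⟩ * v ⟨2 * j + 1, by omega⟩
    - u ⟨2 * j + 1, by omega⟩ * v ⟨2 * j, by omega⟩)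

/-- The closed ball `B²ⁿ(b)` of radius `√(b/π)` in `ℝ²ⁿ` centred at the origin. -/
def symplBall (n : ℕ) (b : ℝ) : Set (Euc n) :=
  Metric.closedBall 0 (Real.sqrt (b / Real.pi))

lemma zero_mem_symplBall (n : ℕ) (b : ℝ) : (0 : Euc n) ∈ symplBall n b :=
  Metric.mem_closedBall_self (Real.sqrt_nonneg _)

section Manifold

variable {n : ℕ} {M : Type*} [TopologicalSpace M] [ChartedSpace (Euc n) M]

/-- The expression of a (not necessarily smooth) 2-form `Ω` on `M` in the chart at `p`:
the pullback of `Ω` under the inverse of the chart. It is meaningful on the target of the chart,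
which is an open subset of `ℝ²ⁿ`. -/
def formInChart (Ω : (x : M) → TangentSpace (𝓡 (2 * n)) x [⋀^Fin 2]→L[ℝ] ℝ) (p : M) (z : Euc n) :
    Euc n [⋀^Fin 2]→L[ℝ] ℝ :=
  (Ω ((extChartAt (𝓡 (2 * n)) p).symm z)).compContinuousLinearMap
    (mfderiv (𝓡 (2 * n)) (𝓡 (2 * n)) (extChartAt (𝓡 (2 * n)) p).symm z)

/-- The expression of a vector field `X` on `M` in the chart at `p`. It is meaningful on the target
of the chart. -/
def fieldInChart (X : (x : M) → TangentSpace (𝓡 (2 * n)) x) (p : M) (z : Euc n) : Euc n :=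
  VectorField.mpullback (𝓡 (2 * n)) (𝓡 (2 * n)) (extChartAt (𝓡 (2 * n)) p).symm X z

variable (n M) in
/-- A symplectic form on the `2n`-dimensional manifold `M`: a smooth, closed, non-degenerate
2-form. Smoothness and `dΩ = 0` are expressed in the charts of `M`. -/
structure SymplecticForm where
  form : (x : M) → TangentSpace (𝓡 (2 * n)) x [⋀^Fin 2]→L[ℝ] ℝ
  smooth : ∀ p : M, ContDiffOn ℝ ∞ (formInChart form p) (extChartAt (𝓡 (2 * n)) p).target
  closed : ∀ p : M, ∀ z ∈ (extChartAt (𝓡 (2 * n)) p).target,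
    extDeriv (formInChart form p) z = 0
  nondegenerate : ∀ (x : M) (u : TangentSpace (𝓡 (2 * n)) x),
    (∀ v : TangentSpace (𝓡 (2 * n)) x, form x ![u, v] = 0) → u = 0

/-- The Lie derivative of a 2-form `Ω` on (an open subset of) `ℝ²ⁿ` along a vector field `X`,
at the point `z` and on the vectors `u`, `v`:
`(𝓛_X Ω)(u, v) = (D_X Ω)(u, v) + Ω(D_u X, v) + Ω(u, D_v X)`,
that is, `X (Ω(U, V)) - Ω([X, U], V) - Ω(U, [X, V])` for the constant fields `U = u`, `V = v`. -/
def lieDeriv (X : Euc n → Euc n) (Ω : Euc n → Euc n [⋀^Fin 2]→L[ℝ] ℝ) (z u v : Euc n) : ℝ :=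
  fderiv ℝ Ω z (X z) ![u, v] + Ω z ![fderiv ℝ X z u, v] + Ω z ![u, fderiv ℝ X z v]

variable [IsManifold (𝓡 (2 * n)) ∞ M]

/-- `X` is a Liouville field of `Ω`: a smooth vector field with `𝓛_X Ω = Ω`. The equation is
expressed in the charts of `M`. -/
structure IsLiouvilleField (Ω : SymplecticForm n M) (X : (x : M) → TangentSpace (𝓡 (2 * n)) x) :
    Prop where
  smooth : ContMDiff (𝓡 (2 * n)) (𝓡 (2 * n)).tangent ∞
    (fun x => (⟨x, X x⟩ : TangentBundle (𝓡 (2 * n)) M))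
  lieDeriv_eq : ∀ p : M, ∀ z ∈ (extChartAt (𝓡 (2 * n)) p).target, ∀ u v : Euc n,
    lieDeriv (fieldInChart X p) (formInChart Ω.form p) z u v = formInChart Ω.form p z ![u, v]

/-- The time `t` flow map of `X` is defined on all of `M` for each `t ≥ 0`: every point is the
starting point of an integral curve of `X` on `[0, ∞)`. -/
def IsForwardComplete (X : (x : M) → TangentSpace (𝓡 (2 * n)) x) : Prop :=
  ∀ x : M, ∃ γ : ℝ → M, γ 0 = x ∧ IsMIntegralCurveOn (I := 𝓡 (2 * n)) γ X (Set.Ici 0)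

/-- `(M, Ω)` is a forward complete Liouville manifold. -/
def IsForwardCompleteLiouville (Ω : SymplecticForm n M) : Prop :=
  ∃ X : (x : M) → TangentSpace (𝓡 (2 * n)) x, IsLiouvilleField Ω X ∧ IsForwardComplete X

/-- An extension of a map `B²ⁿ(b) → M` to all of `ℝ²ⁿ`. It only serves to speak of the derivatives
of the map within the ball, which do not depend on the values outside of the ball. -/
def extendMap {b : ℝ} (f : symplBall n b → M) : Euc n → M :=
  Function.extend Subtype.val f (fun _ => f ⟨0, zero_mem_symplBall n b⟩)

variable (n M) in
/-- The space `C^∞(B²ⁿ(b), M)` of smooth maps (smooth up to the boundary of the closed ball). -/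
structure SmoothMap (b : ℝ) where
  toFun : symplBall n b → M
  smooth : ContMDiffOn (𝓡 (2 * n)) (𝓡 (2 * n)) ∞ (extendMap toFun) (symplBall n b)

/-- The `k`-th derivative at `x ∈ B²ⁿ(b)` of the map `f` read in the chart of `M` at `p`.
It is meaningful if `f x` lies in the domain of that chart. -/
def chartDeriv {b : ℝ} (f : SmoothMap n M b) (p : M) (k : ℕ) (x : Euc n) :
    Euc n [×k]→L[ℝ] Euc n :=
  iteratedFDerivWithin ℝ k (fun y => extChartAt (𝓡 (2 * n)) p (extendMap f.toFun y)) (symplBall n b) x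

/-- `K` is mapped by `f` into the domain of the chart at `p`. -/
def MapsIntoChart {b : ℝ} (f : SmoothMap n M b) (p : M) (K : Set (Euc n)) : Prop :=
  ∀ x ∈ K, extendMap f.toFun x ∈ (chartAt (Euc n) p).source

/-- The subbasic neighbourhood of `f` given by a chart at `p`, a compact set `K` with `f(K)` in the
domain of the chart, an order of differentiation `k` and `ε > 0`. -/
def subbasicNhd {b : ℝ} (f : SmoothMap n M b) (p : M) (K : Set (Euc n)) (k : ℕ) (ε : ℝ) :
    Set (SmoothMap n M b) :=
  {g | MapsIntoChart g p K ∧ ∀ x ∈ K, ‖chartDeriv g p k x - chartDeriv f p k x‖ < ε}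

/-- The `C^∞`-topology: uniform convergence in charts, on compact sets, of the derivatives of
every order. -/
instance smoothTopology (b : ℝ) : TopologicalSpace (SmoothMap n M b) :=
  TopologicalSpace.generateFrom
    {N | ∃ (f : SmoothMap n M b) (p : M) (K : Set (Euc n)) (k : ℕ) (ε : ℝ),
      IsCompact K ∧ K ⊆ symplBall n b ∧ MapsIntoChart f p K ∧ 0 < ε ∧ N = subbasicNhd f p K k ε}

/-- `f : B²ⁿ(b) → (M, Ω)` is a symplectic embedding: a topological embedding with `f^*Ω = ωₙ`.
(The differential of `f` is then injective at every point, as `ωₙ` is non-degenerate.) -/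
structure IsSymplecticEmbedding (Ω : SymplecticForm n M) {b : ℝ} (f : SmoothMap n M b) :
    Prop where
  isEmbedding : Topology.IsEmbedding f.toFun
  pullback_eq : ∀ x ∈ symplBall n b, ∀ u v : Euc n,
    Ω.form (extendMap f.toFun x)
      ![mfderivWithin (𝓡 (2 * n)) (𝓡 (2 * n)) (extendMap f.toFun) (symplBall n b) x u,
        mfderivWithin (𝓡 (2 * n)) (𝓡 (2 * n)) (extendMap f.toFun) (symplBall n b) x v] = stdForm n u v

/-- The space `Emb(B²ⁿ(b), M, Ω)` of symplectic embeddings, with the `C^∞`-topology (as a subspace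
of `C^∞(B²ⁿ(b), M)`). -/
abbrev Emb (Ω : SymplecticForm n M) (b : ℝ) : Type _ :=
  {f : SmoothMap n M b // IsSymplecticEmbedding Ω f}

end Manifold

end SymplecticBall

end

/-! The forward flow `ψ` of the Liouville field satisfies `ψ_t^* Ω = e^t Ω`, so it can enlarge
balls. Put `R = √(b/π)`. If `f` embeds the ball of radius `r ≤ R` symplectically, then so does `x ↦
ψ_T (f ((r/R) x))` the ball of radius `R`, where `T = 2 log (R/r) ≥ 0`: the homothety multiplies
`ωₙ` by `(r/R)²` and the flow compensates (`IsSymplecticOn.exists_push`). Applied to a small Darboux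
ball, this gives an embedding of the given ball.

For connectedness, a smooth family of embeddings whose radius is allowed to vary is pushed to a path
in the space of embeddings of the fixed ball (`pushJoined_of_family`). Letting the radius shrink
joins any embedding to the push of a tiny ball inside a Darboux chart. There Alexander's trick
deforms the embedding to its affine part (`pushJoined_affine`), and a translation together with a
path in the connected linear symplectic group deforms that to the chart itself
(`pushJoined_affine_id`). Being joined is symmetric and transitive on the centres of Darboux balls
and holds for nearby centres, so it holds for all of them because `M` is connected.

Three analytic ingredients support this. Smooth dependence of solutions of differential equations
comes from the implicit function theorem in the space of continuous curves
(`exists_smooth_solutions`). A transport equation for a form integrates to a pullback formula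
(`pullback_of_transport`). These two yield the local conformal flow as well as Moser's argument for
Darboux charts, where the primitive of `Ω` is its contraction with the Liouville field. Finally,
joint continuity of the partial derivatives of a smooth family gives continuity in the
`C^∞`-topology (`continuous_of_smooth_family`). -/

set_option maxSynthPendingDepth 3

noncomputable section

namespace SymplecticBall

open Set Filter Topology Metric

/-! ### The Nemytskii operator -/

section Nemytskii

universe u v

variable {K : Type v} [TopologicalSpace K] [CompactSpace K]
  {E₁ E₂ : Type u} [NormedAddCommGroup E₁] [NormedSpace ℝ E₁]
  [NormedAddCommGroup E₂] [NormedSpace ℝ E₂]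

/-- The pointwise application of a continuous family of continuous linear maps, as a bilinear
map. -/
def applyFamilyₗ : C(K, E₁ →L[ℝ] E₂) →ₗ[ℝ] C(K, E₁) →ₗ[ℝ] C(K, E₂) :=
  LinearMap.mk₂ ℝ (M := C(K, E₁ →L[ℝ] E₂)) (Nₗ := C(K, E₁)) (Pₗ := C(K, E₂))
    (fun A h => ⟨fun k => A k (h k), A.continuous.clm_apply h.continuous⟩)
    (fun A B h => by ext; simp) (fun c A h => by ext; simp)
    (fun A h h' => by ext; simp) (fun c A h => by ext; simp)

lemma norm_applyFamilyₗ_le (A : C(K, E₁ →L[ℝ] E₂)) (h : C(K, E₁)) :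
    ‖applyFamilyₗ A h‖ ≤ 1 * ‖A‖ * ‖h‖ := by
  rw [one_mul]
  refine (ContinuousMap.norm_le _ (mul_nonneg (norm_nonneg A) (norm_nonneg h))).2 fun k => ?_
  exact (A k).le_of_opNorm_le_of_le (A.norm_coe_le_norm k) (h.norm_coe_le_norm k)

/-- The pointwise application of a continuous family of continuous linear maps. -/
def applyFamily : C(K, E₁ →L[ℝ] E₂) →L[ℝ] C(K, E₁) →L[ℝ] C(K, E₂) :=
  LinearMap.mkContinuous₂ (E := C(K, E₁ →L[ℝ] E₂)) (F := C(K, E₁)) (G := C(K, E₂))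
    (σ₁₃ := .id ℝ) (σ₂₃ := .id ℝ) applyFamilyₗ 1 norm_applyFamilyₗ_le

@[simp] lemma applyFamily_apply (A : C(K, E₁ →L[ℝ] E₂)) (h : C(K, E₁)) (k : K) :
    applyFamily A h k = A k (h k) := rfl

/-- The mean value inequality is applied at each `k` on a ball around `γ k`. Its radius does not
depend on `k`, because `γ ↦ v' ∘ γ` is continuous for uniform convergence. -/
lemma hasFDerivAt_postcomp {v : C(E₁, E₂)} {v' : C(E₁, E₁ →L[ℝ] E₂)}
    (hv : ∀ x, HasFDerivAt v (v' x) x) (γ : C(K, E₁)) :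
    HasFDerivAt (fun γ : C(K, E₁) => v.comp γ) (applyFamily (v'.comp γ)) γ := by
  rw [hasFDerivAt_iff_isLittleO, Asymptotics.isLittleO_iff]
  intro ε hε
  have hc : ContinuousAt (fun γ : C(K, E₁) => v'.comp γ) γ :=
    (ContinuousMap.continuous_postcomp v').continuousAt
  obtain ⟨δ, hδ, H⟩ := (Metric.continuousAt_iff (α := C(K, E₁))
    (β := C(K, E₁ →L[ℝ] E₂))).1 hc ε hε
  filter_upwards [Metric.ball_mem_nhds γ hδ] with η hη
  rw [ContinuousMap.norm_le _ (by positivity)]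
  intro k
  have hk : η k ∈ ball (γ k) δ := lt_of_le_of_lt (ContinuousMap.dist_apply_le_dist k) hη
  have key := Convex.norm_image_sub_le_of_norm_hasFDerivWithin_le' (f := v) (f' := v')
    (φ := v' (γ k)) (C := ε) (s := ball (γ k) δ) (x := γ k) (y := η k)
    (fun x _ => (hv x).hasFDerivWithinAt) (fun y hy => ?_) (convex_ball _ _)
    (mem_ball_self hδ) hk
  · refine (le_trans (le_of_eq ?_) key).trans ?_
    · simp
    · gcongr
      exact (η - γ).norm_coe_le_norm k
  -- A point `y` near `γ k` is the value at `k` of a translate of the whole curve, so the uniform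
  -- estimate on curves bounds `v' y - v' (γ k)`.
  · have h1 : dist (γ + ContinuousMap.const K (y - γ k)) γ < δ := by
      rw [dist_eq_norm, add_sub_cancel_left]
      refine lt_of_le_of_lt ?_ hy
      rw [ContinuousMap.norm_le _ dist_nonneg]
      intro _
      simp [dist_eq_norm]
    have h2 := lt_of_le_of_lt (ContinuousMap.dist_apply_le_dist k) (H h1)
    simp only [ContinuousMap.comp_apply, ContinuousMap.add_apply, ContinuousMap.const_apply,
      add_sub_cancel, dist_eq_norm] at h2
    exact h2.le

/-- By `hasFDerivAt_postcomp` the derivative of postcomposition with `v` is postcomposition with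
`v'` followed by a bounded linear map. The induction therefore passes from `v` to `v'` and has to
let the target space vary. -/
lemma contDiff_postcomp_nat (m : ℕ) : ∀ {E₂ : Type u} [NormedAddCommGroup E₂] [NormedSpace ℝ E₂]
    (v : C(E₁, E₂)), ContDiff ℝ ∞ v → ContDiff ℝ m (fun γ : C(K, E₁) => v.comp γ) := by
  induction m with
  | zero =>
    intro E₂ _ _ v hv
    exact contDiff_zero.2 (ContinuousMap.continuous_postcomp v)
  | succ m ih =>
    intro E₂ _ _ v hv
    have hd := contDiff_infty_iff_fderiv.1 hv
    let v' : C(E₁, E₁ →L[ℝ] E₂) := ⟨fderiv ℝ v, hd.2.continuous⟩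
    have h := hasFDerivAt_postcomp (K := K) (v := v) (v' := v')
      (fun x => (hd.1 x).hasFDerivAt)
    push_cast
    refine contDiff_succ_iff_hasFDerivAt.2 ⟨_, ?_, h⟩
    exact applyFamily.contDiff.comp (ih v' hd.2)

lemma contDiff_postcomp {v : C(E₁, E₂)} (hv : ContDiff ℝ ∞ v) :
    ContDiff ℝ ∞ (fun γ : C(K, E₁) => v.comp γ) :=
  contDiff_infty.2 fun m => contDiff_postcomp_nat m v hv

end Nemytskii

/-! ### Solutions of ordinary differential equations depend smoothly on parameters -/

section ODE

variable {E : Type} [NormedAddCommGroup E] [NormedSpace ℝ E]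

open unitInterval

/-- Integration from `0` as an operator on the continuous curves on the unit interval. -/
def integralOp : C(I, E) →L[ℝ] C(I, E) :=
  LinearMap.mkContinuous
    { toFun := fun f => ⟨fun t => ∫ s in (0 : ℝ)..t, IccExtend zero_le_one f s,
        (intervalIntegral.continuous_primitive (fun a b =>
          (f.continuous.Icc_extend' (h := zero_le_one)).intervalIntegrable a b) 0).comp
          continuous_subtype_val⟩
      map_add' := fun f g => by
        ext t
        exact intervalIntegral.integral_add
          ((f.continuous.Icc_extend' (h := zero_le_one)).intervalIntegrable _ _)
          ((g.continuous.Icc_extend' (h := zero_le_one)).intervalIntegrable _ _)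
      map_smul' := fun c f => by
        ext t
        exact intervalIntegral.integral_smul c (IccExtend zero_le_one f) }
    1 (fun f => by
      rw [ContinuousMap.norm_le _ (by positivity), one_mul]
      intro t
      refine (intervalIntegral.norm_integral_le_of_norm_le_const (C := ‖f‖) fun s _ =>
        f.norm_coe_le_norm _).trans ?_
      rw [sub_zero, abs_of_nonneg t.2.1]
      exact mul_le_of_le_one_right (norm_nonneg _) t.2.2)

lemma integralOp_apply (f : C(I, E)) (t : I) :
    integralOp f t = ∫ s in (0 : ℝ)..t, IccExtend zero_le_one f s := rfl

@[simp] lemma integralOp_apply_zero (f : C(I, E)) : integralOp f 0 = 0 := by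
  simp [integralOp_apply]

lemma hasDerivWithinAt_integralOp [CompleteSpace E] (f : C(I, E)) {t : ℝ} (ht : t ∈ Icc (0 : ℝ) 1) :
    HasDerivWithinAt (fun t => IccExtend zero_le_one (integralOp f) t) (f ⟨t, ht⟩) (Icc 0 1) t := by
  have hc : Continuous (IccExtend zero_le_one f) := f.continuous.Icc_extend'
  have h := (hc.integral_hasStrictDerivAt 0 t).hasDerivAt.hasDerivWithinAt (s := Icc 0 1)
  rw [IccExtend_of_mem _ _ ht] at h
  refine h.congr (fun s hs => ?_) ?_
  · simp only [IccExtend_of_mem _ _ hs, integralOp_apply]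
  · simp only [IccExtend_of_mem _ _ ht, integralOp_apply]

/-- The curve `s ↦ (p, s, γ s)`, for a curve `γ` on the unit interval. -/
def graphCurve : ℝ × C(I, E) →L[ℝ] C(I, ℝ × ℝ × E) :=
  LinearMap.mkContinuous
    { toFun := fun z => ⟨fun s => (z.1, 0, z.2 s), by fun_prop⟩
      map_add' := fun f g => by ext <;> simp
      map_smul' := fun c f => by ext <;> simp }
    1 (fun z => by
      rw [ContinuousMap.norm_le _ (by positivity), one_mul]
      intro t
      refine max_le (le_max_left _ _) (max_le (by simp) ?_)
      exact (z.2.norm_coe_le_norm t).trans (le_max_right _ _))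

/-- The affine part of `γ ↦ (s ↦ (p, s, γ s))`, whose linear part is `graphCurve`. -/
def timeCurve : C(I, ℝ × ℝ × E) := ⟨fun s => (0, s, 0), by fun_prop⟩

lemma graphCurve_add_timeCurve_apply (p : ℝ) (γ : C(I, E)) (s : I) :
    (graphCurve (p, γ) + timeCurve : C(I, ℝ × ℝ × E)) s = (p, (s : ℝ), γ s) := by
  change ((p, 0, γ s) : ℝ × ℝ × E) + (0, (s : ℝ), 0) = _
  simp

/-- The curve `s ↦ V (p, s, γ s)`. -/
def fieldAlong (V : C(ℝ × ℝ × E, E)) (p : ℝ) (γ : C(I, E)) : C(I, E) :=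
  V.comp (graphCurve (p, γ) + timeCurve : C(I, ℝ × ℝ × E))

lemma fieldAlong_apply (V : C(ℝ × ℝ × E, E)) (p : ℝ) (γ : C(I, E)) (s : I) :
    fieldAlong V p γ s = V (p, s, γ s) := by
  rw [fieldAlong, ContinuousMap.comp_apply, graphCurve_add_timeCurve_apply]

lemma contDiff_fieldAlong {V : C(ℝ × ℝ × E, E)} (hV : ContDiff ℝ ∞ V) :
    ContDiff ℝ ∞ (fun z : ℝ × C(I, E) => fieldAlong V z.1 z.2) :=
  (contDiff_postcomp (K := I) hV).comp
    (f := fun z : ℝ × C(I, E) => (graphCurve z + timeCurve : C(I, ℝ × ℝ × E)))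
    ((graphCurve (E := E)).contDiff.add contDiff_const)

/-- The derivative of `V (p, s, y)` in `y`. -/
def spaceDeriv (V : ℝ × ℝ × E → E) (z : ℝ × ℝ × E) : E →L[ℝ] E :=
  fderiv ℝ V z ∘L .inr ℝ ℝ (ℝ × E) ∘L .inr ℝ ℝ E

lemma hasFDerivAt_fieldAlong {V : C(ℝ × ℝ × E, E)} (hV : ContDiff ℝ ∞ V) (p : ℝ) (γ : C(I, E)) :
    ∃ A : C(I, E →L[ℝ] E), (∀ s : I, A s = spaceDeriv V (p, s, γ s)) ∧
      HasFDerivAt (fun γ => fieldAlong V p γ) (applyFamily A) γ := by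
  have hd := contDiff_infty_iff_fderiv.1 hV
  let V' : C(ℝ × ℝ × E, ℝ × ℝ × E →L[ℝ] E) := ⟨fderiv ℝ V, hd.2.continuous⟩
  have h1 := hasFDerivAt_postcomp (K := I) (v := V) (v' := V')
      (fun x => (hd.1 x).hasFDerivAt) (graphCurve (p, γ) + timeCurve : C(I, ℝ × ℝ × E))
  have h2 : HasFDerivAt (fun γ : C(I, E) => (graphCurve (p, γ) + timeCurve : C(I, ℝ × ℝ × E)))
      (graphCurve ∘L .inr ℝ ℝ C(I, E)) γ :=
    ((graphCurve (E := E)).hasFDerivAt.comp γ (hasFDerivAt_prodMk_right p γ)).add_const _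
  refine ⟨⟨fun s => spaceDeriv V (p, s, γ s), ?_⟩, fun s => rfl, ?_⟩
  · unfold spaceDeriv
    have := hd.2.continuous
    fun_prop
  · refine (h1.comp γ h2).congr_fderiv ?_
    ext h s
    simp only [ContinuousLinearMap.comp_apply, applyFamily_apply, ContinuousMap.comp_apply,
      graphCurve_add_timeCurve_apply]
    rfl

/-- Solutions of `γ' = V (p, s, γ)` on the unit interval depend smoothly on the parameter `p` and on
the initial value, near a constant solution along which `V` vanishes to second order in `y`. -/
theorem exists_smooth_solutions [CompleteSpace E] {V : C(ℝ × ℝ × E, E)} (hV : ContDiff ℝ ∞ V)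
    (p₀ : ℝ) (y₀ : E)
    (h0 : ∀ s : I, V (p₀, s, y₀) = 0) (h1 : ∀ s : I, spaceDeriv V (p₀, s, y₀) = 0) :
    ∃ Γ : ℝ × E → C(I, E), (∀ᶠ z in 𝓝 (p₀, y₀), ContDiffAt ℝ ∞ Γ z) ∧
      Γ (p₀, y₀) = ContinuousMap.const I y₀ ∧
      ∀ᶠ z in 𝓝 (p₀, y₀), Γ z =
        ContinuousMap.const I z.2 + integralOp (fieldAlong V z.1 (Γ z)) := by
  let constL : E →L[ℝ] C(I, E) := ContinuousLinearMap.const ℝ I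
  -- The zeros of `G` are the solutions of the integral equation with parameter `p` and initial
  -- value `y`. The curve is found as an implicit function of `(p, y)`.
  let G : (ℝ × E) × C(I, E) → C(I, E) := fun w =>
    w.2 - (constL w.1.2 + integralOp (fieldAlong V w.1.1 w.2))
  have hG : ContDiff ℝ ∞ G := by
    have := contDiff_fieldAlong hV
    have h3 : ContDiff ℝ ∞ (fun w : (ℝ × E) × C(I, E) => fieldAlong V w.1.1 w.2) :=
      this.comp (contDiff_fst.fst.prodMk contDiff_snd)
    have h4 : ContDiff ℝ ∞
        (fun w : (ℝ × E) × C(I, E) => integralOp (fieldAlong V w.1.1 w.2)) :=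
      (integralOp (E := E)).contDiff.comp h3
    have h5 : ContDiff ℝ ∞ (fun w : (ℝ × E) × C(I, E) => constL w.1.2) :=
      constL.contDiff.comp contDiff_fst.snd
    exact contDiff_snd.sub (h5.add h4)
  let u : (ℝ × E) × C(I, E) := ((p₀, y₀), ContinuousMap.const I y₀)
  have hf : fieldAlong V p₀ (ContinuousMap.const I y₀) = 0 := by
    ext s; simp [fieldAlong_apply, h0]
  have hGu : G u = 0 := by
    simp only [G, u, hf, map_zero, add_zero]
    ext s; simp [constL]
  -- Since `V` has vanishing space derivative along the constant solution, the linearization in the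
  -- curve is the identity and no Volterra operator has to be inverted.
  have hder : fderiv ℝ G u ∘L .inr ℝ (ℝ × E) C(I, E) = .id ℝ C(I, E) := by
    obtain ⟨A, hA, hA'⟩ := hasFDerivAt_fieldAlong hV p₀ (ContinuousMap.const I y₀)
    have hA0 : A = 0 := by ext1 s; rw [hA]; exact h1 s
    have e1 : HasFDerivAt (fun γ => G ((p₀, y₀), γ)) (fderiv ℝ G u ∘L .inr ℝ (ℝ × E) C(I, E))
        (ContinuousMap.const I y₀) :=
      ((hG.differentiable (by simp) u).hasFDerivAt).comp _ (hasFDerivAt_prodMk_right _ _)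
    have e2 : HasFDerivAt (fun γ => G ((p₀, y₀), γ))
        (.id ℝ C(I, E) - integralOp ∘L applyFamily A) (ContinuousMap.const I y₀) :=
      (hasFDerivAt_id _).sub (((integralOp (E := E)).hasFDerivAt.comp _ hA').const_add (constL y₀))
    rw [e1.unique e2, hA0]
    simp
  have hinv : (fderiv ℝ G u ∘L .inr ℝ (ℝ × E) C(I, E)).IsInvertible := by
    rw [hder]; exact ⟨.refl ℝ _, rfl⟩
  have hGu' : ContDiffAt ℝ ∞ G u := hG.contDiffAt
  set Γ := hGu'.implicitFunction (by simp) hinv with hΓ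
  have hΓu : Γ (p₀, y₀) = ContinuousMap.const I y₀ := hGu'.implicitFunction_apply_self _ hinv
  have hΓs : ContDiffAt ℝ ∞ Γ (p₀, y₀) := hGu'.contDiffAt_implicitFunction _ hinv
  have hΓe : ∀ᶠ z in 𝓝 (p₀, y₀), G (z, Γ z) = 0 := by
    have := hGu'.eventually_apply_implicitFunction (by simp) hinv
    rwa [hGu] at this
  refine ⟨Γ, ?_, hΓu, hΓe.mono fun z hz => sub_eq_zero.1 hz⟩
  -- Being `C^∞` at one point only gives `C^m` on neighbourhoods that may shrink with `m`. To get
  -- `C^∞` at nearby points, the implicit function theorem is applied again at `(z, Γ z)`, where the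
  -- partial derivative is still invertible, and local uniqueness identifies the new solution with
  -- `Γ`.
  have hcont : ContinuousAt (fun z => fderiv ℝ G (z, Γ z) ∘L .inr ℝ (ℝ × E) C(I, E)) (p₀, y₀) := by
    have h1 : Continuous (fderiv ℝ G) := hG.continuous_fderiv (by simp)
    have h2 : ContinuousAt (fun z => (z, Γ z)) (p₀, y₀) := continuousAt_id.prodMk hΓs.continuousAt
    exact (h1.continuousAt.comp h2).clm_comp continuousAt_const
  have hinv' : ∀ᶠ z in 𝓝 (p₀, y₀),
      (fderiv ℝ G (z, Γ z) ∘L .inr ℝ (ℝ × E) C(I, E)).IsInvertible := by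
    refine hcont.eventually ?_
    obtain ⟨e, he⟩ := hinv
    beta_reduce
    rw [hΓu]
    change ∀ᶠ A in 𝓝 (fderiv ℝ G u ∘L .inr ℝ (ℝ × E) C(I, E)), _
    rw [← he]
    exact e.nhds
  have h1 : ∀ᶠ z in 𝓝 (p₀, y₀), ContDiffAt ℝ 1 Γ z := (hΓs.of_le (by simp)).eventually (by simp)
  filter_upwards [hinv', hΓe.eventually_nhds, h1] with z hz hz' hz1
  have hGz : ContDiffAt ℝ ∞ G (z, Γ z) := hG.contDiffAt
  refine (hGz.contDiffAt_implicitFunction (by simp) hz).congr_of_eventuallyEq ?_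
  have h2 : ContinuousAt (fun z => (z, Γ z)) z := continuousAt_id.prodMk hz1.continuousAt
  filter_upwards [hz', h2.eventually (hGz.eventually_apply_eq_iff_implicitFunction (by simp) hz)]
    with w hw hw'
  exact (hw'.1 (by rw [hw, hz'.self_of_nhds])).symm

end ODE

/-! ### Transport of bilinear forms along solutions of differential equations -/

section LieTransport

variable {E : Type} [NormedAddCommGroup E] [NormedSpace ℝ E]

/-- A 2-form as a bilinear map. -/
def bilin : (E [⋀^Fin 2]→L[ℝ] ℝ) →L[ℝ] E →L[ℝ] E →L[ℝ] ℝ :=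
  (ContinuousLinearMap.compL ℝ E (E [×1]→L[ℝ] ℝ) (E →L[ℝ] ℝ)
    ((continuousMultilinearCurryFin1 ℝ E ℝ).toContinuousLinearEquiv :
      (E [×1]→L[ℝ] ℝ) →L[ℝ] E →L[ℝ] ℝ)) ∘L
  (((continuousMultilinearCurryLeftEquiv ℝ (fun _ : Fin 2 => E) ℝ).toContinuousLinearEquiv :
    (E [×2]→L[ℝ] ℝ) →L[ℝ] E →L[ℝ] (E [×1]→L[ℝ] ℝ))) ∘L
  ContinuousAlternatingMap.toContinuousMultilinearMapCLM ℝ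

@[simp] lemma bilin_apply (η : E [⋀^Fin 2]→L[ℝ] ℝ) (u v : E) : bilin η u v = η ![u, v] := by
  change η (Fin.cons u (Fin.snoc 0 v)) = _
  congr 1
  ext i
  fin_cases i <;> rfl

lemma hasFDerivAt_bilin (η : E [⋀^Fin 2]→L[ℝ] ℝ) :
    HasFDerivAt (fun η : E [⋀^Fin 2]→L[ℝ] ℝ => bilin η) bilin η :=
  ContinuousLinearMap.hasFDerivAt (F := E →L[ℝ] E →L[ℝ] ℝ) bilin

lemma contDiff_bilin {m : WithTop ℕ∞} :
    ContDiff ℝ m (fun η : E [⋀^Fin 2]→L[ℝ] ℝ => bilin η) :=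
  ContinuousLinearMap.contDiff (𝕜 := ℝ) (n := m) (E := E [⋀^Fin 2]→L[ℝ] ℝ)
    (F := E →L[ℝ] E →L[ℝ] ℝ) bilin

open unitInterval

/-- A bilinear form that satisfies the transport equation `∂ₛ Ω + 𝓛_V Ω = c Ω` along the solutions
of `γ' = V (p, s, γ)` is multiplied by `exp c` under pullback by the time one map. -/
theorem pullback_of_transport [CompleteSpace E] {V : C(ℝ × ℝ × E, E)} (hV : ContDiff ℝ ∞ V) (p : ℝ)
    {γ : E → C(I, E)} {x₀ : E} (hγ : DifferentiableAt ℝ γ x₀)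
    (heq : ∀ᶠ x in 𝓝 x₀, γ x = ContinuousMap.const I x + integralOp (fieldAlong V p (γ x)))
    {Ω : ℝ × E → E →L[ℝ] E →L[ℝ] ℝ} (hΩ : ∀ s : I, DifferentiableAt ℝ Ω ((s : ℝ), γ x₀ s)) {c : ℝ}
    (hLie : ∀ (s : I) (u v : E), fderiv ℝ Ω ((s : ℝ), γ x₀ s) (1, V (p, s, γ x₀ s)) u v
      + Ω ((s : ℝ), γ x₀ s) (spaceDeriv V (p, s, γ x₀ s) u) v
      + Ω ((s : ℝ), γ x₀ s) u (spaceDeriv V (p, s, γ x₀ s) v)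
      = c * Ω ((s : ℝ), γ x₀ s) u v) (u v : E) :
    Ω (1, γ x₀ 1) (fderiv ℝ (fun x => γ x 1) x₀ u) (fderiv ℝ (fun x => γ x 1) x₀ v)
      = Real.exp c * Ω (0, x₀) u v := by
  let constL : E →L[ℝ] C(I, E) := ContinuousLinearMap.const ℝ I
  set D : E →L[ℝ] C(I, E) := fderiv ℝ γ x₀
  obtain ⟨A, hA, hA'⟩ := hasFDerivAt_fieldAlong hV p (γ x₀)
  -- Differentiating the integral equation in the initial value gives the linearized equation in
  -- integral form: `s ↦ D w s` solves `J' = A J` with `J 0 = w`.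
  have hD : D = constL + integralOp ∘L applyFamily A ∘L D := by
    have e1 : HasFDerivAt (fun x => constL x + integralOp (fieldAlong V p (γ x)))
        (constL + integralOp ∘L applyFamily A ∘L D) x₀ :=
      constL.hasFDerivAt.add ((integralOp (E := E)).hasFDerivAt.comp x₀
        (hA'.comp x₀ hγ.hasFDerivAt))
    exact (hγ.hasFDerivAt.congr_of_eventuallyEq (heq.mono fun x hx => hx.symm)).unique e1
  have hγ0 : γ x₀ = constL x₀ + integralOp (fieldAlong V p (γ x₀)) := heq.self_of_nhds
  have hd1 : fderiv ℝ (fun x => γ x 1) x₀ = (ContinuousMap.evalCLM ℝ (1 : I)) ∘L D :=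
    (((ContinuousMap.evalCLM ℝ (1 : I) : C(I, E) →L[ℝ] E).hasFDerivAt).comp x₀
      hγ.hasFDerivAt).fderiv
  have hJ : ∀ w : E, ∀ t (ht : t ∈ Icc (0 : ℝ) 1), HasDerivWithinAt (IccExtend zero_le_one (D w))
      (A ⟨t, ht⟩ (D w ⟨t, ht⟩)) (Icc 0 1) t := by
    intro w t ht
    have e : D w = constL w + integralOp (applyFamily A (D w)) := by
      conv_lhs => rw [hD]
      rfl
    have h2 := (hasDerivWithinAt_integralOp (applyFamily A (D w)) ht).const_add w
    refine h2.congr (fun s hs => ?_) ?_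
    · rw [IccExtend_of_mem _ _ hs, IccExtend_of_mem _ _ hs]
      conv_lhs => rw [e]
      rfl
    · rw [IccExtend_of_mem _ _ ht, IccExtend_of_mem _ _ ht]
      conv_lhs => rw [e]
      rfl
  have hJ0 : ∀ w : E, D w 0 = w := by
    intro w
    conv_lhs => rw [hD]
    change w + integralOp _ 0 = w
    simp
  have hγ' : ∀ t (ht : t ∈ Icc (0 : ℝ) 1), HasDerivWithinAt (IccExtend zero_le_one (γ x₀))
      (V (p, t, γ x₀ ⟨t, ht⟩)) (Icc 0 1) t := by
    intro t ht
    have h2 := (hasDerivWithinAt_integralOp (fieldAlong V p (γ x₀)) ht).const_add x₀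
    rw [fieldAlong_apply] at h2
    refine h2.congr (fun s hs => ?_) ?_
    · rw [IccExtend_of_mem _ _ hs, IccExtend_of_mem _ _ hs]
      conv_lhs => rw [hγ0]
      rfl
    · rw [IccExtend_of_mem _ _ ht, IccExtend_of_mem _ _ ht]
      conv_lhs => rw [hγ0]
      rfl
  have hγ00 : γ x₀ 0 = x₀ := by
    conv_lhs => rw [hγ0]
    change x₀ + integralOp _ 0 = x₀
    simp
  -- The form on two solutions of the linearized equation, rescaled by `exp (-c t)`. The transport
  -- equation says that its derivative vanishes; comparing `t = 0` and `t = 1` gives the claim.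
  let g : ℝ → ℝ := fun t => Real.exp (-(c * t)) * Ω (t, IccExtend zero_le_one (γ x₀) t)
    (IccExtend zero_le_one (D u) t) (IccExtend zero_le_one (D v) t)
  have hg : ∀ t ∈ Icc (0 : ℝ) 1, HasDerivWithinAt g 0 (Icc 0 1) t := by
    intro t ht
    have k1 : HasDerivWithinAt (fun t => (t, IccExtend zero_le_one (γ x₀) t))
        ((1 : ℝ), V (p, t, γ x₀ ⟨t, ht⟩)) (Icc 0 1) t :=
      (hasDerivWithinAt_id t _).prodMk (hγ' t ht)
    have k2 : HasFDerivAt Ω (fderiv ℝ Ω (t, γ x₀ ⟨t, ht⟩))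
        (t, IccExtend zero_le_one (γ x₀) t) := by
      rw [IccExtend_of_mem _ _ ht]
      exact (hΩ ⟨t, ht⟩).hasFDerivAt
    have k3 : HasDerivWithinAt (fun t => Ω (t, IccExtend zero_le_one (γ x₀) t))
        (fderiv ℝ Ω (t, γ x₀ ⟨t, ht⟩) (1, V (p, t, γ x₀ ⟨t, ht⟩))) (Icc 0 1) t :=
      HasFDerivAt.comp_hasDerivWithinAt (l := Ω)
        (f := fun t => (t, IccExtend zero_le_one (γ x₀) t)) t k2 k1
    have k4 := (k3.clm_apply (hJ u t ht)).clm_apply (hJ v t ht)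
    have k5 : HasDerivWithinAt (fun t => Real.exp (-(c * t))) (Real.exp (-(c * t)) * -(c * 1))
        (Icc 0 1) t := ((((hasDerivAt_id t).const_mul c).neg).exp).hasDerivWithinAt
    refine (k5.mul k4).congr_deriv ?_
    have := hLie ⟨t, ht⟩ (D u ⟨t, ht⟩) (D v ⟨t, ht⟩)
    simp only [IccExtend_of_mem _ _ ht, add_apply, hA]
    simp only at this
    linear_combination (Real.exp (-(c * t))) * this
  have hconst := constant_of_derivWithin_zero (f := g) (a := 0) (b := 1)
    (fun t ht => (hg t ht).differentiableWithinAt) (fun t ht =>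
      (hg t ⟨ht.1, ht.2.le⟩).derivWithin (uniqueDiffOn_Icc zero_lt_one t ⟨ht.1, ht.2.le⟩))
      1 (right_mem_Icc.2 zero_le_one)
  have hl : (0 : ℝ) ∈ Icc (0 : ℝ) 1 := left_mem_Icc.2 zero_le_one
  have hr : (1 : ℝ) ∈ Icc (0 : ℝ) 1 := right_mem_Icc.2 zero_le_one
  simp only [g, IccExtend_of_mem _ _ hl, IccExtend_of_mem _ _ hr, mul_zero, mul_one,
    neg_zero, Real.exp_zero, one_mul] at hconst
  change Real.exp (-c) * Ω (1, γ x₀ 1) (D u 1) (D v 1) = Ω (0, γ x₀ 0) (D u 0) (D v 0) at hconst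
  rw [hJ0, hJ0, hγ00] at hconst
  rw [hd1, ← hconst, ← mul_assoc, ← Real.exp_add, add_neg_cancel, Real.exp_zero, one_mul]
  rfl

end LieTransport

/-! ### Forms, fields and curves in charts -/

section Charts

variable {n : ℕ} {M : Type*} [TopologicalSpace M] [ChartedSpace (Euc n) M]

lemma formInChart_apply (Ω : (x : M) → TangentSpace (𝓡 (2 * n)) x [⋀^Fin 2]→L[ℝ] ℝ) (p : M)
    (z u v : Euc n) : formInChart Ω p z ![u, v] = Ω ((extChartAt (𝓡 (2 * n)) p).symm z)
      ![mfderiv (𝓡 (2 * n)) (𝓡 (2 * n)) (extChartAt (𝓡 (2 * n)) p).symm z u,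
        mfderiv (𝓡 (2 * n)) (𝓡 (2 * n)) (extChartAt (𝓡 (2 * n)) p).symm z v] := by
  change Ω _ _ = Ω _ _
  congr 1
  ext i : 1
  fin_cases i <;> rfl

lemma isOpen_target (p : M) : IsOpen (extChartAt (𝓡 (2 * n)) p).target :=
  isOpen_extChartAt_target p

lemma fieldInChart_smul (X : (x : M) → TangentSpace (𝓡 (2 * n)) x) (a : ℝ) (p : M) (z : Euc n) :
    fieldInChart (fun x => a • X x) p z = a • fieldInChart X p z :=
  map_smul _ _ _

variable [IsManifold (𝓡 (2 * n)) ∞ M]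

lemma contMDiffAt_symm {p : M} {z : Euc n} (hz : z ∈ (extChartAt (𝓡 (2 * n)) p).target) :
    ContMDiffAt (𝓡 (2 * n)) (𝓡 (2 * n)) ∞ (extChartAt (𝓡 (2 * n)) p).symm z :=
  (contMDiffOn_extChartAt_symm p z hz).contMDiffAt ((isOpen_target p).mem_nhds hz)

lemma contMDiffAt_chart {p x : M} (hx : x ∈ (chartAt (Euc n) p).source) :
    ContMDiffAt (𝓡 (2 * n)) (𝓡 (2 * n)) ∞ (extChartAt (𝓡 (2 * n)) p) x :=
  contMDiffAt_extChartAt' hx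

lemma mfderiv_chart_symm {p : M} {z : Euc n} (hz : z ∈ (extChartAt (𝓡 (2 * n)) p).target)
    (u : Euc n) :
    mfderiv (𝓡 (2 * n)) (𝓡 (2 * n)) (extChartAt (𝓡 (2 * n)) p)
      ((extChartAt (𝓡 (2 * n)) p).symm z)
      (mfderiv (𝓡 (2 * n)) (𝓡 (2 * n)) (extChartAt (𝓡 (2 * n)) p).symm z u) = u := by
  have : IsManifold (𝓡 (2 * n)) 1 M := .of_le (n := ∞) (by simp)
  have h := mfderiv_extChartAt_comp_mfderivWithin_extChartAt_symm (I := 𝓡 (2 * n)) hz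
  rw [ModelWithCorners.range_eq_univ, mfderivWithin_univ] at h
  exact DFunLike.congr_fun h u

lemma mfderiv_symm_chart {p x : M} (hx : x ∈ (chartAt (Euc n) p).source)
    (u : TangentSpace (𝓡 (2 * n)) x) :
    mfderiv (𝓡 (2 * n)) (𝓡 (2 * n)) (extChartAt (𝓡 (2 * n)) p).symm
      (extChartAt (𝓡 (2 * n)) p x)
      (mfderiv (𝓡 (2 * n)) (𝓡 (2 * n)) (extChartAt (𝓡 (2 * n)) p) x u) = u := by
  have : IsManifold (𝓡 (2 * n)) 1 M := .of_le (n := ∞) (by simp)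
  have h := mfderivWithin_extChartAt_symm_comp_mfderiv_extChartAt' (I := 𝓡 (2 * n)) (x := p)
    (y := x) (by rwa [extChartAt_source])
  rw [ModelWithCorners.range_eq_univ, mfderivWithin_univ] at h
  exact DFunLike.congr_fun h u

lemma form_eq_formInChart (Ω : (x : M) → TangentSpace (𝓡 (2 * n)) x [⋀^Fin 2]→L[ℝ] ℝ) {p x : M}
    (hx : x ∈ (chartAt (Euc n) p).source) (u v : Euc n) :
    Ω x ![u, v] = formInChart Ω p (extChartAt (𝓡 (2 * n)) p x)
      ![mfderiv (𝓡 (2 * n)) (𝓡 (2 * n)) (extChartAt (𝓡 (2 * n)) p) x u,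
        mfderiv (𝓡 (2 * n)) (𝓡 (2 * n)) (extChartAt (𝓡 (2 * n)) p) x v] := by
  have hx' : (extChartAt (𝓡 (2 * n)) p).symm (extChartAt (𝓡 (2 * n)) p x) = x :=
    (extChartAt (𝓡 (2 * n)) p).left_inv (by rwa [extChartAt_source])
  refine Eq.trans ?_ (formInChart_apply Ω p _ _ _).symm
  have h : ∀ u : Euc n, _ = u := fun u => mfderiv_symm_chart hx u
  refine Eq.trans ?_ (congrArg₂ (fun a b : Euc n =>
    Ω ((extChartAt (𝓡 (2 * n)) p).symm (extChartAt (𝓡 (2 * n)) p x)) ![a, b]) (h u) (h v)).symm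
  rw [hx']

lemma mfderiv_symm_isInvertible {p : M} {z : Euc n}
    (hz : z ∈ (extChartAt (𝓡 (2 * n)) p).target) :
    (mfderiv (𝓡 (2 * n)) (𝓡 (2 * n)) (extChartAt (𝓡 (2 * n)) p).symm z).IsInvertible := by
  have : IsManifold (𝓡 (2 * n)) 1 M := .of_le (n := ∞) (by simp)
  have h := isInvertible_mfderivWithin_extChartAt_symm (I := 𝓡 (2 * n)) hz
  rwa [ModelWithCorners.range_eq_univ, mfderivWithin_univ] at h

lemma mfderiv_symm_fieldInChart (X : (x : M) → TangentSpace (𝓡 (2 * n)) x) {p : M} {z : Euc n}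
    (hz : z ∈ (extChartAt (𝓡 (2 * n)) p).target) :
    mfderiv (𝓡 (2 * n)) (𝓡 (2 * n)) (extChartAt (𝓡 (2 * n)) p).symm z (fieldInChart X p z)
      = X ((extChartAt (𝓡 (2 * n)) p).symm z) :=
  (mfderiv_symm_isInvertible hz).self_apply_inverse _

lemma fieldInChart_eq (X : (x : M) → TangentSpace (𝓡 (2 * n)) x) {p x : M}
    (hx : x ∈ (chartAt (Euc n) p).source) :
    fieldInChart X p (extChartAt (𝓡 (2 * n)) p x)
      = mfderiv (𝓡 (2 * n)) (𝓡 (2 * n)) (extChartAt (𝓡 (2 * n)) p) x (X x) := by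
  have hs : x ∈ (extChartAt (𝓡 (2 * n)) p).source := by rwa [extChartAt_source]
  have hx' : (extChartAt (𝓡 (2 * n)) p).symm (extChartAt (𝓡 (2 * n)) p x) = x :=
    (extChartAt (𝓡 (2 * n)) p).left_inv hs
  have h := mfderiv_symm_fieldInChart X ((extChartAt (𝓡 (2 * n)) p).map_source hs)
  have h2 := mfderiv_chart_symm ((extChartAt (𝓡 (2 * n)) p).map_source hs)
    (fieldInChart X p (extChartAt (𝓡 (2 * n)) p x))
  rw [← h2]
  erw [h]
  rw [hx']

lemma contDiffOn_fieldInChart {X : (x : M) → TangentSpace (𝓡 (2 * n)) x}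
    (hX : ContMDiff (𝓡 (2 * n)) (𝓡 (2 * n)).tangent ∞
      (fun x => (⟨x, X x⟩ : TangentBundle (𝓡 (2 * n)) M))) (p : M) :
    ContDiffOn ℝ ∞ (fieldInChart X p) (extChartAt (𝓡 (2 * n)) p).target := by
  intro z hz
  have h := ContMDiffAt.mpullback_vectorField_preimage (m := ∞) (n := ∞)
    (hX ((extChartAt (𝓡 (2 * n)) p).symm z)) (contMDiffAt_symm hz)
    (mfderiv_symm_isInvertible hz) (by simp)
  exact ((contMDiffAt_vectorSpace_iff_contDiffAt).1 h).contDiffWithinAt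

lemma hasDerivWithinAt_chart_comp {X : (x : M) → TangentSpace (𝓡 (2 * n)) x} {γ : ℝ → M}
    {s : Set ℝ} {t : ℝ} {p : M}
    (h : HasMFDerivWithinAt 𝓘(ℝ, ℝ) (𝓡 (2 * n)) γ s t ((1 : ℝ →L[ℝ] ℝ).smulRight (X (γ t))))
    (ht : γ t ∈ (chartAt (Euc n) p).source) :
    HasDerivWithinAt (fun t => extChartAt (𝓡 (2 * n)) p (γ t))
      (fieldInChart X p (extChartAt (𝓡 (2 * n)) p (γ t))) s t := by
  have h1 := ((contMDiffAt_chart ht).mdifferentiableAt (by simp)).hasMFDerivAt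
  have h2 : HasFDerivWithinAt (fun t => extChartAt (𝓡 (2 * n)) p (γ t))
      (ContinuousLinearMap.toSpanSingleton ℝ (fieldInChart X p (extChartAt (𝓡 (2 * n)) p (γ t))))
      s t := by
    refine ((h1.comp_hasMFDerivWithinAt t h).congr_mfderiv ?_).hasFDerivWithinAt
    rw [fieldInChart_eq X ht]
    ext
    change mfderiv (𝓡 (2 * n)) (𝓡 (2 * n)) (extChartAt (𝓡 (2 * n)) p) (γ t) ((1 : ℝ) • X (γ t))
      = (1 : ℝ) • mfderiv (𝓡 (2 * n)) (𝓡 (2 * n)) (extChartAt (𝓡 (2 * n)) p) (γ t) (X (γ t))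
    rw [one_smul, one_smul]
  exact h2.hasDerivWithinAt.congr_deriv (by simp)

lemma hasMFDerivWithinAt_symm_comp {X : (x : M) → TangentSpace (𝓡 (2 * n)) x} {c : ℝ → Euc n}
    {s : Set ℝ} {t : ℝ} {p : M} (h : HasDerivWithinAt c (fieldInChart X p (c t)) s t)
    (ht : c t ∈ (extChartAt (𝓡 (2 * n)) p).target) :
    HasMFDerivWithinAt 𝓘(ℝ, ℝ) (𝓡 (2 * n)) (fun t => (extChartAt (𝓡 (2 * n)) p).symm (c t)) s t
      ((1 : ℝ →L[ℝ] ℝ).smulRight (X ((extChartAt (𝓡 (2 * n)) p).symm (c t)))) := by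
  have h1 := ((contMDiffAt_symm ht).mdifferentiableAt (by simp)).hasMFDerivAt
  have h2 := h1.comp_hasMFDerivWithinAt t h.hasFDerivWithinAt.hasMFDerivWithinAt
  refine h2.congr_mfderiv ?_
  ext
  change mfderiv (𝓡 (2 * n)) (𝓡 (2 * n)) (extChartAt (𝓡 (2 * n)) p).symm (c t)
    ((1 : ℝ) • fieldInChart X p (c t)) = (1 : ℝ) • X _
  rw [one_smul, one_smul, mfderiv_symm_fieldInChart X ht]

/-- Two integral curves on the unit interval with the same starting point coincide. -/
theorem integralCurve_eqOn [T2Space M] {X : (x : M) → TangentSpace (𝓡 (2 * n)) x}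
    (hX : ∀ p : M, ContDiffOn ℝ ∞ (fieldInChart X p) (extChartAt (𝓡 (2 * n)) p).target)
    {γ₁ γ₂ : ℝ → M} (h₁ : IsMIntegralCurveOn (I := 𝓡 (2 * n)) γ₁ X (Icc 0 1))
    (h₂ : IsMIntegralCurveOn (I := 𝓡 (2 * n)) γ₂ X (Icc 0 1)) (h0 : γ₁ 0 = γ₂ 0) :
    EqOn γ₁ γ₂ (Icc 0 1) := by
  have c₁ := h₁.continuousOn
  have c₂ := h₂.continuousOn
  -- Continuous induction: the set of agreement is closed, and from a common point the curves agree
  -- slightly further by uniqueness for the Lipschitz field in the chart centred there.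
  refine IsClosed.Icc_subset_of_forall_exists_gt (s := {t | γ₁ t = γ₂ t}) ?_ h0 ?_
  · have := (c₁.prodMk c₂).preimage_isClosed_of_isClosed isClosed_Icc isClosed_diagonal
    convert this using 1
    ext t
    simp [and_comm]
  · rintro t ⟨ht, ht01⟩ y hy
    have htI : t ∈ Icc (0 : ℝ) 1 := ⟨ht01.1, ht01.2.le⟩
    set p := γ₁ t with hp
    have hpt : extChartAt (𝓡 (2 * n)) p p ∈ (extChartAt (𝓡 (2 * n)) p).target :=
      mem_extChartAt_target p
    obtain ⟨K, U, hU, hK⟩ := ((hX p).contDiffAt ((isOpen_target p).mem_nhds hpt)).of_le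
      (m := 1) (by simp) |>.exists_lipschitzOnWith
    have key : ∀ γ : ℝ → M, IsMIntegralCurveOn (I := 𝓡 (2 * n)) γ X (Icc 0 1) → γ t = p →
        ∀ᶠ s in 𝓝[Icc 0 1] t, γ s ∈ (chartAt (Euc n) p).source ∧
          extChartAt (𝓡 (2 * n)) p (γ s) ∈ U := by
      intro γ hγ hγt
      have hc : Tendsto γ (𝓝[Icc 0 1] t) (𝓝 p) := hγt ▸ hγ.continuousOn t htI
      have a := hc.eventually ((chartAt (Euc n) p).open_source.mem_nhds (mem_chart_source _ p))
      have b := hc.eventually ((continuousAt_extChartAt (I := 𝓡 (2 * n)) p).preimage_mem_nhds hU)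
      exact a.and b
    have hev := (key γ₁ h₁ rfl).and (key γ₂ h₂ ht.symm)
    rw [eventually_nhdsWithin_iff, Metric.eventually_nhds_iff] at hev
    obtain ⟨δ, hδ, hev⟩ := hev
    set r := min (min (t + δ / 2) 1) y with hr
    have htr : t < r := by
      simp only [hr, lt_min_iff]
      exact ⟨⟨by linarith, ht01.2⟩, hy⟩
    have hr1 : r ≤ 1 := (min_le_left _ _).trans (min_le_right _ _)
    have hrδ : r ≤ t + δ / 2 := (min_le_left _ _).trans (min_le_left _ _)
    have hin : ∀ s ∈ Icc t r, s ∈ Icc (0 : ℝ) 1 := fun s hs =>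
      ⟨ht01.1.trans hs.1, hs.2.trans hr1⟩
    have hnear : ∀ s ∈ Icc t r, dist s t < δ := fun s hs => by
      rw [Real.dist_eq, abs_of_nonneg (by linarith [hs.1])]
      linarith [hs.2]
    have hloc : ∀ γ : ℝ → M, IsMIntegralCurveOn (I := 𝓡 (2 * n)) γ X (Icc 0 1) →
        (∀ s ∈ Icc t r, γ s ∈ (chartAt (Euc n) p).source) →
        ∀ s ∈ Icc t r, HasDerivWithinAt (fun s => extChartAt (𝓡 (2 * n)) p (γ s))
          (fieldInChart X p (extChartAt (𝓡 (2 * n)) p (γ s))) (Icc t r) s := by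
      intro γ hγ hs s hs'
      exact (hasDerivWithinAt_chart_comp (hγ s (hin s hs')) (hs s hs')).mono
        (fun s hs => hin s hs)
    have m₁ : ∀ s ∈ Icc t r, _ := fun s hs => (hev (hnear s hs) (hin s hs)).1
    have m₂ : ∀ s ∈ Icc t r, _ := fun s hs => (hev (hnear s hs) (hin s hs)).2
    have d₁ := hloc γ₁ h₁ (fun s hs => (m₁ s hs).1)
    have d₂ := hloc γ₂ h₂ (fun s hs => (m₂ s hs).1)
    have := ODE_solution_unique_of_mem_Icc_right (v := fun _ => fieldInChart X p) (s := fun _ => U)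
      (K := K) (a := t) (b := r) (fun _ _ => hK)
      (fun s hs => (d₁ s hs).continuousWithinAt)
      (fun s hs => ((d₁ s ⟨hs.1, hs.2.le⟩).mono_of_mem_nhdsWithin (Icc_mem_nhdsGE_of_mem hs)))
      (fun s hs => (m₁ s ⟨hs.1, hs.2.le⟩).2)
      (fun s hs => (d₂ s hs).continuousWithinAt)
      (fun s hs => ((d₂ s ⟨hs.1, hs.2.le⟩).mono_of_mem_nhdsWithin (Icc_mem_nhdsGE_of_mem hs)))
      (fun s hs => (m₂ s ⟨hs.1, hs.2.le⟩).2) (by simp only [ht.symm, hp.symm])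
    have hrr : r ∈ Icc t r := right_mem_Icc.2 htr.le
    refine ⟨r, ?_, htr, min_le_right _ _⟩
    refine (extChartAt (𝓡 (2 * n)) p).injOn ?_ ?_ (this hrr)
    · rw [extChartAt_source]; exact (m₁ r hrr).1
    · rw [extChartAt_source]; exact (m₂ r hrr).1

end Charts

/-! ### The local flow of a Liouville field in a chart -/

/-- A map that is smooth on a neighbourhood of a closed set agrees near that set with a map that is
smooth on the whole space. -/
lemma exists_contDiff_eventuallyEq {F G : Type*} [NormedAddCommGroup F] [NormedSpace ℝ F]
    [FiniteDimensional ℝ F] [NormedAddCommGroup G] [NormedSpace ℝ G] {f : F → G} {U K : Set F}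
    (hU : IsOpen U) (hK : IsClosed K) (hKU : K ⊆ U) (hf : ContDiffOn ℝ ∞ f U) :
    ∃ g : F → G, ContDiff ℝ ∞ g ∧ ∀ᶠ x in 𝓝ˢ K, g x = f x := by
  obtain ⟨W, hW, hKW, hWU⟩ := normal_exists_closure_subset hK hU hKU
  obtain ⟨χ, hχ1, hχ0, -⟩ := exists_contMDiffMap_one_nhds_of_subset_interior (n := ⊤) 𝓘(ℝ, F)
    (s := K) (t := W) hK (by rwa [hW.interior_eq])
  refine ⟨fun x => χ x • f x, ?_, hχ1.mono fun x hx => by simp [hx]⟩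
  rw [contDiff_iff_contDiffAt]
  intro x
  by_cases hx : x ∈ closure W
  · exact (χ.contMDiff.contDiff.contDiffAt).smul (hf.contDiffAt (hU.mem_nhds (hWU hx)))
  · have : (fun x => χ x • f x) =ᶠ[𝓝 x] fun _ => 0 := by
      filter_upwards [isClosed_closure.isOpen_compl.mem_nhds hx] with y hy
      rw [hχ0 y (fun h => hy (subset_closure h)), zero_smul]
    exact contDiffAt_const.congr_of_eventuallyEq this

section LocalFlow

variable {n : ℕ} {M : Type*} [TopologicalSpace M] [ChartedSpace (Euc n) M]
  [IsManifold (𝓡 (2 * n)) ∞ M]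

open unitInterval

/-- The flow at time `a` is the time-one map of `a • X`, so time becomes a parameter, and at `a = 0`
the field vanishes with its derivative, as `exists_smooth_solutions` demands. The Liouville equation
multiplied by `a` is the transport equation with `c = a`, whence the factor `exp a`. The curve in
the conclusion serves to identify `θ` with the flow of `X` by uniqueness. -/
lemma exists_localFlow_inChart {Ω : SymplecticForm n M} {X : (x : M) → TangentSpace (𝓡 (2 * n)) x}
    (hX : IsLiouvilleField Ω X) (p : M) {z₀ : Euc n}
    (hz₀ : z₀ ∈ (extChartAt (𝓡 (2 * n)) p).target) :
    ∃ θ : ℝ × Euc n → Euc n, θ (0, z₀) = z₀ ∧ ∀ᶠ w in 𝓝 ((0 : ℝ), z₀), ContDiffAt ℝ ∞ θ w ∧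
      w.2 ∈ (extChartAt (𝓡 (2 * n)) p).target ∧ θ w ∈ (extChartAt (𝓡 (2 * n)) p).target ∧
      (∃ c : ℝ → Euc n, c 0 = w.2 ∧ c 1 = θ w ∧ ∀ t ∈ Icc (0 : ℝ) 1,
        c t ∈ (extChartAt (𝓡 (2 * n)) p).target ∧
        HasDerivWithinAt c (w.1 • fieldInChart X p (c t)) (Icc 0 1) t) ∧
      ∀ u v : Euc n, formInChart Ω.form p (θ w) ![fderiv ℝ (fun z => θ (w.1, z)) w.2 u,
          fderiv ℝ (fun z => θ (w.1, z)) w.2 v]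
        = Real.exp w.1 * formInChart Ω.form p w.2 ![u, v] := by
  obtain ⟨v, hv, hvX⟩ := exists_contDiff_eventuallyEq (isOpen_target p)
    (isClosed_singleton (x := z₀)) (singleton_subset_iff.2 hz₀)
    (contDiffOn_fieldInChart hX.smooth p)
  rw [nhdsSet_singleton] at hvX
  obtain ⟨δ, hδ, hball⟩ := Metric.eventually_nhds_iff_ball.1
    (hvX.and ((isOpen_target p).mem_nhds hz₀))
  let V : C(ℝ × ℝ × Euc n, Euc n) :=
    ⟨fun w => w.1 • v w.2.2, by have := hv.continuous; fun_prop⟩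
  have hV : ContDiff ℝ ∞ V := contDiff_fst.smul (hv.comp contDiff_snd.snd)
  have hVs : ∀ s t y, spaceDeriv V (s, t, y) = s • fderiv ℝ v y := by
    intro s t y
    have h1 : HasFDerivAt (fun y => V (s, t, y)) (spaceDeriv V (s, t, y)) y :=
      ((hV.differentiable (by simp) (s, t, y)).hasFDerivAt).comp y
        ((hasFDerivAt_prodMk_right s (t, y)).comp y (hasFDerivAt_prodMk_right t y))
    exact h1.unique (((hv.differentiable (by simp) y).hasFDerivAt).const_smul s)
  obtain ⟨Γ, hΓs, hΓ0, hΓe⟩ := exists_smooth_solutions hV 0 z₀ (fun s => zero_smul _ _)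
    (fun s => by rw [hVs]; exact zero_smul _ _)
  have hclose : ∀ᶠ w in 𝓝 ((0 : ℝ), z₀), ∀ t : I, Γ w t ∈ ball z₀ δ := by
    have hc := hΓs.self_of_nhds.continuousAt.eventually (Metric.ball_mem_nhds _ hδ)
    refine hc.mono fun w hw t => ?_
    rw [hΓ0] at hw
    exact lt_of_le_of_lt (ContinuousMap.dist_apply_le_dist (f := Γ w)
      (g := ContinuousMap.const I z₀) t) hw
  refine ⟨fun w => Γ w 1, by simp [hΓ0], ?_⟩
  filter_upwards [hΓs, hΓe.eventually_nhds, hclose] with w hw hwe hwc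
  have hwe' := hwe.self_of_nhds
  have hw0 : Γ w 0 = w.2 := by
    rw [hwe']
    change w.2 + integralOp _ 0 = w.2
    simp
  have hsm : ContDiffAt ℝ ∞ (fun w => Γ w 1) w :=
    ((ContinuousMap.evalCLM ℝ (1 : I) : C(I, Euc n) →L[ℝ] Euc n).contDiff.contDiffAt).comp w hw
  have hfield : ∀ t : I, v (Γ w t) = fieldInChart X p (Γ w t) := fun t => (hball _ (hwc t)).1
  have hfield' : ∀ t : I, fderiv ℝ v (Γ w t) = fderiv ℝ (fieldInChart X p) (Γ w t) := fun t =>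
    Filter.EventuallyEq.fderiv_eq (by
      filter_upwards [isOpen_ball.mem_nhds (hwc t)] with y hy using (hball y hy).1)
  refine ⟨hsm, ?_, (hball _ (hwc 1)).2, ⟨IccExtend zero_le_one (Γ w), ?_, ?_, fun t ht => ?_⟩,
    fun u u' => ?_⟩
  · rw [← hw0]
    exact (hball _ (hwc 0)).2
  · rw [IccExtend_left]
    exact hw0
  · rw [IccExtend_right]
    rfl
  · rw [IccExtend_of_mem _ _ ht]
    refine ⟨(hball _ (hwc _)).2, ?_⟩
    have h2 := (hasDerivWithinAt_integralOp (fieldAlong V w.1 (Γ w)) ht).const_add w.2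
    rw [fieldAlong_apply] at h2
    rw [← hfield]
    refine h2.congr (fun s hs => ?_) ?_
    · rw [IccExtend_of_mem _ _ hs, IccExtend_of_mem _ _ hs]
      conv_lhs => rw [hwe']
      rfl
    · rw [IccExtend_of_mem _ _ ht, IccExtend_of_mem _ _ ht]
      conv_lhs => rw [hwe']
      rfl
  · have hslice : Tendsto (fun z => (w.1, z)) (𝓝 w.2) (𝓝 w) :=
      (continuous_const.prodMk continuous_id).tendsto' _ _ rfl
    have hΩ : ∀ t : I, ContDiffAt ℝ ∞ (formInChart Ω.form p) (Γ w t) := fun t =>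
      (Ω.smooth p).contDiffAt ((isOpen_target p).mem_nhds (hball _ (hwc t)).2)
    have hΩ' : ∀ s : I, HasFDerivAt (fun y : ℝ × Euc n => bilin (formInChart Ω.form p y.2))
        (bilin ∘L fderiv ℝ (formInChart Ω.form p) (Γ w s) ∘L .snd ℝ ℝ (Euc n))
        ((s : ℝ), Γ w s) := fun s =>
      HasFDerivAt.comp (g := fun η : Euc n [⋀^Fin 2]→L[ℝ] ℝ => bilin η) ((s : ℝ), Γ w s)
        (hasFDerivAt_bilin _) (HasFDerivAt.comp (g := formInChart Ω.form p) (f := Prod.snd)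
          ((s : ℝ), Γ w s) ((hΩ s).differentiableAt (by simp)).hasFDerivAt hasFDerivAt_snd)
    have key := pullback_of_transport hV w.1 (γ := fun z => Γ (w.1, z)) (x₀ := w.2)
      (Ω := fun y => bilin (formInChart Ω.form p y.2)) (c := w.1)
      (((hw.differentiableAt (by simp)).comp w.2 (differentiableAt_const _ |>.prodMk
        differentiableAt_id)))
      (hslice.eventually hwe)
      (fun s => (hΩ' s).differentiableAt)
      (fun s u u' => by
        have e2 := hX.lieDeriv_eq p (Γ w s) (hball _ (hwc s)).2 u u'
        have e3 : V (w.1, (s : ℝ), Γ w s) = w.1 • fieldInChart X p (Γ w s) := by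
          rw [← hfield]; rfl
        change fderiv ℝ (fun y : ℝ × Euc n => bilin (formInChart Ω.form p y.2)) ((s : ℝ), Γ w s)
          (1, V (w.1, (s : ℝ), Γ w s)) u u'
          + bilin (formInChart Ω.form p (Γ w s)) (spaceDeriv V (w.1, s, Γ w s) u) u'
          + bilin (formInChart Ω.form p (Γ w s)) u (spaceDeriv V (w.1, s, Γ w s) u') =
          w.1 * bilin (formInChart Ω.form p (Γ w s)) u u'
        rw [(hΩ' s).fderiv, e3, hVs, hfield']
        simp only [lieDeriv, ← bilin_apply] at e2
        simp only [ContinuousLinearMap.comp_apply, ContinuousLinearMap.coe_snd', map_smul,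
          smul_apply, smul_eq_mul]
        linear_combination w.1 * e2) u u'
    simp only [bilin_apply] at key
    exact key

end LocalFlow

/-! ### The forward flow of a Liouville field -/

section Flow

variable {n : ℕ} {M : Type*} [TopologicalSpace M] [ChartedSpace (Euc n) M]

/-- `f` is conformally symplectic at `x`, with factor `c`: `f^*Ω = c Ω` at `x`. -/
def IsConformalAt (Ω : SymplecticForm n M) (f : M → M) (c : ℝ) (x : M) : Prop :=
  ∀ u v : Euc n, Ω.form (f x) ![mfderiv (𝓡 (2 * n)) (𝓡 (2 * n)) f x u,
    mfderiv (𝓡 (2 * n)) (𝓡 (2 * n)) f x v] = c * Ω.form x ![u, v]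

lemma IsConformalAt.comp {Ω : SymplecticForm n M} {f g : M → M} {c d : ℝ} {x : M}
    (hg : IsConformalAt Ω g d (f x)) (hf : IsConformalAt Ω f c x)
    (hgs : ContMDiffAt (𝓡 (2 * n)) (𝓡 (2 * n)) ∞ g (f x))
    (hfs : ContMDiffAt (𝓡 (2 * n)) (𝓡 (2 * n)) ∞ f x) :
    IsConformalAt Ω (g ∘ f) (d * c) x := by
  intro u v
  have h := mfderiv_comp x (hgs.mdifferentiableAt (by simp)) (hfs.mdifferentiableAt (by simp))
  rw [h, mul_assoc, ← hf u v]
  exact hg _ _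

lemma IsConformalAt.congr {Ω : SymplecticForm n M} {f g : M → M} {c : ℝ} {x : M}
    (hg : IsConformalAt Ω g c x) (h : f =ᶠ[𝓝 x] g) : IsConformalAt Ω f c x := by
  intro u v
  rw [h.mfderiv_eq, h.self_of_nhds]
  exact hg u v

/-- `ψ` is a forward flow of the field `X`. -/
structure IsForwardFlow (X : (x : M) → TangentSpace (𝓡 (2 * n)) x) (ψ : ℝ → M → M) : Prop where
  zero : ∀ x, ψ 0 x = x
  curve : ∀ x, IsMIntegralCurveOn (I := 𝓡 (2 * n)) (fun t => ψ t x) X (Ici 0)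

lemma IsForwardComplete.exists_flow {X : (x : M) → TangentSpace (𝓡 (2 * n)) x}
    (h : IsForwardComplete X) : ∃ ψ, IsForwardFlow X ψ := by
  choose γ h0 hγ using h
  exact ⟨fun t x => γ x t, h0, hγ⟩

/-- Negative `s` is allowed: a trajectory may be run backwards as long as its time stays
nonnegative. -/
lemma IsForwardFlow.reparam {X : (x : M) → TangentSpace (𝓡 (2 * n)) x} {ψ : ℝ → M → M}
    (hψ : IsForwardFlow X ψ) (x : M) {t s : ℝ} (ht : 0 ≤ t) (hts : 0 ≤ t + s) :
    IsMIntegralCurveOn (I := 𝓡 (2 * n)) (fun a => ψ (a * s + t) x) (s • X) (Icc 0 1) := by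
  refine (((hψ.curve x).comp_add t).comp_mul s).mono fun a ha => ?_
  change 0 ≤ a * s + t
  -- `a s + t = a (t + s) + (1 - a) t` is a convex combination of nonnegative times.
  nlinarith [mul_nonneg ha.1 hts, mul_nonneg (sub_nonneg.2 ha.2) ht]

variable [IsManifold (𝓡 (2 * n)) ∞ M] [T2Space M] {Ω : SymplecticForm n M}
  {X : (x : M) → TangentSpace (𝓡 (2 * n)) x} {ψ : ℝ → M → M}

/-- This substitutes for the group law, as the flow need not exist at negative times. For `s < 0`
the trajectory of `x` itself supplies the reversed curve with which `c` is compared. -/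
lemma IsForwardFlow.eq_of_curve (hX : IsLiouvilleField Ω X) (hψ : IsForwardFlow X ψ)
    {x : M} {t s : ℝ} (ht : 0 ≤ t) (hts : 0 ≤ t + s) {c : ℝ → M}
    (hc : IsMIntegralCurveOn (I := 𝓡 (2 * n)) c (s • X) (Icc 0 1)) (h0 : c 0 = ψ t x) :
    ψ (t + s) x = c 1 := by
  have h := integralCurve_eqOn (X := s • X) (fun p => ?_) hc (hψ.reparam x ht hts)
    (by simpa using h0)
    (right_mem_Icc.2 zero_le_one)
  · rw [h]
    simp only [one_mul, add_comm]
  · refine ((contDiffOn_fieldInChart hX.smooth p).const_smul s).congr fun z _ => ?_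
    exact fieldInChart_smul X s p z

/-- Trajectories that meet at time `t` can be run back for time `t`, and uniqueness makes their
starting points agree. -/
lemma IsForwardFlow.injective (hX : IsLiouvilleField Ω X) (hψ : IsForwardFlow X ψ) {t : ℝ}
    (ht : 0 ≤ t) : Function.Injective (ψ t) := by
  intro x y hxy
  have h := hψ.eq_of_curve hX (x := x) (t := t) (s := -t) ht (by simp)
    (hψ.reparam y ht (by simp)) (by simpa using hxy.symm)
  simpa [hψ.zero] using h

/-- Near every point and for small times, the flow is given by smooth conformally symplectic maps
that depend smoothly on the time. -/
lemma IsForwardFlow.exists_localFlow (hX : IsLiouvilleField Ω X) (hψ : IsForwardFlow X ψ) (y₀ : M) :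
    ∃ Φ : ℝ → M → M, ∃ ε > 0, ∃ N ∈ 𝓝 y₀,
      ContMDiffAt (𝓘(ℝ, ℝ).prod (𝓡 (2 * n))) (𝓡 (2 * n)) ∞ (fun w : ℝ × M => Φ w.1 w.2) (0, y₀) ∧
      Φ 0 y₀ = y₀ ∧ ∀ s, |s| < ε → ∀ y ∈ N, ContMDiffAt (𝓡 (2 * n)) (𝓡 (2 * n)) ∞ (Φ s) y ∧
        IsConformalAt Ω (Φ s) (Real.exp s) y ∧
        ∀ t x, 0 ≤ t → 0 ≤ t + s → ψ t x = y → ψ (t + s) x = Φ s y := by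
  set φ := extChartAt (𝓡 (2 * n)) y₀ with hφ
  obtain ⟨θ, hθ0, hθ⟩ := exists_localFlow_inChart hX y₀ (mem_extChartAt_target (I := 𝓡 (2 * n)) y₀)
  have hθs : ContDiffAt ℝ ∞ θ (0, φ y₀) := hθ.self_of_nhds.1
  have hc : Tendsto (fun w : ℝ × M => (w.1, φ w.2)) (𝓝 (0, y₀)) (𝓝 (0, φ y₀)) := by
    rw [nhds_prod_eq, nhds_prod_eq]
    exact tendsto_id.prodMap (continuousAt_extChartAt (I := 𝓡 (2 * n)) y₀)
  have he : ∀ᶠ w : ℝ × M in 𝓝 (0, y₀), w.2 ∈ (chartAt (Euc n) y₀).source :=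
    continuousAt_snd.eventually ((chartAt (Euc n) y₀).open_source.mem_nhds (mem_chart_source _ y₀))
  have hev := he.and (hc.eventually hθ)
  obtain ⟨A, hA, N, hN, hAN⟩ := mem_nhds_prod_iff.1 hev
  obtain ⟨ε, hε, hεA⟩ := Metric.mem_nhds_iff.1 hA
  refine ⟨fun s y => φ.symm (θ (s, φ y)), ε, hε, N, hN, ?_, ?_, fun s hs y hy => ?_⟩
  · have h1 : ContMDiffAt (𝓘(ℝ, ℝ).prod (𝓡 (2 * n))) 𝓘(ℝ, ℝ × Euc n) ∞
        (fun w : ℝ × M => (w.1, φ w.2)) (0, y₀) :=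
      contMDiffAt_fst.prodMk_space ((contMDiffAt_extChartAt (x := y₀)).comp _ contMDiffAt_snd)
    have h2 : ContMDiffAt (𝓘(ℝ, ℝ).prod (𝓡 (2 * n))) (𝓡 (2 * n)) ∞
        (fun w : ℝ × M => θ (w.1, φ w.2)) (0, y₀) :=
      (hθs.contMDiffAt).comp (I' := 𝓘(ℝ, ℝ × Euc n)) (0, y₀) h1
    exact ContMDiffAt.comp (I' := 𝓡 (2 * n)) (0, y₀) (contMDiffAt_symm hθ.self_of_nhds.2.2.1) h2
  · change φ.symm (θ (0, φ y₀)) = y₀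
    rw [hθ0]
    exact extChartAt_to_inv (I := 𝓡 (2 * n)) y₀
  · obtain ⟨hys, hsm, hyt, hθt, ⟨c, hc0, hc1, hc⟩, hconf⟩ :=
      @hAN (s, y) ⟨hεA (by simpa [Real.dist_eq] using hs), hy⟩
    change y ∈ _ at hys
    simp only [← hφ] at hsm hyt hθt hc0 hc1 hconf hc
    have hslice : ContDiffAt ℝ ∞ (fun z => θ (s, z)) (φ y) :=
      hsm.comp (φ y) (contDiffAt_const.prodMk contDiffAt_id)
    have m1 := contMDiffAt_chart hys
    have m2 : ContMDiffAt (𝓡 (2 * n)) (𝓡 (2 * n)) ∞ (fun z => θ (s, z)) (φ y) := hslice.contMDiffAt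
    have m3 := contMDiffAt_symm hθt
    have m23 : ContMDiffAt (𝓡 (2 * n)) (𝓡 (2 * n)) ∞ (fun z => φ.symm (θ (s, z))) (φ y) :=
      ContMDiffAt.comp (I' := 𝓡 (2 * n)) (φ y) m3 m2
    refine ⟨ContMDiffAt.comp (I' := 𝓡 (2 * n)) (g := fun z => φ.symm (θ (s, z))) (f := φ) y
      m23 m1, fun u v => ?_, fun t x ht hts hxy => ?_⟩
    · have d1 := mfderiv_comp (I' := 𝓡 (2 * n)) (g := fun z => φ.symm (θ (s, z))) (f := φ) y
        (m23.mdifferentiableAt (by simp)) (m1.mdifferentiableAt (by simp))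
      have d2 := mfderiv_comp (I' := 𝓡 (2 * n)) (g := φ.symm) (f := fun z => θ (s, z)) (φ y)
        (m3.mdifferentiableAt (by simp)) (m2.mdifferentiableAt (by simp))
      have d3 : ∀ u : Euc n, mfderiv (𝓡 (2 * n)) (𝓡 (2 * n)) (fun y => φ.symm (θ (s, φ y))) y u
          = mfderiv (𝓡 (2 * n)) (𝓡 (2 * n)) φ.symm (θ (s, φ y))
            (fderiv ℝ (fun z => θ (s, z)) (φ y) (mfderiv (𝓡 (2 * n)) (𝓡 (2 * n)) φ y u)) := by
        intro u
        rw [← mfderiv_eq_fderiv]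
        exact (DFunLike.congr_fun d1 u).trans (DFunLike.congr_fun d2 _)
      rw [form_eq_formInChart Ω.form hys]
      refine Eq.trans ?_ (hconf _ _)
      refine Eq.trans ?_ (formInChart_apply _ _ _ _ _).symm
      rw [d3 u, d3 v]
    · refine (hψ.eq_of_curve hX ht hts (c := fun a => φ.symm (c a)) (fun a ha => ?_) ?_).trans ?_
      · have := hasMFDerivWithinAt_symm_comp (X := s • X) (p := y₀) (c := c) (s := Icc 0 1) (t := a)
          (by
            refine (hc a ha).2.congr_deriv ?_
            exact (fieldInChart_smul X s y₀ (c a)).symm) (hc a ha).1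
        exact this
      · rw [hxy, hc0]
        exact φ.left_inv (by rwa [hφ, extChartAt_source])
      · rw [hc1]

/-- The half-line of times is connected and the property is locally constant in `t`. For times near
`t₀` one has `ψ (t + s) = Φ s ∘ ψ t` near `x₀`, with `Φ` the local flow at `ψ t₀ x₀`; `s` may have
either sign, so the property passes from `t₀` to nearby times and back. -/
lemma IsForwardFlow.smooth_and_conformal (hX : IsLiouvilleField Ω X) (hψ : IsForwardFlow X ψ)
    (x₀ : M) {t : ℝ} (ht : 0 ≤ t) : ContMDiffAt (𝓡 (2 * n)) (𝓡 (2 * n)) ∞ (ψ t) x₀ ∧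
      IsConformalAt Ω (ψ t) (Real.exp t) x₀ := by
  let P : ℝ → Prop := fun t => ContMDiffAt (𝓡 (2 * n)) (𝓡 (2 * n)) ∞ (ψ t) x₀ ∧
      IsConformalAt Ω (ψ t) (Real.exp t) x₀
  suffices h : P 0 ↔ P t by
    refine h.1 ⟨?_, fun u v => ?_⟩
    · exact contMDiffAt_id.congr_of_eventuallyEq (Eventually.of_forall fun x => hψ.zero x)
    · have h0 : ψ 0 = id := funext fun x => hψ.zero x
      rw [h0, Real.exp_zero, one_mul, mfderiv_id]
      rfl
  refine (isPreconnected_Ici (a := (0 : ℝ))).induction₂ (fun s t => (P s ↔ P t)) ?_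
    (fun _ _ _ _ _ _ => Iff.trans) (fun _ _ _ _ => Iff.symm) (self_mem_Ici (a := (0 : ℝ))) ht
  intro t₀ ht₀
  obtain ⟨Φ, ε, hε, N, hN, -, -, H⟩ := hψ.exists_localFlow hX (ψ t₀ x₀)
  obtain ⟨W, hWN, hW, hW0⟩ := mem_nhds_iff.1 hN
  have step : ∀ t s, 0 ≤ t → 0 ≤ t + s → |s| < ε → ψ t x₀ ∈ W → P t → P (t + s) := by
    intro t s ht hts hs htW hP
    have heq : ψ (t + s) =ᶠ[𝓝 x₀] Φ s ∘ ψ t := by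
      filter_upwards [hP.1.continuousAt.eventually (hW.mem_nhds htW)] with x hx
      exact (H s hs _ (hWN hx)).2.2 t x ht hts rfl
    obtain ⟨h1, h2, -⟩ := H s hs _ (hWN htW)
    refine ⟨(h1.comp x₀ hP.1).congr_of_eventuallyEq heq, ?_⟩
    have := (h2.comp hP.2 h1 hP.1).congr heq
    rwa [← Real.exp_add, add_comm s t] at this
  have e1 : ∀ᶠ t in 𝓝[Ici 0] t₀, ψ t x₀ ∈ W :=
    ((hψ.curve x₀).continuousOn t₀ ht₀).eventually (hW.mem_nhds hW0)
  have e2 : ∀ᶠ t in 𝓝[Ici 0] t₀, dist t t₀ < ε := nhdsWithin_le_nhds (Metric.ball_mem_nhds _ hε)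
  filter_upwards [e1, e2, self_mem_nhdsWithin] with t h1 h2 h3
  rw [Real.dist_eq] at h2
  constructor
  · intro h
    have := step t₀ (t - t₀) ht₀ (by simpa using h3) h2 hW0 h
    rwa [add_sub_cancel] at this
  · intro h
    have := step t (t₀ - t) h3 (by simpa using ht₀) (by rwa [abs_sub_comm]) h1 h
    rwa [add_sub_cancel] at this

/-- The flow read in charts is the restriction of a map that is smooth in time and space. -/
lemma IsForwardFlow.exists_smooth_inChart (hX : IsLiouvilleField Ω X) (hψ : IsForwardFlow X ψ)
    {t₀ : ℝ} (ht₀ : 0 ≤ t₀) {y₀ p q : M} (hp : y₀ ∈ (chartAt (Euc n) p).source)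
    (hq : ψ t₀ y₀ ∈ (chartAt (Euc n) q).source) :
    ∃ H : ℝ × Euc n → Euc n, ContDiffAt ℝ ∞ H (t₀, extChartAt (𝓡 (2 * n)) p y₀) ∧
      ∀ᶠ w in 𝓝 (t₀, y₀), 0 ≤ w.1 → ψ w.1 w.2 ∈ (chartAt (Euc n) q).source ∧
        extChartAt (𝓡 (2 * n)) q (ψ w.1 w.2) = H (w.1, extChartAt (𝓡 (2 * n)) p w.2) := by
  obtain ⟨Φ, ε, hε, N, hN, hΦ, hΦ0, hH⟩ := hψ.exists_localFlow hX (ψ t₀ y₀)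
  have hps : y₀ ∈ (extChartAt (𝓡 (2 * n)) p).source := by rwa [extChartAt_source]
  have hψs := (hψ.smooth_and_conformal hX y₀ ht₀).1
  -- `F` is smooth on a full neighbourhood, even of times below `0` when `t₀ = 0`, and equals the
  -- flow at the nonnegative times.
  let F : ℝ × M → M := fun w => Φ (w.1 - t₀) (ψ t₀ w.2)
  have hF : ContMDiffAt (𝓘(ℝ, ℝ).prod (𝓡 (2 * n))) (𝓡 (2 * n)) ∞ F (t₀, y₀) := by
    have h1 : ContMDiffAt (𝓘(ℝ, ℝ).prod (𝓡 (2 * n))) (𝓘(ℝ, ℝ).prod (𝓡 (2 * n))) ∞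
        (fun w : ℝ × M => (w.1 - t₀, ψ t₀ w.2)) (t₀, y₀) :=
      (contMDiffAt_fst.sub contMDiffAt_const).prodMk
        (ContMDiffAt.comp (I' := 𝓡 (2 * n)) (t₀, y₀) hψs contMDiffAt_snd)
    exact ContMDiffAt.comp_of_eq (x := (t₀, y₀)) hΦ h1 (by simp)
  have hF0 : F (t₀, y₀) = ψ t₀ y₀ := by simp [F, hΦ0]
  have hFψ : ∀ᶠ w in 𝓝 (t₀, y₀), 0 ≤ w.1 → ψ w.1 w.2 = F w := by
    have e1 : ∀ᶠ w : ℝ × M in 𝓝 (t₀, y₀), dist w.1 t₀ < ε :=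
      continuousAt_fst.eventually (Metric.ball_mem_nhds _ hε)
    have e2 : ∀ᶠ w : ℝ × M in 𝓝 (t₀, y₀), ψ t₀ w.2 ∈ N :=
      (hψs.continuousAt.comp (f := Prod.snd) (x := (t₀, y₀)) continuousAt_snd).eventually hN
    filter_upwards [e1, e2] with w h1 h2 h3
    have := (hH (w.1 - t₀) (by rwa [← Real.dist_eq]) _ h2).2.2 t₀ w.2 ht₀ (by simpa using h3) rfl
    rwa [add_sub_cancel] at this
  let H : ℝ × Euc n → Euc n := fun w =>
    extChartAt (𝓡 (2 * n)) q (F (w.1, (extChartAt (𝓡 (2 * n)) p).symm w.2))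
  refine ⟨H, ?_, ?_⟩
  · have hsymm : (extChartAt (𝓡 (2 * n)) p).symm (extChartAt (𝓡 (2 * n)) p y₀) = y₀ :=
      (extChartAt (𝓡 (2 * n)) p).left_inv hps
    have h1 : ContMDiffAt 𝓘(ℝ, ℝ × Euc n) (𝓘(ℝ, ℝ).prod (𝓡 (2 * n))) ∞
        (fun w : ℝ × Euc n => (w.1, (extChartAt (𝓡 (2 * n)) p).symm w.2))
        (t₀, extChartAt (𝓡 (2 * n)) p y₀) := by
      refine ContMDiffAt.prodMk contDiffAt_fst.contMDiffAt ?_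
      exact ContMDiffAt.comp (I' := 𝓡 (2 * n)) (t₀, extChartAt (𝓡 (2 * n)) p y₀)
        (contMDiffAt_symm ((extChartAt (𝓡 (2 * n)) p).map_source hps))
        contDiffAt_snd.contMDiffAt
    have h2 : ContMDiffAt 𝓘(ℝ, ℝ × Euc n) (𝓡 (2 * n)) ∞
        (fun w : ℝ × Euc n => F (w.1, (extChartAt (𝓡 (2 * n)) p).symm w.2))
        (t₀, extChartAt (𝓡 (2 * n)) p y₀) :=
      ContMDiffAt.comp_of_eq (x := (t₀, extChartAt (𝓡 (2 * n)) p y₀)) hF h1 (by simp only [hsymm])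
    refine ContMDiffAt.contDiffAt ?_
    exact ContMDiffAt.comp_of_eq (x := (t₀, extChartAt (𝓡 (2 * n)) p y₀))
      (contMDiffAt_chart (p := q) (x := ψ t₀ y₀) hq) h2 (by simp only [hsymm, hF0])
  · have e1 : ∀ᶠ w in 𝓝 (t₀, y₀), F w ∈ (chartAt (Euc n) q).source :=
      hF.continuousAt.eventually ((chartAt (Euc n) q).open_source.mem_nhds (by rwa [hF0]))
    have e2 : ∀ᶠ w : ℝ × M in 𝓝 (t₀, y₀), w.2 ∈ (chartAt (Euc n) p).source :=
      continuousAt_snd.eventually ((chartAt (Euc n) p).open_source.mem_nhds hp)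
    filter_upwards [hFψ, e1, e2] with w h1 h2 h3 h4
    rw [h1 h4]
    refine ⟨h2, ?_⟩
    have h5 : (extChartAt (𝓡 (2 * n)) p).symm (extChartAt (𝓡 (2 * n)) p w.2) = w.2 :=
      (extChartAt (𝓡 (2 * n)) p).left_inv (by rwa [extChartAt_source])
    simp only [H, h5]

end Flow

/-! ### Linear symplectic geometry -/

section Linear

variable {n : ℕ}

/-- The standard symplectic form as a bilinear map. -/
def stdBilin (n : ℕ) : Euc n →L[ℝ] Euc n →L[ℝ] ℝ :=
  ∑ j : Fin n, ((ContinuousLinearMap.smulRightL ℝ (Euc n) (Euc n →L[ℝ] ℝ)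
      (EuclideanSpace.proj ⟨2 * j, by omega⟩)) (EuclideanSpace.proj ⟨2 * j + 1, by omega⟩)
    - (ContinuousLinearMap.smulRightL ℝ (Euc n) (Euc n →L[ℝ] ℝ)
      (EuclideanSpace.proj ⟨2 * j + 1, by omega⟩)) (EuclideanSpace.proj ⟨2 * j, by omega⟩))

lemma stdBilin_apply (u v : Euc n) : stdBilin n u v = stdForm n u v := by
  simp [stdBilin, stdForm, sum_apply]

lemma stdForm_swap (u v : Euc n) : stdForm n u v = - stdForm n v u := by
  simp only [stdForm, ← Finset.sum_neg_distrib]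
  exact Finset.sum_congr rfl fun j _ => by ring

lemma stdForm_self (u : Euc n) : stdForm n u u = 0 := by
  linarith [stdForm_swap u u]

lemma stdForm_add_left (u v w : Euc n) : stdForm n (u + v) w = stdForm n u w + stdForm n v w := by
  simp [← stdBilin_apply]

lemma stdForm_add_right (u v w : Euc n) : stdForm n u (v + w) = stdForm n u v + stdForm n u w := by
  simp [← stdBilin_apply]

lemma stdForm_sub_left (u v w : Euc n) : stdForm n (u - v) w = stdForm n u w - stdForm n v w := by
  simp [← stdBilin_apply]

lemma stdForm_smul_left (c : ℝ) (u v : Euc n) : stdForm n (c • u) v = c * stdForm n u v := by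
  simp [← stdBilin_apply]

lemma stdForm_smul_right (c : ℝ) (u v : Euc n) : stdForm n u (c • v) = c * stdForm n u v := by
  simp [← stdBilin_apply]

/-- The basis vector of the coordinate `x_j`. -/
def basisX (j : Fin n) : Euc n := EuclideanSpace.single ⟨2 * j, by omega⟩ 1

/-- The basis vector of the coordinate `y_j`. -/
def basisY (j : Fin n) : Euc n := EuclideanSpace.single ⟨2 * j + 1, by omega⟩ 1

lemma stdForm_basisX (u : Euc n) (j : Fin n) :
    stdForm n u (basisX j) = - u ⟨2 * j + 1, by omega⟩ := by
  simp only [stdForm, basisX]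
  rw [Finset.sum_eq_single j]
  · simp
  · intro i _ hij
    have h1 : (i : ℕ) ≠ j := fun h => hij (Fin.ext h)
    rw [PiLp.single_apply, PiLp.single_apply, if_neg (by simp [Fin.ext_iff]; omega),
      if_neg (by simp [Fin.ext_iff]; omega)]
    simp
  · simp

lemma stdForm_basisY (u : Euc n) (j : Fin n) : stdForm n u (basisY j) = u ⟨2 * j, by omega⟩ := by
  simp only [stdForm, basisY]
  rw [Finset.sum_eq_single j]
  · simp
  · intro i _ hij
    have h1 : (i : ℕ) ≠ j := fun h => hij (Fin.ext h)
    rw [PiLp.single_apply, PiLp.single_apply, if_neg (by simp [Fin.ext_iff]; omega),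
      if_neg (by simp [Fin.ext_iff]; omega)]
    simp
  · simp

lemma exists_index (i : Fin (2 * n)) :
    ∃ j : Fin n, i = ⟨2 * j, by omega⟩ ∨ i = ⟨2 * j + 1, by omega⟩ := by
  refine ⟨⟨i / 2, by omega⟩, ?_⟩
  simp only [Fin.ext_iff]
  omega

lemma ext_of_stdForm {u v : Euc n} (hx : ∀ j, stdForm n u (basisX j) = stdForm n v (basisX j))
    (hy : ∀ j, stdForm n u (basisY j) = stdForm n v (basisY j)) : u = v := by
  ext i
  obtain ⟨j, rfl | rfl⟩ := exists_index i
  · simpa [stdForm_basisY] using hy j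
  · simpa [stdForm_basisX] using hx j

lemma stdForm_nondegenerate {u : Euc n} (h : ∀ v, stdForm n u v = 0) : u = 0 :=
  ext_of_stdForm (fun j => by rw [h, ← stdBilin_apply]; simp)
    (fun j => by rw [h, ← stdBilin_apply]; simp)

lemma eq_sum_basis (u : Euc n) : u = ∑ j : Fin n,
    (u ⟨2 * j, by omega⟩ • basisX j + u ⟨2 * j + 1, by omega⟩ • basisY j) := by
  ext i
  obtain ⟨k, rfl | rfl⟩ := exists_index i
  · simp only [basisX, basisY, WithLp.ofLp_sum, Finset.sum_apply, PiLp.add_apply, PiLp.smul_apply,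
      PiLp.single_apply, smul_eq_mul]
    rw [Finset.sum_eq_single k]
    · simp [Fin.ext_iff]
    · intro j _ hj
      have h1 : (j : ℕ) ≠ k := fun h => hj (Fin.ext h)
      rw [if_neg (by simp [Fin.ext_iff]; omega), if_neg (by simp [Fin.ext_iff]; omega)]
      simp
    · simp
  · simp only [basisX, basisY, WithLp.ofLp_sum, Finset.sum_apply, PiLp.add_apply, PiLp.smul_apply,
      PiLp.single_apply, smul_eq_mul]
    rw [Finset.sum_eq_single k]
    · simp [Fin.ext_iff]
    · intro j _ hj
      have h1 : (j : ℕ) ≠ k := fun h => hj (Fin.ext h)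
      rw [if_neg (by simp [Fin.ext_iff]; omega), if_neg (by simp [Fin.ext_iff]; omega)]
      simp
    · simp

/-- The linear symplectic maps. -/
def linearSymplectic (n : ℕ) : Set (Euc n →L[ℝ] Euc n) :=
  {A | ∀ u v, stdForm n (A u) (A v) = stdForm n u v}

/-- The linear symplectic maps that fix the first `k` pairs of basis vectors. -/
def symplecticFixing (n k : ℕ) : Set (Euc n →L[ℝ] Euc n) :=
  {A | A ∈ linearSymplectic n ∧ ∀ i : Fin n, (i : ℕ) < k → A (basisX i) = basisX i ∧
    A (basisY i) = basisY i}

/-- The symplectic complement of the first `k` pairs of basis vectors. -/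
def symplecticComplement (n k : ℕ) : Submodule ℝ (Euc n) where
  carrier := {w | ∀ i : Fin n, (i : ℕ) < k →
    stdForm n w (basisX i) = 0 ∧ stdForm n w (basisY i) = 0}
  zero_mem' := fun i _ => by simp [← stdBilin_apply]
  add_mem' := fun {a b} ha hb i hi => by
    rw [stdForm_add_left, stdForm_add_left, (ha i hi).1, (ha i hi).2, (hb i hi).1, (hb i hi).2]
    simp
  smul_mem' := fun c a ha i hi => by
    rw [stdForm_smul_left, stdForm_smul_left, (ha i hi).1, (ha i hi).2]
    simp

lemma basisX_mem_symplecticComplement {k : ℕ} {j : Fin n} (hj : k ≤ j) :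
    basisX j ∈ symplecticComplement n k := by
  intro i hi
  rw [stdForm_basisX, stdForm_basisY]
  simp only [basisX, PiLp.single_apply, Fin.ext_iff]
  rw [if_neg (by omega), if_neg (by omega)]
  simp

lemma basisY_mem_symplecticComplement {k : ℕ} {j : Fin n} (hj : k ≤ j) :
    basisY j ∈ symplecticComplement n k := by
  intro i hi
  rw [stdForm_basisX, stdForm_basisY]
  simp only [basisY, PiLp.single_apply, Fin.ext_iff]
  rw [if_neg (by omega), if_neg (by omega)]
  simp

lemma stdForm_basisX_basisY (j : Fin n) : stdForm n (basisX j) (basisY j) = 1 := by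
  rw [stdForm_basisY]; simp [basisX]

/-- A nonzero vector pairs nontrivially with some basis vector. A vector of the complement is
orthogonal to the first `k` pairs, and the remaining basis vectors lie in the complement. -/
lemma exists_stdForm_ne_zero {k : ℕ} {u : Euc n} (hu : u ∈ symplecticComplement n k) (h0 : u ≠ 0) :
    ∃ w ∈ symplecticComplement n k, stdForm n u w ≠ 0 := by
  by_contra! h
  refine h0 (ext_of_stdForm (fun j => ?_) (fun j => ?_))
  · rw [← stdBilin_apply 0, map_zero, zero_apply]
    by_cases hj : (j : ℕ) < k
    · exact (hu j hj).1
    · exact h _ (basisX_mem_symplecticComplement (not_lt.1 hj))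
  · rw [← stdBilin_apply 0, map_zero, zero_apply]
    by_cases hj : (j : ℕ) < k
    · exact (hu j hj).2
    · exact h _ (basisY_mem_symplecticComplement (not_lt.1 hj))

/-- The symplectic transvection `x ↦ x + c ω(w, x) w`. -/
def transvection (c : ℝ) (w : Euc n) : Euc n →L[ℝ] Euc n :=
  .id ℝ (Euc n) + c • (stdBilin n w).smulRight w

lemma transvection_apply (c : ℝ) (w x : Euc n) :
    transvection c w x = x + (c * stdForm n w x) • w := by
  simp [transvection, stdBilin_apply, smul_smul]

lemma transvection_comp_mem {k : ℕ} {A : Euc n →L[ℝ] Euc n} (hA : A ∈ symplecticFixing n k)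
    (c : ℝ) {w : Euc n} (hw : w ∈ symplecticComplement n k) :
    transvection c w ∘L A ∈ symplecticFixing n k := by
  refine ⟨fun u v => ?_, fun i hi => ⟨?_, ?_⟩⟩
  · simp only [ContinuousLinearMap.comp_apply, transvection_apply, stdForm_add_left,
      stdForm_add_right, stdForm_smul_left, stdForm_smul_right, stdForm_self]
    rw [hA.1, stdForm_swap (A u) w]
    ring
  · simp only [ContinuousLinearMap.comp_apply, transvection_apply, (hA.2 i hi).1, (hw i hi).1]
    simp
  · simp only [ContinuousLinearMap.comp_apply, transvection_apply, (hA.2 i hi).2, (hw i hi).2]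
    simp

/-- Scaling the coefficient `c` down to `0` stays among the symplectic transvections. -/
lemma joinedIn_transvection_comp {k : ℕ} {A : Euc n →L[ℝ] Euc n} (hA : A ∈ symplecticFixing n k)
    (c : ℝ) {w : Euc n} (hw : w ∈ symplecticComplement n k) :
    JoinedIn (symplecticFixing n k) A (transvection c w ∘L A) := by
  refine ⟨⟨⟨fun t => transvection (t * c) w ∘L A, ?_⟩, ?_, ?_⟩, fun t =>
    transvection_comp_mem hA _ hw⟩
  · unfold transvection
    fun_prop
  · ext1 u
    simp [transvection_apply]
  · simp

/-- With `w = v - u` one has `ω(w, u) = -ω(u, v)`, so the coefficient is chosen to make `c ω(w, u) =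
1`. -/
lemma transvection_sub_apply {u v : Euc n} (h : stdForm n u v ≠ 0) :
    transvection (-(stdForm n u v)⁻¹) (v - u) u = v := by
  rw [transvection_apply, stdForm_sub_left, stdForm_self, stdForm_swap v u, sub_zero]
  rw [neg_mul_neg, inv_mul_cancel₀ h, one_smul, add_sub_cancel]

/-- Moving the image of a vector by transvections. -/
lemma exists_joinedIn_apply_eq {k : ℕ} {A : Euc n →L[ℝ] Euc n} (hA : A ∈ symplecticFixing n k)
    {x v : Euc n} (hu : A x ∈ symplecticComplement n k) (hv : v ∈ symplecticComplement n k)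
    (hu0 : A x ≠ 0) (hv0 : v ≠ 0) :
    ∃ A', JoinedIn (symplecticFixing n k) A A' ∧ A' x = v := by
  have step : ∀ (A : Euc n →L[ℝ] Euc n) (v : Euc n), A ∈ symplecticFixing n k →
      A x ∈ symplecticComplement n k → v ∈ symplecticComplement n k → stdForm n (A x) v ≠ 0 →
      ∃ A', JoinedIn (symplecticFixing n k) A A' ∧ A' x = v := fun A v hA hu hv h =>
    ⟨_, joinedIn_transvection_comp hA _ (sub_mem hv hu), transvection_sub_apply h⟩
  -- One transvection does not suffice if `ω(A x, v) = 0`. The detour goes through a vector that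
  -- pairs nontrivially with both; if neither `w₁` nor `w₂` does, their sum does.
  obtain ⟨w, hw, h1, h2⟩ : ∃ w ∈ symplecticComplement n k, stdForm n (A x) w ≠ 0 ∧
      stdForm n v w ≠ 0 := by
    obtain ⟨w₁, hw₁, h₁⟩ := exists_stdForm_ne_zero hu hu0
    obtain ⟨w₂, hw₂, h₂⟩ := exists_stdForm_ne_zero hv hv0
    by_cases h₃ : stdForm n v w₁ = 0
    · by_cases h₄ : stdForm n (A x) w₂ = 0
      · refine ⟨w₁ + w₂, add_mem hw₁ hw₂, ?_, ?_⟩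
        · rwa [stdForm_add_right, h₄, add_zero]
        · rwa [stdForm_add_right, h₃, zero_add]
      · exact ⟨w₂, hw₂, h₄, h₂⟩
    · exact ⟨w₁, hw₁, h₁, h₃⟩
  obtain ⟨A₁, hA₁, e₁⟩ := step A w hA hu hw h1
  obtain ⟨A₂, hA₂, e₂⟩ := step A₁ v hA₁.target_mem (by rwa [e₁]) hv
    (by rw [e₁, stdForm_swap]; exact neg_ne_zero.2 h2)
  exact ⟨A₂, hA₁.trans hA₂, e₂⟩

/-- Moving the image of the second vector of a hyperbolic pair by transvections. -/
lemma exists_joinedIn_apply_eq_of_fix {k : ℕ} {A : Euc n →L[ℝ] Euc n}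
    (hA : A ∈ symplecticFixing n k) {x y v : Euc n} (hx : x ∈ symplecticComplement n k)
    (hAx : A x = x) (hu : A y ∈ symplecticComplement n k) (hv : v ∈ symplecticComplement n k)
    (hxy : stdForm n x (A y) = 1) (hxv : stdForm n x v = 1) :
    ∃ A', JoinedIn (symplecticFixing n k) A A' ∧ A' x = x ∧ A' y = v := by
  have step : ∀ (A : Euc n →L[ℝ] Euc n) (v : Euc n), A ∈ symplecticFixing n k →
      A x = x → A y ∈ symplecticComplement n k → v ∈ symplecticComplement n k →
      stdForm n x (A y) = 1 → stdForm n x v = 1 → stdForm n (A y) v ≠ 0 →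
      ∃ A', JoinedIn (symplecticFixing n k) A A' ∧ A' x = x ∧ A' y = v := by
    intro A v hA hAx hu hv h1 h2 h
    refine ⟨_, joinedIn_transvection_comp hA _ (sub_mem hv hu), ?_, transvection_sub_apply h⟩
    -- The transvection along `v - A y` fixes `x`, as `v` and `A y` have the same pairing with `x`.
    rw [ContinuousLinearMap.comp_apply, hAx, transvection_apply, stdForm_sub_left,
      stdForm_swap v, stdForm_swap (A y) x, h1, h2]
    simp
  -- In the degenerate case the detour is through `A y + x`, for which `ω(A y, A y + x) = -1`, `ω(A
  -- y + x, v) = 1` and `ω(x, A y + x) = 1`.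
  by_cases h : stdForm n (A y) v = 0
  · obtain ⟨A₁, hA₁, e₁, e₁'⟩ := step A (A y + x) hA hAx hu (add_mem hu hx) hxy
      (by rw [stdForm_add_right, hxy, stdForm_self, add_zero])
      (by rw [stdForm_add_right, stdForm_self, stdForm_swap, hxy]; norm_num)
    obtain ⟨A₂, hA₂, e₂⟩ := step A₁ v hA₁.target_mem e₁ (by rw [e₁']; exact add_mem hu hx) hv
      (by rw [e₁', stdForm_add_right, hxy, stdForm_self, add_zero]) hxv
      (by rw [e₁', stdForm_add_left, h, hxv]; norm_num)
    exact ⟨A₂, hA₁.trans hA₂, e₂⟩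
  · exact step A v hA hAx hu hv hxy hxv h

/-- Downward induction on `k`. A map that fixes all `n` pairs is the identity. A map that fixes the
first `k` pairs preserves their complement, where transvections move the images of the next two
basis vectors back to these vectors. -/
lemma joinedIn_symplecticFixing (k : ℕ) (hk : k ≤ n) {A : Euc n →L[ℝ] Euc n}
    (hA : A ∈ symplecticFixing n k) : JoinedIn (linearSymplectic n) A (.id ℝ (Euc n)) := by
  induction hk using Nat.decreasingInduction generalizing A with
  | self =>
    have : A = .id ℝ (Euc n) := by
      ext1 u
      conv_lhs => rw [eq_sum_basis u]
      conv_rhs => rw [eq_sum_basis u]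
      simp only [map_sum, map_add, map_smul, (hA.2 _ (Fin.is_lt _)).1, (hA.2 _ (Fin.is_lt _)).2,
        ContinuousLinearMap.id_apply]
    rw [← this]
    exact JoinedIn.refl hA.1
  | of_succ k hk ih =>
    let j : Fin n := ⟨k, hk⟩
    have hX : basisX j ∈ symplecticComplement n k := basisX_mem_symplecticComplement le_rfl
    have hY : basisY j ∈ symplecticComplement n k := basisY_mem_symplecticComplement le_rfl
    have hmem : ∀ B ∈ symplecticFixing n k, ∀ w ∈ symplecticComplement n k,
        B w ∈ symplecticComplement n k := by
      intro B hB w hw i hi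
      rw [← (hB.2 i hi).1, ← (hB.2 i hi).2, hB.1, hB.1]
      exact hw i hi
    have hX0 : basisX j ≠ 0 := fun h => by
      have := stdForm_basisX_basisY j
      rw [h, ← stdBilin_apply] at this
      simp at this
    have hAX0 : A (basisX j) ≠ 0 := fun h => by
      have := hA.1 (basisX j) (basisY j)
      rw [h, stdForm_basisX_basisY, ← stdBilin_apply] at this
      simp at this
    obtain ⟨A₁, h₁, e₁⟩ := exists_joinedIn_apply_eq hA (hmem A hA _ hX) hX hAX0 hX0
    have hA₁ := h₁.target_mem
    obtain ⟨A₂, h₂, e₂, e₂'⟩ := exists_joinedIn_apply_eq_of_fix hA₁ hX e₁ (hmem A₁ hA₁ _ hY) hY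
      (by
        have := hA₁.1 (basisX j) (basisY j)
        rwa [e₁, stdForm_basisX_basisY] at this) (stdForm_basisX_basisY j)
    have hA₂ : A₂ ∈ symplecticFixing n (k + 1) := by
      refine ⟨h₂.target_mem.1, fun i hi => ?_⟩
      rcases Nat.lt_succ_iff_lt_or_eq.1 hi with h | h
      · exact h₂.target_mem.2 i h
      · have : i = j := Fin.ext h
        rw [this]
        exact ⟨e₂, e₂'⟩
    exact ((h₁.trans h₂).mono fun B hB => hB.1).trans (ih hA₂)

/-- The linear symplectic group is path connected. -/
lemma joinedIn_linearSymplectic {A : Euc n →L[ℝ] Euc n} (hA : A ∈ linearSymplectic n) :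
    JoinedIn (linearSymplectic n) A (.id ℝ (Euc n)) :=
  joinedIn_symplecticFixing 0 (Nat.zero_le n) ⟨hA, fun _ h => absurd h (Nat.not_lt_zero _)⟩

/-! ### Symplectic bases -/

/-- Symplectic Gram–Schmidt: each step adds a hyperbolic pair orthogonal to the pairs already found.
-/
lemma exists_symplectic_family {B : Euc n →L[ℝ] Euc n →L[ℝ] ℝ} (hB : ∀ u, B u u = 0)
    (hnd : ∀ u, (∀ v, B u v = 0) → u = 0) (k : ℕ) (hk : k ≤ n) :
    ∃ a b : Fin k → Euc n, (∀ i j, B (a i) (a j) = 0) ∧ (∀ i j, B (b i) (b j) = 0) ∧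
      ∀ i j, B (a i) (b j) = if i = j then 1 else 0 := by
  have hsw : ∀ u v, B u v = - B v u := by
    intro u v
    have := hB (u + v)
    simp only [map_add, add_apply, hB] at this
    linarith
  induction k with
  | zero => exact ⟨Fin.elim0, Fin.elim0, fun i => i.elim0, fun i => i.elim0, fun i => i.elim0⟩
  | succ k ih =>
    obtain ⟨a, b, haa, hbb, hab⟩ := ih (by omega)
    let T : Euc n →ₗ[ℝ] (Fin k → ℝ) × (Fin k → ℝ) :=
      LinearMap.prod (LinearMap.pi fun i => (B (a i) : Euc n →ₗ[ℝ] ℝ))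
        (LinearMap.pi fun i => (B (b i) : Euc n →ₗ[ℝ] ℝ))
    -- The `2k` linear conditions have a nonzero common solution because `2k < 2n`.
    have hT : LinearMap.ker T ≠ ⊥ := LinearMap.ker_ne_bot_of_finrank_lt (by simp; omega)
    obtain ⟨w, hw, hw0⟩ := Submodule.exists_mem_ne_zero_of_ne_bot hT
    have hTw : T w = 0 := hw
    have hwa : ∀ i, B (a i) w = 0 := fun i => congrFun (congrArg Prod.fst hTw) i
    have hwb : ∀ i, B (b i) w = 0 := fun i => congrFun (congrArg Prod.snd hTw) i
    obtain ⟨v₀, hv₀⟩ : ∃ v, B w v = 1 := by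
      by_contra! h
      refine hw0 (hnd w fun v => ?_)
      by_contra hv
      exact h ((B w v)⁻¹ • v) (by simp [hv])
    -- The `B`-orthogonal projection of `v₀` to the complement of the earlier pairs. It leaves `B w
    -- v₀ = 1` unchanged since `w` is orthogonal to these pairs.
    let v := v₀ - ∑ i, B (a i) v₀ • b i + ∑ i, B (b i) v₀ • a i
    have hva : ∀ i, B (a i) v = 0 := by
      intro i
      simp [v, hab, haa]
    have hvb : ∀ i, B (b i) v = 0 := by
      intro i
      have hba : ∀ j, B (b i) (a j) = if j = i then -1 else 0 := fun j => by
        rw [hsw, hab]; split_ifs <;> simp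
      simp [v, hbb, hba]
    have hwv : B w v = 1 := by
      have h1 : ∀ i, B w (a i) = 0 := fun i => by rw [hsw, hwa, neg_zero]
      have h2 : ∀ i, B w (b i) = 0 := fun i => by rw [hsw, hwb, neg_zero]
      simp [v, hv₀, h1, h2]
    refine ⟨Fin.snoc a w, Fin.snoc b v, fun i j => ?_, fun i j => ?_, fun i j => ?_⟩
    · refine Fin.lastCases ?_ (fun i => ?_) i <;> refine Fin.lastCases ?_ (fun j => ?_) j <;>
        simp [hB, haa, hwa, hsw w]
    · refine Fin.lastCases ?_ (fun i => ?_) i <;> refine Fin.lastCases ?_ (fun j => ?_) j <;>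
        simp [hB, hbb, hvb, hsw v]
    · refine Fin.lastCases ?_ (fun i => ?_) i <;> refine Fin.lastCases ?_ (fun j => ?_) j
      · simp [hwv]
      · simp [hsw w, hwb, Fin.ext_iff]
        omega
      · simp [hva, Fin.ext_iff]
        omega
      · simp [hab]

/-- Every linear symplectic form on `ℝ²ⁿ` is linearly equivalent to the standard one. -/
lemma exists_linearEquiv_stdForm {B : Euc n →L[ℝ] Euc n →L[ℝ] ℝ} (hB : ∀ u, B u u = 0)
    (hnd : ∀ u, (∀ v, B u v = 0) → u = 0) :
    ∃ L : Euc n ≃L[ℝ] Euc n, ∀ u v, B (L u) (L v) = stdForm n u v := by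
  obtain ⟨a, b, haa, hbb, hab⟩ := exists_symplectic_family hB hnd n le_rfl
  have hba : ∀ i j, B (b i) (a j) = if i = j then -1 else 0 := by
    intro i j
    have := hB (b i + a j)
    simp only [map_add, add_apply, hB, hab] at this
    split_ifs at this ⊢ with h1 h2 h2
    · linarith
    · exact absurd h1.symm h2
    · exact absurd h2.symm h1
    · linarith
  let L₀ : Euc n →ₗ[ℝ] Euc n :=
    { toFun := fun u => ∑ j : Fin n, (u ⟨2 * j, by omega⟩ • a j + u ⟨2 * j + 1, by omega⟩ • b j)
      map_add' := fun u v => by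
        rw [← Finset.sum_add_distrib]
        exact Finset.sum_congr rfl fun j _ => by simp only [PiLp.add_apply]; module
      map_smul' := fun c u => by
        rw [Finset.smul_sum]
        exact Finset.sum_congr rfl fun j _ => by
          simp only [PiLp.smul_apply, smul_eq_mul, RingHom.id_apply]; module }
  have hL : ∀ u v, B (L₀ u) (L₀ v) = stdForm n u v := by
    intro u v
    simp only [L₀, LinearMap.coe_mk, AddHom.coe_mk, map_sum, map_add, map_smul, sum_apply,
      add_apply, smul_apply, haa, hbb, hab, hba, smul_eq_mul, stdForm]
    refine Finset.sum_congr rfl fun j _ => ?_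
    rw [Finset.sum_eq_single j]
    · simp; ring
    · intro i _ hij
      simp [hij]
    · simp
  have hinj : Function.Injective L₀ := by
    rw [injective_iff_map_eq_zero]
    intro u hu
    exact stdForm_nondegenerate fun v => by rw [← hL, hu]; simp
  exact ⟨(LinearEquiv.ofInjectiveEndo L₀ hinj).toContinuousLinearEquiv, fun u v => hL u v⟩

end Linear

/-! ### Moser's argument -/

section Moser

open unitInterval

variable {E : Type} [NormedAddCommGroup E] [NormedSpace ℝ E] [FiniteDimensional ℝ E]

/-- A symplectic form `B = dl` on an open set is near each point `z₀` the pullback of the constant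
form `B z₀` under a local diffeomorphism. -/
theorem exists_moser_map {U : Set E} (hU : IsOpen U) {z₀ : E} (hz₀ : z₀ ∈ U)
    {B : E → E →L[ℝ] E →L[ℝ] ℝ} (hB : ContDiffOn ℝ ∞ B U) {l : E → E →L[ℝ] ℝ}
    (hl : ContDiffOn ℝ ∞ l U) (hskew : ∀ y ∈ U, ∀ u v, B y u v = - B y v u)
    (hclosed : ∀ y ∈ U, ∀ a b c,
      fderiv ℝ B y a b c - fderiv ℝ B y b a c + fderiv ℝ B y c a b = 0)
    (hprim : ∀ y ∈ U, ∀ u v, fderiv ℝ l y u v - fderiv ℝ l y v u = B y u v)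
    (hinv : (B z₀).IsInvertible) :
    ∃ θ : E → E, θ z₀ = z₀ ∧ ∀ᶠ x in 𝓝 z₀, ContDiffAt ℝ ∞ θ x ∧ θ x ∈ U ∧
      ∀ u v, B (θ x) (fderiv ℝ θ x u) (fderiv ℝ θ x v) = B z₀ u v := by
  have : CompleteSpace E := FiniteDimensional.complete ℝ E
  set S := B z₀ with hS
  let Bt : ℝ × E → E →L[ℝ] E →L[ℝ] ℝ := fun w => S + w.1 • (B w.2 - S)
  -- The 1-form `y ↦ ½ S y` has differential `S`, so `dβ = B - S`. In `α` the first-order Taylor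
  -- polynomial of `β` at `z₀` is removed. This keeps `dα = B - S`, because the derivative of `β` at
  -- `z₀` is symmetric, and makes `α` vanish to second order at `z₀`.
  let β : E → E →L[ℝ] ℝ := fun y => l y - (1 / 2 : ℝ) • S y
  let α : E → E →L[ℝ] ℝ := fun y => β y - β z₀ - fderiv ℝ β z₀ (y - z₀)
  have hβs : ContDiffOn ℝ ∞ β U := hl.sub ((S.contDiff.const_smul (1 / 2 : ℝ)).contDiffOn)
  have hβd : ∀ y ∈ U, HasFDerivAt β (fderiv ℝ l y - (1 / 2 : ℝ) • S) y := fun y hy =>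
    (((hl.contDiffAt (hU.mem_nhds hy)).differentiableAt (by simp)).hasFDerivAt).sub
      (S.hasFDerivAt.const_smul (1 / 2 : ℝ))
  have hαs : ContDiffOn ℝ ∞ α U := (hβs.sub contDiffOn_const).sub
    ((fderiv ℝ β z₀).contDiff.comp (contDiff_id.sub contDiff_const)).contDiffOn
  have hαd : ∀ y ∈ U, HasFDerivAt α (fderiv ℝ l y - (1 / 2 : ℝ) • S - fderiv ℝ β z₀) y := by
    intro y hy
    exact ((hβd y hy).sub_const _).sub
      ((fderiv ℝ β z₀).hasFDerivAt.comp y ((hasFDerivAt_id y).sub_const z₀))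
  have hSskew : ∀ u v, S u v = - S v u := hskew z₀ hz₀
  have hαprim : ∀ y ∈ U, ∀ u v, fderiv ℝ α y u v - fderiv ℝ α y v u = B y u v - S u v := by
    intro y hy u v
    rw [(hαd y hy).fderiv, (hβd z₀ hz₀).fderiv]
    have h1 := hprim y hy u v
    have h2 := hprim z₀ hz₀ u v
    simp only [sub_apply, smul_apply, smul_eq_mul]
    rw [← hS] at h2
    linear_combination h1 - h2
  have hα0 : α z₀ = 0 := by simp [α]
  have hα0' : fderiv ℝ α z₀ = 0 := by
    rw [(hαd z₀ hz₀).fderiv, (hβd z₀ hz₀).fderiv, sub_self]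
  have hBts : ContDiffOn ℝ ∞ Bt (univ ×ˢ U) := by
    have h1 : ContDiffOn ℝ ∞ (fun w : ℝ × E => B w.2) (univ ×ˢ U) :=
      hB.comp contDiffOn_snd fun w hw => hw.2
    exact contDiffOn_const.add (contDiffOn_fst.smul (h1.sub contDiffOn_const))
  let W : Set (ℝ × E) := {w ∈ univ ×ˢ U | (Bt w).IsInvertible}
  have hopen : IsOpen {A : E →L[ℝ] E →L[ℝ] ℝ | A.IsInvertible} := by
    rw [isOpen_iff_mem_nhds]
    rintro A ⟨e, rfl⟩
    exact e.nhds
  have hW : IsOpen W :=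
    hBts.continuousOn.isOpen_inter_preimage (isOpen_univ.prod hU) hopen
  -- Moser's field, determined by `ι_Y B_t = -α`. It inherits second-order vanishing in space at
  -- `z₀`, which is the condition of `exists_smooth_solutions`.
  let Y : ℝ × E → E := fun w => -((Bt w).inverse (α w.2))
  have hYs : ContDiffOn ℝ ∞ Y W := by
    intro w hw
    have h1 : ContDiffAt ℝ ∞ Bt w := hBts.contDiffAt ((isOpen_univ.prod hU).mem_nhds hw.1)
    have h2 : ContDiffAt ℝ ∞ (fun w : ℝ × E => α w.2) w :=
      (hαs.contDiffAt (hU.mem_nhds hw.1.2)).comp w contDiffAt_snd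
    exact ((((hw.2.contDiffAt_map_inverse).comp w h1).clm_apply h2).neg).contDiffWithinAt
  have hBtY : ∀ w ∈ W, Bt w (Y w) = - α w.2 := fun w hw => by
    simp only [Y, map_neg]
    rw [hw.2.self_apply_inverse]
  let K : Set (ℝ × E) := Icc 0 1 ×ˢ {z₀}
  have hKW : K ⊆ W := by
    rintro ⟨t, y⟩ ⟨-, hy⟩
    obtain rfl : y = z₀ := hy
    refine ⟨⟨mem_univ _, hz₀⟩, ?_⟩
    simpa [Bt, ← hS] using hinv
  obtain ⟨V₀, hV₀, hV₀Y⟩ := exists_contDiff_eventuallyEq hW (isClosed_Icc.prod isClosed_singleton)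
    hKW hYs
  obtain ⟨O, hO, hKO, hOY⟩ := eventually_nhdsSet_iff_exists.1 hV₀Y
  -- The field depends on time and space only; the parameter is a dummy and is set to `0`.
  let V : C(ℝ × ℝ × E, E) := ⟨fun w => V₀ w.2, by have := hV₀.continuous; fun_prop⟩
  have hV : ContDiff ℝ ∞ V := hV₀.comp contDiff_snd
  have hVs : ∀ s t y, spaceDeriv V (s, t, y) = fderiv ℝ V₀ (t, y) ∘L .inr ℝ ℝ E := by
    intro s t y
    have h1 : fderiv ℝ V (s, t, y) = fderiv ℝ V₀ (t, y) ∘L .snd ℝ ℝ (ℝ × E) :=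
      (((hV₀.differentiable (by simp) (t, y)).hasFDerivAt).comp (s, t, y)
        (hasFDerivAt_snd (𝕜 := ℝ) (E := ℝ) (F := ℝ × E))).fderiv
    rw [spaceDeriv, h1]
    rfl
  have hV₀d : ∀ w ∈ O, fderiv ℝ V₀ w = fderiv ℝ Y w := fun w hw =>
    Filter.EventuallyEq.fderiv_eq (by
      filter_upwards [hO.mem_nhds hw] with y hy using hOY y hy)
  have hYd : ∀ w ∈ W, HasFDerivAt Y (fderiv ℝ Y w) w := fun w hw =>
    ((hYs.contDiffAt (hW.mem_nhds hw)).differentiableAt (by simp)).hasFDerivAt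
  have hBd : ∀ y ∈ U, HasFDerivAt B (fderiv ℝ B y) y := fun y hy =>
    ((hB.contDiffAt (hU.mem_nhds hy)).differentiableAt (by simp)).hasFDerivAt
  have hBtd : ∀ w ∈ W, HasFDerivAt Bt
      ((w.1 • (fderiv ℝ B w.2 ∘L .snd ℝ ℝ E)) +
        (ContinuousLinearMap.fst ℝ ℝ E).smulRight (B w.2 - S)) w := by
    intro w hw
    have h1 : HasFDerivAt (fun w : ℝ × E => B w.2 - S) (fderiv ℝ B w.2 ∘L .snd ℝ ℝ E) w :=
      ((hBd w.2 hw.1.2).comp w hasFDerivAt_snd).sub_const S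
    exact (hasFDerivAt_fst.smul h1).const_add S
  have hBtYd : ∀ w ∈ W, ∀ u v, w.1 * fderiv ℝ B w.2 u (Y w) v + Bt w (fderiv ℝ Y w (0, u)) v
      = - fderiv ℝ α w.2 u v := by
    intro w hw u v
    have h1 := (hBtd w hw).clm_apply (hYd w hw)
    have h2 : HasFDerivAt (fun w : ℝ × E => - α w.2) (-(fderiv ℝ α w.2 ∘L .snd ℝ ℝ E)) w :=
      ((((hαs.contDiffAt (hU.mem_nhds hw.1.2)).differentiableAt (by simp)).hasFDerivAt).comp w
        hasFDerivAt_snd).neg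
    have h3 := h1.unique (h2.congr_of_eventuallyEq (by
      filter_upwards [hW.mem_nhds hw] with y hy using hBtY y hy))
    have h4 := DFunLike.congr_fun (DFunLike.congr_fun h3 (0, u)) v
    simp at h4
    linarith
  have hY0 : ∀ t ∈ Icc (0 : ℝ) 1, Y (t, z₀) = 0 := fun t ht => by simp [Y, hα0]
  have hY0' : ∀ t ∈ Icc (0 : ℝ) 1, fderiv ℝ Y (t, z₀) ∘L .inr ℝ ℝ E = 0 := by
    intro t ht
    have hw : (t, z₀) ∈ W := hKW ⟨ht, rfl⟩
    ext1 u
    have h1 : Bt (t, z₀) (fderiv ℝ Y (t, z₀) (0, u)) = 0 := by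
      ext1 v
      have := hBtYd _ hw u v
      simpa [hY0 t ht, hα0'] using this
    have h2 := congrArg (Bt (t, z₀)).inverse h1
    rw [hw.2.inverse_apply_self, map_zero] at h2
    exact h2
  have hsO : ∀ s : I, ((s : ℝ), z₀) ∈ O := fun s =>
    hKO (show ((s : ℝ), z₀) ∈ Icc (0 : ℝ) 1 ×ˢ {z₀} from ⟨s.2, rfl⟩)
  obtain ⟨Γ, hΓs, hΓ0, hΓe⟩ := exists_smooth_solutions hV 0 z₀
    (fun s => by
      change V₀ ((s : ℝ), z₀) = 0
      rw [hOY _ (hsO s), hY0 _ s.2])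
    (fun s => by rw [hVs, hV₀d _ (hsO s), hY0' _ s.2])
  -- A neighbourhood of `z₀` that works for all times in `[0, 1]`: solutions that stay in it see the
  -- true field `Y` and an invertible `B_t`.
  obtain ⟨A, N, -, hN, hA, hN0, hAN⟩ := generalized_tube_lemma isCompact_Icc isCompact_singleton
    (hO.inter hW) (fun w hw => ⟨hKO hw, hKW hw⟩)
  obtain ⟨δ, hδ, hδN⟩ := Metric.mem_nhds_iff.1 (hN.mem_nhds (singleton_subset_iff.1 hN0))
  have hslice : Tendsto (fun z : E => ((0 : ℝ), z)) (𝓝 z₀) (𝓝 (0, z₀)) :=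
    (continuous_const.prodMk continuous_id).tendsto' _ _ rfl
  have hclose : ∀ᶠ w in 𝓝 ((0 : ℝ), z₀), ∀ t : I, ((t : ℝ), Γ w t) ∈ O ∩ W := by
    have hc := hΓs.self_of_nhds.continuousAt.eventually (Metric.ball_mem_nhds _ hδ)
    refine hc.mono fun w hw t => hAN ⟨hA t.2, hδN ?_⟩
    rw [hΓ0] at hw
    exact lt_of_le_of_lt (ContinuousMap.dist_apply_le_dist (f := Γ w)
      (g := ContinuousMap.const I z₀) t) hw
  refine ⟨fun x => Γ (0, x) 1, by simp [hΓ0], ?_⟩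
  filter_upwards [hslice.eventually hΓs, hslice.eventually hΓe.eventually_nhds,
    hslice.eventually hclose] with x hx hxe hxc
  have hxs : ContDiffAt ℝ ∞ (fun x => Γ (0, x)) x :=
    hx.comp x (contDiffAt_const.prodMk contDiffAt_id)
  refine ⟨((ContinuousMap.evalCLM ℝ (1 : I) : C(I, E) →L[ℝ] E).contDiff.contDiffAt).comp x hxs,
    (hxc 1).2.1.2, fun u v => ?_⟩
  have hsl : Tendsto (fun z : E => ((0 : ℝ), z)) (𝓝 x) (𝓝 (0, x)) :=
    (continuous_const.prodMk continuous_id).tendsto' _ _ rfl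
  have key := pullback_of_transport hV 0 (γ := fun z => Γ (0, z)) (x₀ := x) (Ω := Bt) (c := 0)
    (hxs.differentiableAt (by simp)) (hsl.eventually hxe)
    (fun s => (hBtd _ (hxc s).2).differentiableAt) (fun s u v => by
      obtain ⟨hsO, hsW⟩ := hxc s
      have e0 : V (0, (s : ℝ), Γ (0, x) s) = Y ((s : ℝ), Γ (0, x) s) := hOY _ hsO
      rw [(hBtd _ hsW).fderiv, e0, hVs, hV₀d _ hsO]
      set y := Γ (0, x) s
      have hyU : y ∈ U := hsW.1.2
      have e1 := hBtYd _ hsW u v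
      have e2 := hBtYd _ hsW v u
      have e3 := hαprim y hyU u v
      have e4 := hclosed y hyU (Y ((s : ℝ), y)) u v
      have e5 : Bt ((s : ℝ), y) u (fderiv ℝ Y ((s : ℝ), y) (0, v))
          = - Bt ((s : ℝ), y) (fderiv ℝ Y ((s : ℝ), y) (0, v)) u := by
        simp only [Bt, add_apply, smul_apply, sub_apply, smul_eq_mul]
        rw [hSskew, hskew y hyU]
        ring
      simp only [add_apply, smul_apply, sub_apply, smul_eq_mul, ContinuousLinearMap.comp_apply,
        ContinuousLinearMap.smulRight_apply, ContinuousLinearMap.coe_snd',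
        ContinuousLinearMap.coe_fst', ContinuousLinearMap.inr_apply, one_mul, zero_mul]
      simp only at e1 e2
      rw [e5]
      -- Moser's computation: since `dB_t = 0`, Cartan's formula gives `∂_t B_t + 𝓛_Y B_t = (B - S)
      -- + d(ι_Y B_t) = (B - S) - dα = 0`.
      linear_combination (s : ℝ) * e4 + e1 - e2 - e3) u v
  simp only [Real.exp_zero, one_mul] at key
  have k1 : ∀ y, Bt (1, y) = B y := fun y => by simp [Bt]
  have k0 : ∀ y, Bt (0, y) = S := fun y => by simp [Bt]
  rw [k1, k0] at key
  exact key

end Moser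

/-! ### Darboux charts -/

section Darboux

variable {n : ℕ} {M : Type*} [TopologicalSpace M] [ChartedSpace (Euc n) M]

lemma isInvertible_of_injective {E F : Type*} [NormedAddCommGroup E] [NormedSpace ℝ E]
    [FiniteDimensional ℝ E] [NormedAddCommGroup F] [NormedSpace ℝ F] [FiniteDimensional ℝ F]
    {f : E →L[ℝ] F} (hf : ∀ u, f u = 0 → u = 0)
    (hd : Module.finrank ℝ E = Module.finrank ℝ F) : f.IsInvertible :=
  ⟨(LinearMap.linearEquivOfInjective (f : E →ₗ[ℝ] F)
    ((injective_iff_map_eq_zero _).2 hf) hd).toContinuousLinearEquiv, by ext; rfl⟩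

/-- A symplectic parametrization of an open subset of `M`. -/
structure IsDarbouxChart (Ω : SymplecticForm n M) (e : OpenPartialHomeomorph (Euc n) M) : Prop where
  smooth : ∀ z ∈ e.source, ContMDiffAt (𝓡 (2 * n)) (𝓡 (2 * n)) ∞ e z
  smooth_symm : ∀ x ∈ e.target, ContMDiffAt (𝓡 (2 * n)) (𝓡 (2 * n)) ∞ e.symm x
  pullback_eq : ∀ z ∈ e.source, ∀ u v : Euc n,
    Ω.form (e z) ![mfderiv (𝓡 (2 * n)) (𝓡 (2 * n)) e z u,
      mfderiv (𝓡 (2 * n)) (𝓡 (2 * n)) e z v] = stdForm n u v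

lemma bilin_formInChart_skew (Ω : SymplecticForm n M) (p : M) (z u v : Euc n) :
    bilin (formInChart Ω.form p z) u v = - bilin (formInChart Ω.form p z) v u := by
  have h : formInChart Ω.form p z (![v, u] ∘ Equiv.swap 0 1) = - formInChart Ω.form p z ![v, u] :=
    (formInChart Ω.form p z).toAlternatingMap.map_swap ![v, u] (i := 0) (j := 1) (by simp)
  have e : ![v, u] ∘ Equiv.swap 0 1 = ![u, v] := by
    ext i : 1
    fin_cases i <;> simp
  rw [bilin_apply, bilin_apply, ← h, e]

variable [IsManifold (𝓡 (2 * n)) ∞ M]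

lemma bilin_formInChart_nondegenerate (Ω : SymplecticForm n M) {p : M} {z : Euc n}
    (hz : z ∈ (extChartAt (𝓡 (2 * n)) p).target) {u : Euc n}
    (hu : ∀ v, bilin (formInChart Ω.form p z) u v = 0) : u = 0 := by
  obtain ⟨e, he⟩ := mfderiv_symm_isInvertible hz
  have h1 := Ω.nondegenerate _ (mfderiv (𝓡 (2 * n)) (𝓡 (2 * n)) (extChartAt (𝓡 (2 * n)) p).symm z u)
    fun v => by
      have h2 := (formInChart_apply Ω.form p z u (e.symm v)).symm.trans
        ((bilin_apply _ _ _).symm.trans (hu (e.symm v)))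
      have h3 : mfderiv (𝓡 (2 * n)) (𝓡 (2 * n)) (extChartAt (𝓡 (2 * n)) p).symm z
          (e.symm v) = v := by
        rw [← he]
        exact e.apply_symm_apply v
      rw [← h3]
      exact h2
  rw [← he] at h1
  exact e.map_eq_zero_iff.1 h1

/-- The contraction `ι_X Ω` is a primitive of `Ω`, for `d(ι_X Ω) = 𝓛_X Ω - ι_X dΩ = Ω`, so no
Poincaré lemma is needed. Moser's map reduces `Ω` to its constant value at the centre, which `L`
brings to the standard form. -/
theorem exists_symplectic_coordinates {Ω : SymplecticForm n M}
    {X : (x : M) → TangentSpace (𝓡 (2 * n)) x} (hX : IsLiouvilleField Ω X) (p : M) :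
    ∃ h : Euc n → Euc n, h 0 = extChartAt (𝓡 (2 * n)) p p ∧ ∀ᶠ z in 𝓝 0, ContDiffAt ℝ ∞ h z ∧
      h z ∈ (extChartAt (𝓡 (2 * n)) p).target ∧ (fderiv ℝ h z).IsInvertible ∧
      ∀ u v, formInChart Ω.form p (h z) ![fderiv ℝ h z u, fderiv ℝ h z v] = stdForm n u v := by
  set U := (extChartAt (𝓡 (2 * n)) p).target
  set z₀ := extChartAt (𝓡 (2 * n)) p p
  set η := formInChart Ω.form p
  set Y := fieldInChart X p
  have hU : IsOpen U := isOpen_target p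
  have hz₀ : z₀ ∈ U := mem_extChartAt_target (I := 𝓡 (2 * n)) p
  let B : Euc n → Euc n →L[ℝ] Euc n →L[ℝ] ℝ := fun y => bilin (η y)
  have hη : ContDiffOn ℝ ∞ η U := Ω.smooth p
  have hB : ContDiffOn ℝ ∞ B U := contDiff_bilin.comp_contDiffOn hη
  have hY : ContDiffOn ℝ ∞ Y U := contDiffOn_fieldInChart hX.smooth p
  have hBd : ∀ y ∈ U, HasFDerivAt B (bilin ∘L fderiv ℝ η y) y := fun y hy =>
    (hasFDerivAt_bilin (η y)).comp y
      ((hη.contDiffAt (hU.mem_nhds hy)).differentiableAt (by simp)).hasFDerivAt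
  have hYd : ∀ y ∈ U, HasFDerivAt Y (fderiv ℝ Y y) y := fun y hy =>
    ((hY.contDiffAt (hU.mem_nhds hy)).differentiableAt (by simp)).hasFDerivAt
  have hskew : ∀ y u v, B y u v = - B y v u := fun y u v => bilin_formInChart_skew Ω p y u v
  have hclosed : ∀ y ∈ U, ∀ a b c,
      fderiv ℝ B y a b c - fderiv ℝ B y b a c + fderiv ℝ B y c a b = 0 := by
    intro y hy a b c
    have h1 := congrArg (fun f => f ![a, b, c]) (Ω.closed p y hy)
    simp only [extDeriv, ContinuousAlternatingMap.alternatizeUncurryFin_apply] at h1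
    rw [Fin.sum_univ_three] at h1
    have e0 : (0 : Fin 3).removeNth ![a, b, c] = ![b, c] := by ext i : 1; fin_cases i <;> rfl
    have e1 : (1 : Fin 3).removeNth ![a, b, c] = ![a, c] := by ext i : 1; fin_cases i <;> rfl
    have e2 : (2 : Fin 3).removeNth ![a, b, c] = ![a, b] := by ext i : 1; fin_cases i <;> rfl
    rw [e0, e1, e2] at h1
    rw [(hBd y hy).fderiv]
    simp only [ContinuousLinearMap.comp_apply, bilin_apply]
    simp at h1
    linarith
  have hprim : ∀ y ∈ U, ∀ u v, fderiv ℝ (fun y => B y (Y y)) y u v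
      - fderiv ℝ (fun y => B y (Y y)) y v u = B y u v := by
    intro y hy u v
    have h1 := hX.lieDeriv_eq p y hy u v
    have h2 := hclosed y hy (Y y) u v
    have h3 := hskew y (fderiv ℝ Y y v) u
    rw [((hBd y hy).clm_apply (hYd y hy)).fderiv]
    rw [(hBd y hy).fderiv] at h2
    simp only [lieDeriv, ContinuousLinearMap.comp_apply, bilin_apply, add_apply,
      ContinuousLinearMap.flip_apply, B] at h1 h2 h3 ⊢
    linarith
  have hfr : Module.finrank ℝ (Euc n) = Module.finrank ℝ (Euc n →L[ℝ] ℝ) := by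
    rw [← (LinearMap.toContinuousLinearMap (𝕜 := ℝ) (E := Euc n) (F' := ℝ)).finrank_eq]
    exact Subspace.dual_finrank_eq.symm
  have hinv : (B z₀).IsInvertible := isInvertible_of_injective
    (fun u hu => bilin_formInChart_nondegenerate Ω hz₀ fun v => DFunLike.congr_fun hu v) hfr
  obtain ⟨θ, hθ0, hθ⟩ := exists_moser_map hU hz₀ hB (hB.clm_apply hY) (fun y _ => hskew y) hclosed
    hprim hinv
  obtain ⟨L, hL⟩ := exists_linearEquiv_stdForm (B := B z₀)
    (fun u => by have := hskew z₀ u u; linarith)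
    (fun u hu => bilin_formInChart_nondegenerate Ω hz₀ hu)
  have ha : ContDiff ℝ ∞ (fun z => z₀ + L z) := contDiff_const.add L.contDiff
  have ha' : ∀ z, HasFDerivAt (fun z => z₀ + L z) (L : Euc n →L[ℝ] Euc n) z := fun z =>
    L.hasFDerivAt.const_add z₀
  have hat : Tendsto (fun z => z₀ + L z) (𝓝 0) (𝓝 z₀) := ha.continuous.tendsto' _ _ (by simp)
  refine ⟨fun z => θ (z₀ + L z), by simp [hθ0], ?_⟩
  filter_upwards [hat.eventually hθ] with z ⟨hs, hzU, hz⟩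
  have hd : fderiv ℝ (fun z => θ (z₀ + L z)) z = fderiv ℝ θ (z₀ + L z) ∘L L :=
    ((hs.differentiableAt (by simp)).hasFDerivAt.comp z (ha' z)).fderiv
  have hpb : ∀ u v, η (θ (z₀ + L z)) ![fderiv ℝ (fun z => θ (z₀ + L z)) z u,
      fderiv ℝ (fun z => θ (z₀ + L z)) z v] = stdForm n u v := by
    intro u v
    rw [hd, ← hL, ← hz, ← bilin_apply]
    rfl
  refine ⟨hs.comp z ha.contDiffAt, hzU, isInvertible_of_injective (fun u hu => ?_) rfl, hpb⟩
  refine stdForm_nondegenerate fun v => ?_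
  rw [← hpb, hu, ← bilin_apply, map_zero, zero_apply]

theorem exists_darbouxChart {Ω : SymplecticForm n M}
    {X : (x : M) → TangentSpace (𝓡 (2 * n)) x} (hX : IsLiouvilleField Ω X) (p : M) :
    ∃ e : OpenPartialHomeomorph (Euc n) M, IsDarbouxChart Ω e ∧ 0 ∈ e.source ∧ e 0 = p := by
  obtain ⟨h, h0, hh⟩ := exists_symplectic_coordinates hX p
  obtain ⟨N, hN, hNo, h0N⟩ := _root_.eventually_nhds_iff.1 hh
  obtain ⟨hs, -, ⟨d, hd⟩, -⟩ := hN 0 h0N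
  have hd' : HasFDerivAt h (d : Euc n →L[ℝ] Euc n) 0 :=
    hd ▸ (hs.differentiableAt (by simp)).hasFDerivAt
  -- After restriction to `N` the derivative of `h` is invertible at every point of the source, so
  -- the inverse is smooth on the whole target.
  set e₁ := (hs.toOpenPartialHomeomorph h hd' (by simp)).restrOpen N hNo with he₁
  have e₁c : (e₁ : Euc n → Euc n) = h := rfl
  have e₁s : e₁.source ⊆ N := inter_subset_right
  set c := chartAt (Euc n) p
  have hc : (c.symm : Euc n → M) = (extChartAt (𝓡 (2 * n)) p).symm := rfl
  have hct : c.target = (extChartAt (𝓡 (2 * n)) p).target := by simp [c, mfld_simps]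
  have hmem : ∀ z ∈ e₁.source, h z ∈ (extChartAt (𝓡 (2 * n)) p).target := fun z hz =>
    (hN z (e₁s hz)).2.1
  have hsrc : (e₁.trans c.symm).source ⊆ e₁.source := fun z hz => hz.1
  refine ⟨e₁.trans c.symm, ⟨fun z hz => ?_, fun x hx => ?_, fun z hz u v => ?_⟩, ?_, ?_⟩
  · have hz' := hsrc hz
    exact (contMDiffAt_symm (hmem z hz')).comp z (hN z (e₁s hz')).1.contMDiffAt
  · have hx1 : x ∈ c.source := hx.1
    have hx2 : c x ∈ e₁.target := hx.2
    have hz := e₁.map_target hx2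
    obtain ⟨hs', -, ⟨d', hd'⟩, -⟩ := hN _ (e₁s hz)
    have h1 : ContDiffAt ℝ ∞ e₁.symm (c x) := e₁.contDiffAt_symm (f₀' := d') hx2
      (hd' ▸ (hs'.differentiableAt (by simp)).hasFDerivAt) hs'
    exact h1.contMDiffAt.comp x (contMDiffAt_chart hx1)
  · have hz' := hsrc hz
    obtain ⟨hs', hU', -, hpb⟩ := hN z (e₁s hz')
    have h1 : HasMFDerivAt (𝓡 (2 * n)) (𝓡 (2 * n)) (e₁.trans c.symm) z
        ((mfderiv (𝓡 (2 * n)) (𝓡 (2 * n)) (extChartAt (𝓡 (2 * n)) p).symm (h z)).comp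
          (fderiv ℝ h z)) :=
      ((contMDiffAt_symm hU').mdifferentiableAt (by simp)).hasMFDerivAt.comp z
        (hs'.differentiableAt (by simp)).hasFDerivAt.hasMFDerivAt
    rw [← hpb, formInChart_apply, h1.mfderiv]
    rfl
  · refine ⟨⟨hs.mem_toOpenPartialHomeomorph_source hd' (by simp), h0N⟩, ?_⟩
    change h 0 ∈ c.target
    rw [hct, h0]
    exact mem_extChartAt_target (I := 𝓡 (2 * n)) p
  · change (extChartAt (𝓡 (2 * n)) p).symm (h 0) = p
    rw [h0]
    exact extChartAt_to_inv (I := 𝓡 (2 * n)) p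

end Darboux

/-! ### Smooth families and the `C^∞`-topology -/

section Families

variable {P E : Type} [NormedAddCommGroup P] [NormedSpace ℝ P]
  [NormedAddCommGroup E] [NormedSpace ℝ E]

/-- The partial derivatives in the second variable of a function that is smooth on a product are
continuous in both variables. -/
lemma continuousOn_iteratedFDerivWithin_right {Q : Set P} {B : Set E} (hQ : UniqueDiffOn ℝ Q)
    (hB : UniqueDiffOn ℝ B) (k : ℕ) {F : Type} [NormedAddCommGroup F] [NormedSpace ℝ F]
    {G : P × E → F} (hG : ContDiffOn ℝ ∞ G (Q ×ˢ B)) :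
    ContinuousOn (fun w : P × E => iteratedFDerivWithin ℝ k (fun y => G (w.1, y)) B w.2)
      (Q ×ˢ B) := by
  induction k generalizing F with
  | zero =>
    simp only [iteratedFDerivWithin_zero_eq_comp]
    exact (continuousMultilinearCurryFin0 ℝ E F).symm.continuous.comp_continuousOn hG.continuousOn
  | succ k ih =>
    -- The partial derivative in the second variable is again smooth on the product, so the
    -- induction replaces `G` by it and `F` by `E →L[ℝ] F`.
    let G' : P × E → E →L[ℝ] F := fun w => fderivWithin ℝ G (Q ×ˢ B) w ∘L .inr ℝ P E
    have hG' : ContDiffOn ℝ ∞ G' (Q ×ˢ B) :=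
      (hG.fderivWithin (hQ.prod hB) (by simp)).clm_comp contDiffOn_const
    refine ((continuousMultilinearCurryRightEquiv' ℝ k E F).symm.continuous.comp_continuousOn
      (ih hG')).congr fun w hw => ?_
    rw [iteratedFDerivWithin_succ_eq_comp_right hB hw.2]
    refine congrArg (continuousMultilinearCurryRightEquiv' ℝ k E F).symm
      (iteratedFDerivWithin_congr (fun y hy => ?_) hw.2 k)
    have h1 : HasFDerivWithinAt (fun y => (w.1, y)) (.inr ℝ P E) B y :=
      (hasFDerivAt_prodMk_right w.1 y).hasFDerivWithinAt
    have h2 := ((hG.differentiableOn (by simp)) (w.1, y) ⟨hw.1, hy⟩).hasFDerivWithinAt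
    exact (h2.comp y h1 fun z hz => ⟨hw.1, hz⟩).fderivWithin (hB y hy)

end Families

lemma uniqueDiffOn_closedBall {E : Type*} [NormedAddCommGroup E] [NormedSpace ℝ E] {r : ℝ}
    (hr : 0 < r) : UniqueDiffOn ℝ (closedBall (0 : E) r) :=
  uniqueDiffOn_convex (convex_closedBall 0 r)
    ⟨0, ball_subset_interior_closedBall (mem_ball_self hr)⟩

section Topology

lemma extendMap_apply {n : ℕ} {M : Type*} {b : ℝ} (f : symplBall n b → M) {x : Euc n}
    (hx : x ∈ symplBall n b) : extendMap f x = f ⟨x, hx⟩ :=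
  Subtype.val_injective.extend_apply f _ (⟨x, hx⟩ : symplBall n b)

variable {n : ℕ} {M : Type*} [TopologicalSpace M] [ChartedSpace (Euc n) M]

lemma uniqueDiffOn_symplBall {b : ℝ} (hb : 0 < b) : UniqueDiffOn ℝ (symplBall n b) :=
  uniqueDiffOn_closedBall (Real.sqrt_pos.2 (div_pos hb Real.pi_pos))

variable [IsManifold (𝓡 (2 * n)) ∞ M]

variable {P : Type} [NormedAddCommGroup P] [NormedSpace ℝ P] {Q : Set P} {b : ℝ}
  {F : P × Euc n → M} {T : Type*} [TopologicalSpace T] {c : T → P} {φ : T → SmoothMap n M b}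

/-- On a small product neighbourhood the family takes values in the chart and its partial
derivatives are jointly continuous. Passing from the ball to its intersection with an open set does
not change them. The joint limit in `(t, x)` becomes uniform on compact sets. -/
lemma tendsto_chartDeriv (hb : 0 < b) (hQ : UniqueDiffOn ℝ Q)
    (hF : ContMDiffOn 𝓘(ℝ, P × Euc n) (𝓡 (2 * n)) ∞ F (Q ×ˢ symplBall n b))
    (hc : Continuous c) (hcQ : ∀ t, c t ∈ Q)
    (hφ : ∀ t, ∀ x ∈ symplBall n b, extendMap (φ t).toFun x = F (c t, x)) {t₀ : T} {x₀ : Euc n}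
    (hx₀ : x₀ ∈ symplBall n b) {p : M} (hp : extendMap (φ t₀).toFun x₀ ∈ (chartAt (Euc n) p).source)
    (k : ℕ) :
    (∀ᶠ w in 𝓝 t₀ ×ˢ 𝓝[symplBall n b] x₀,
      extendMap (φ w.1).toFun w.2 ∈ (chartAt (Euc n) p).source) ∧
    Tendsto (fun w : T × Euc n => chartDeriv (φ w.1) p k w.2) (𝓝 t₀ ×ˢ 𝓝[symplBall n b] x₀)
      (𝓝 (chartDeriv (φ t₀) p k x₀)) := by
  have hB := uniqueDiffOn_symplBall (n := n) hb
  rw [hφ _ _ hx₀] at hp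
  have hw₀ : (c t₀, x₀) ∈ Q ×ˢ symplBall n b := ⟨hcQ t₀, hx₀⟩
  have hlim : Tendsto (fun w : T × Euc n => (c w.1, w.2)) (𝓝 t₀ ×ˢ 𝓝[symplBall n b] x₀)
      (𝓝[Q ×ˢ symplBall n b] (c t₀, x₀)) := by
    rw [nhdsWithin_prod_eq]
    refine Tendsto.prodMap ?_ tendsto_id
    exact tendsto_nhdsWithin_iff.2 ⟨hc.tendsto t₀, Eventually.of_forall hcQ⟩
  have hmem : ∀ᶠ w in 𝓝 t₀ ×ˢ 𝓝[symplBall n b] x₀, w.2 ∈ symplBall n b :=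
    tendsto_snd.eventually self_mem_nhdsWithin
  have hsrc : ∀ᶠ w in 𝓝[Q ×ˢ symplBall n b] (c t₀, x₀), F w ∈ (chartAt (Euc n) p).source :=
    (hF.continuousOn _ hw₀).eventually ((chartAt (Euc n) p).open_source.mem_nhds hp)
  refine ⟨?_, ?_⟩
  · filter_upwards [hlim.eventually hsrc, hmem] with w hw hw2
    rwa [hφ _ _ hw2]
  obtain ⟨u, v, hu, hcu, hv, hxv, huv⟩ := mem_nhds_prod_iff'.1 (eventually_nhdsWithin_iff.1 hsrc)
  have hG : ContDiffOn ℝ ∞ (fun w => extChartAt (𝓡 (2 * n)) p (F w))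
      ((Q ∩ u) ×ˢ (symplBall n b ∩ v)) := by
    rw [← contMDiffOn_iff_contDiffOn]
    intro w hw
    exact (contMDiffAt_chart (huv ⟨hw.1.2, hw.2.2⟩ ⟨hw.1.1, hw.2.1⟩)).comp_contMDiffWithinAt w
      ((hF w ⟨hw.1.1, hw.2.1⟩).mono (prod_mono inter_subset_left inter_subset_left))
  have h1 := continuousOn_iteratedFDerivWithin_right (hQ.inter hu) (hB.inter hv) k hG
  have h2 := h1 (c t₀, x₀) ⟨⟨hcQ t₀, hcu⟩, hx₀, hxv⟩
  have h3 : 𝓝[(Q ∩ u) ×ˢ (symplBall n b ∩ v)] (c t₀, x₀) = 𝓝[Q ×ˢ symplBall n b] (c t₀, x₀) := by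
    rw [← prod_inter_prod]
    exact nhdsWithin_inter_of_mem' (mem_nhdsWithin_of_mem_nhds ((hu.prod hv).mem_nhds ⟨hcu, hxv⟩))
  rw [ContinuousWithinAt, h3] at h2
  have h4 : ∀ t, ∀ x ∈ symplBall n b, x ∈ v → chartDeriv (φ t) p k x = iteratedFDerivWithin ℝ k
      (fun y => extChartAt (𝓡 (2 * n)) p (F (c t, y))) (symplBall n b ∩ v) x := by
    intro t x hx hxv
    rw [iteratedFDerivWithin_inter_open hv hxv]
    exact iteratedFDerivWithin_congr (fun y hy => by rw [hφ t y hy]) hx k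
  rw [h4 t₀ x₀ hx₀ hxv]
  refine (h2.comp hlim).congr' ?_
  filter_upwards [hmem, tendsto_snd.eventually (mem_nhdsWithin_of_mem_nhds (hv.mem_nhds hxv))]
    with w hw1 hw2
  exact (h4 _ _ hw1 hw2).symm

/-- A family of maps that is smooth in the point and a parameter depends continuously on the
parameter. -/
theorem continuous_of_smooth_family (hb : 0 < b) (hQ : UniqueDiffOn ℝ Q)
    (hF : ContMDiffOn 𝓘(ℝ, P × Euc n) (𝓡 (2 * n)) ∞ F (Q ×ˢ symplBall n b))
    (hc : Continuous c) (hcQ : ∀ t, c t ∈ Q)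
    (hφ : ∀ t, ∀ x ∈ symplBall n b, extendMap (φ t).toFun x = F (c t, x)) : Continuous φ := by
  rw [continuous_iff_continuousAt]
  intro t₀
  refine TopologicalSpace.tendsto_nhds_generateFrom_iff.2 ?_
  rintro _ ⟨f, p, K, k, ε, hK, hKB, hfK, -, rfl⟩ ⟨hp, hε⟩
  have key : ∀ x ∈ K, ∀ᶠ w : T × Euc n in 𝓝 (t₀, x), w.2 ∈ K →
      extendMap (φ w.1).toFun w.2 ∈ (chartAt (Euc n) p).source ∧
        ‖chartDeriv (φ w.1) p k w.2 - chartDeriv f p k w.2‖ < ε := by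
    intro x hx
    obtain ⟨h1, h2⟩ := tendsto_chartDeriv hb hQ hF hc hcQ hφ (hKB hx) (hp x hx) k
    have hf : ContMDiffOn 𝓘(ℝ, ℝ × Euc n) (𝓡 (2 * n)) ∞ (fun w => extendMap f.toFun w.2)
        ((univ : Set ℝ) ×ˢ symplBall n b) :=
      f.smooth.comp contDiff_snd.contMDiff.contMDiffOn fun w hw => hw.2
    -- The centre `f` of the subbasic neighbourhood is treated as a constant family, which yields
    -- continuity of its own derivatives in `x`.
    obtain ⟨-, h3⟩ := tendsto_chartDeriv (Q := (univ : Set ℝ)) (F := fun w => extendMap f.toFun w.2)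
      (φ := fun _ : T => f) (c := fun _ => 0) hb uniqueDiffOn_univ hf continuous_const
      (fun _ => mem_univ _) (fun _ _ _ => rfl) (t₀ := t₀) (hKB hx) (hfK x hx) k
    have h4 := (h2.sub h3).norm.eventually (gt_mem_nhds (hε x hx))
    have h5 : 𝓝 t₀ ×ˢ 𝓝[symplBall n b] x = 𝓝[univ ×ˢ symplBall n b] (t₀, x) := by
      rw [nhdsWithin_prod_eq, nhdsWithin_univ]
    have h6 := h1.and h4
    rw [h5, eventually_nhdsWithin_iff] at h6
    exact h6.mono fun w hw hwK => hw ⟨mem_univ _, hKB hwK⟩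
  filter_upwards [hK.eventually_forall_of_forall_eventually (P := fun t x => x ∈ K →
    extendMap (φ t).toFun x ∈ (chartAt (Euc n) p).source ∧
      ‖chartDeriv (φ t) p k x - chartDeriv f p k x‖ < ε) key] with t ht
  exact ⟨fun x hx => (ht x hx hx).1, fun x hx => (ht x hx hx).2⟩

end Topology

/-! ### Symplectic embeddings of balls and the conformal flow -/

section Push

variable {n : ℕ} {M : Type*} [TopologicalSpace M] [ChartedSpace (Euc n) M]

/-- `f` restricts to a symplectic embedding of the closed ball of radius `r`. -/
structure IsSymplecticOn (Ω : SymplecticForm n M) (f : Euc n → M) (r : ℝ) : Prop where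
  smooth : ContMDiffOn (𝓡 (2 * n)) (𝓡 (2 * n)) ∞ f (closedBall 0 r)
  injOn : InjOn f (closedBall 0 r)
  pullback_eq : ∀ x ∈ closedBall (0 : Euc n) r,
    ∃ D : Euc n →L[ℝ] TangentSpace (𝓡 (2 * n)) (f x),
      HasMFDerivWithinAt (𝓡 (2 * n)) (𝓡 (2 * n)) f (closedBall 0 r) x D ∧
      ∀ u v, Ω.form (f x) ![D u, D v] = stdForm n u v

lemma IsSymplecticOn.mono {Ω : SymplecticForm n M} {f : Euc n → M} {r r' : ℝ}
    (hf : IsSymplecticOn Ω f r) (h : r' ≤ r) : IsSymplecticOn Ω f r' := by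
  have hs : closedBall (0 : Euc n) r' ⊆ closedBall 0 r := closedBall_subset_closedBall h
  refine ⟨hf.smooth.mono hs, hf.injOn.mono hs, fun x hx => ?_⟩
  obtain ⟨D, hD, hD'⟩ := hf.pullback_eq x (hs hx)
  exact ⟨D, hD.mono hs, hD'⟩

/-- The smooth map `φ` of the ball of radius `R = √(b/π)` is obtained from the map `f` of the ball
of radius `r` by rescaling and the forward flow `ψ`. -/
def IsPush (ψ : ℝ → M → M) {b : ℝ} (φ : SmoothMap n M b) (f : Euc n → M) (r : ℝ) : Prop :=
  ∀ x ∈ symplBall n b, extendMap φ.toFun x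
    = ψ (2 * Real.log (√(b / Real.pi) / r)) (f ((r / √(b / Real.pi)) • x))

/-- Paths found by different constructions can be concatenated because the push of `f` depends only
on `f` and `r`. -/
lemma IsPush.unique {ψ : ℝ → M → M} {b : ℝ} {φ φ' : SmoothMap n M b} {f f' : Euc n → M} {r : ℝ}
    (h : IsPush ψ φ f r) (h' : IsPush ψ φ' f' r)
    (hff : ∀ x ∈ symplBall n b, f ((r / √(b / Real.pi)) • x) = f' ((r / √(b / Real.pi)) • x)) :
    φ = φ' := by
  have e : φ.toFun = φ'.toFun := funext fun x => by
    rw [← extendMap_apply φ.toFun x.2, ← extendMap_apply φ'.toFun x.2, h _ x.2, h' _ x.2,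
      hff _ x.2]
  cases φ
  cases φ'
  cases e
  rfl

/-- The images of `f` and `g` in the space of symplectic embeddings of a fixed ball, under rescaling
and the forward flow, are connected by a path. -/
def PushJoined (Ω : SymplecticForm n M) (ψ : ℝ → M → M) (b : ℝ)
    (f : Euc n → M) (r : ℝ) (g : Euc n → M) (s : ℝ) : Prop :=
  ∃ φ φ' : Emb Ω b, IsPush ψ φ.1 f r ∧ IsPush ψ φ'.1 g s ∧ Joined φ φ'

lemma smul_mem_closedBall_of_le {r R s : ℝ} (hr : 0 ≤ r) (hR : 0 < R) (hrs : r ≤ s) {x : Euc n}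
    (hx : x ∈ closedBall (0 : Euc n) R) : (r / R) • x ∈ closedBall (0 : Euc n) s := by
  rw [mem_closedBall_zero_iff] at hx ⊢
  rw [norm_smul, Real.norm_of_nonneg (by positivity)]
  calc r / R * ‖x‖ ≤ r / R * R := by gcongr
    _ ≤ s := by rwa [div_mul_cancel₀ _ hR.ne']

lemma PushJoined.symm {Ω : SymplecticForm n M} {ψ : ℝ → M → M} {b : ℝ} {f g : Euc n → M} {r s : ℝ}
    (h : PushJoined Ω ψ b f r g s) : PushJoined Ω ψ b g s f r := by
  obtain ⟨φ, φ', h1, h2, h3⟩ := h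
  exact ⟨φ', φ, h2, h1, h3.symm⟩

lemma PushJoined.trans {Ω : SymplecticForm n M} {ψ : ℝ → M → M} {b : ℝ} {f g k : Euc n → M}
    {r s t : ℝ} (h : PushJoined Ω ψ b f r g s) (h' : PushJoined Ω ψ b g s k t) :
    PushJoined Ω ψ b f r k t := by
  obtain ⟨φ, φ', h1, h2, h3⟩ := h
  obtain ⟨φ₁, φ₁', h4, h5, h6⟩ := h'
  obtain rfl : φ' = φ₁ := Subtype.ext (h2.unique h4 fun _ _ => rfl)
  exact ⟨φ, φ₁', h1, h5, h3.trans h6⟩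

lemma PushJoined.congr_left {Ω : SymplecticForm n M} {ψ : ℝ → M → M} {b : ℝ} {f f' g : Euc n → M}
    {r s : ℝ} (h : PushJoined Ω ψ b f r g s) (hr : 0 ≤ r) (hff : EqOn f f' (closedBall 0 r)) :
    PushJoined Ω ψ b f' r g s := by
  obtain ⟨φ, φ', h1, h2, h3⟩ := h
  refine ⟨φ, φ', fun x hx => ?_, h2, h3⟩
  rw [h1 x hx]
  -- If the radius `√(b/π)` is `0`, the quotient `r / 0` is `0` and only the value at the centre
  -- enters.
  rcases (Real.sqrt_nonneg (b / Real.pi)).eq_or_lt with hb | hb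
  · rw [← hb, div_zero, zero_smul, hff (mem_closedBall_self hr)]
  · rw [hff (smul_mem_closedBall_of_le hr hb le_rfl hx)]

lemma PushJoined.joined {Ω : SymplecticForm n M} {ψ : ℝ → M → M} {b : ℝ} {f g : Euc n → M}
    {r s : ℝ} (h : PushJoined Ω ψ b f r g s) {φ φ' : Emb Ω b} (hφ : IsPush ψ φ.1 f r)
    (hφ' : IsPush ψ φ'.1 g s) : Joined φ φ' := by
  obtain ⟨φ₁, φ₁', h1, h2, h3⟩ := h
  obtain rfl : φ = φ₁ := Subtype.ext (hφ.unique h1 fun _ _ => rfl)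
  obtain rfl : φ' = φ₁' := Subtype.ext (hφ'.unique h2 fun _ _ => rfl)
  exact h3

lemma isPush_of_emb {Ω : SymplecticForm n M} {ψ : ℝ → M → M} (hψ : ∀ x, ψ 0 x = x)
    {b : ℝ} (hb : 0 < b) (φ : Emb Ω b) :
    IsPush ψ φ.1 (extendMap φ.1.toFun) (√(b / Real.pi)) := by
  have hR : √(b / Real.pi) ≠ 0 := (Real.sqrt_pos.2 (div_pos hb Real.pi_pos)).ne'
  intro x hx
  rw [div_self hR, Real.log_one, mul_zero, hψ, one_smul]

lemma isSymplecticOn_of_emb {Ω : SymplecticForm n M} {b : ℝ} (φ : Emb Ω b) :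
    IsSymplecticOn Ω (extendMap φ.1.toFun) (√(b / Real.pi)) where
  smooth := φ.1.smooth
  injOn := fun x hx y hy h => by
    rw [extendMap_apply φ.1.toFun hx, extendMap_apply φ.1.toFun hy] at h
    exact congrArg Subtype.val (φ.2.isEmbedding.injective h)
  pullback_eq := fun x hx => ⟨_, ((φ.1.smooth x hx).mdifferentiableWithinAt
    (by simp)).hasMFDerivWithinAt, φ.2.pullback_eq x hx⟩

variable [IsManifold (𝓡 (2 * n)) ∞ M] [T2Space M] {Ω : SymplecticForm n M}
  {X : (x : M) → TangentSpace (𝓡 (2 * n)) x} {ψ : ℝ → M → M}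

theorem IsForwardFlow.contMDiffOn (hX : IsLiouvilleField Ω X) (hψ : IsForwardFlow X ψ) :
    ContMDiffOn (𝓘(ℝ, ℝ).prod (𝓡 (2 * n))) (𝓡 (2 * n)) ∞ (fun w : ℝ × M => ψ w.1 w.2)
      (Ici 0 ×ˢ univ) := by
  rintro ⟨t₀, y₀⟩ ⟨ht₀, -⟩
  obtain ⟨H, hH, hHe⟩ := hψ.exists_smooth_inChart hX ht₀ (mem_chart_source (Euc n) y₀)
    (mem_chart_source (Euc n) (ψ t₀ y₀))
  have h0 := hHe.self_of_nhds ht₀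
  have h1 : ContMDiffAt (𝓘(ℝ, ℝ).prod (𝓡 (2 * n))) 𝓘(ℝ, ℝ × Euc n) ∞
      (fun w : ℝ × M => (w.1, extChartAt (𝓡 (2 * n)) y₀ w.2)) (t₀, y₀) :=
    contMDiffAt_fst.prodMk_space
      ((contMDiffAt_chart (mem_chart_source (Euc n) y₀)).comp (t₀, y₀) contMDiffAt_snd)
  have h2 : ContMDiffAt (𝓘(ℝ, ℝ).prod (𝓡 (2 * n))) (𝓡 (2 * n)) ∞
      (fun w : ℝ × M => H (w.1, extChartAt (𝓡 (2 * n)) y₀ w.2)) (t₀, y₀) :=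
    hH.contMDiffAt.comp (t₀, y₀) h1
  have h3 : H (t₀, extChartAt (𝓡 (2 * n)) y₀ y₀) ∈ (extChartAt (𝓡 (2 * n)) (ψ t₀ y₀)).target := by
    rw [← h0.2]
    exact mem_extChartAt_target (I := 𝓡 (2 * n)) _
  refine ((contMDiffAt_symm h3).comp (t₀, y₀) h2).contMDiffWithinAt.congr_of_eventuallyEq ?_ ?_
  · filter_upwards [mem_nhdsWithin_of_mem_nhds hHe, self_mem_nhdsWithin] with w hw hw0
    obtain ⟨e1, e2⟩ := hw hw0.1
    rw [Function.comp_apply, ← e2]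
    exact ((extChartAt (𝓡 (2 * n)) (ψ t₀ y₀)).left_inv (by rwa [extChartAt_source])).symm
  · rw [Function.comp_apply, ← h0.2]
    exact (extChartAt_to_inv (I := 𝓡 (2 * n)) _).symm

/-- The factors `(r/R)²` of the homothety and `exp T = (R/r)²` of the flow cancel, and `r ≤ R`
ensures that only nonnegative times occur. Injectivity of the flow and compactness of the ball make
the result a topological embedding. -/
theorem IsSymplecticOn.exists_push (hX : IsLiouvilleField Ω X) (hψ : IsForwardFlow X ψ) {b : ℝ}
    {f : Euc n → M} {r : ℝ} (hf : IsSymplecticOn Ω f r) (hr : 0 < r) (hrb : r ≤ √(b / Real.pi)) :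
    ∃ φ : Emb Ω b, IsPush ψ φ.1 f r := by
  set R := √(b / Real.pi) with hRdef
  have hR : 0 < R := hr.trans_le hrb
  have hb : 0 < b := by
    by_contra! h
    exact hR.ne' (Real.sqrt_eq_zero_of_nonpos (div_nonpos_of_nonpos_of_nonneg h Real.pi_pos.le))
  set T := 2 * Real.log (R / r) with hT
  have hT0 : 0 ≤ T := by
    have := Real.log_nonneg ((one_le_div hr).2 hrb)
    positivity
  have hexp : Real.exp T * (r / R) ^ 2 = 1 := by
    rw [hT, two_mul, Real.exp_add, Real.exp_log (by positivity)]
    field_simp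
  let g : Euc n → M := fun x => ψ T (f ((r / R) • x))
  have hmaps : ∀ x ∈ symplBall n b, (r / R) • x ∈ closedBall (0 : Euc n) r := fun x hx =>
    smul_mem_closedBall_of_le hr.le hR le_rfl hx
  have hψT : ∀ y, ContMDiffAt (𝓡 (2 * n)) (𝓡 (2 * n)) ∞ (ψ T) y := fun y =>
    (hψ.smooth_and_conformal hX y hT0).1
  have hgs : ContMDiffOn (𝓡 (2 * n)) (𝓡 (2 * n)) ∞ g (symplBall n b) := fun x hx =>
    (hψT _).comp_contMDiffWithinAt x ((hf.smooth _ (hmaps x hx)).comp x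
      (contDiff_const_smul (r / R)).contMDiff.contMDiffAt.contMDiffWithinAt hmaps)
  let φ₀ : symplBall n b → M := fun x => g x
  have hφ₀ : ∀ x ∈ symplBall n b, extendMap φ₀ x = g x := fun x hx => extendMap_apply φ₀ hx
  refine ⟨⟨⟨φ₀, hgs.congr hφ₀⟩, ?_, fun x hx u v => ?_⟩, hφ₀⟩
  · have : CompactSpace (symplBall n b) :=
      isCompact_iff_compactSpace.1 (isCompact_closedBall (0 : Euc n) _)
    refine (Continuous.isClosedEmbedding hgs.continuousOn.domRestrict fun x y hxy => ?_).isEmbedding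
    have h1 := hf.injOn (hmaps x x.2) (hmaps y y.2) (hψ.injective hX hT0 hxy)
    exact Subtype.ext (smul_right_injective (Euc n) (div_pos hr hR).ne' h1)
  · obtain ⟨D, hD, hDs⟩ := hf.pullback_eq _ (hmaps x hx)
    have h1 : HasMFDerivWithinAt (𝓡 (2 * n)) (𝓡 (2 * n)) (fun x : Euc n => (r / R) • x)
        (symplBall n b) x ((r / R) • ContinuousLinearMap.id ℝ (Euc n)) :=
      ((hasFDerivAt_id x).const_smul (r / R)).hasFDerivWithinAt.hasMFDerivWithinAt
    have h2 := ((hψT (f ((r / R) • x))).mdifferentiableAt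
      (by simp)).hasMFDerivAt.comp_hasMFDerivWithinAt x (hD.comp x h1 hmaps)
    have h3 := (HasMFDerivWithinAt.congr_mono (f₁ := extendMap φ₀) h2 hφ₀ (hφ₀ x hx)
      subset_rfl).mfderivWithin
      (uniqueDiffOn_symplBall hb x hx).uniqueMDiffWithinAt
    have h4 := (hψ.smooth_and_conformal hX (f ((r / R) • x)) hT0).2
      (D ((r / R) • u)) (D ((r / R) • v))
    rw [hDs, stdForm_smul_left, stdForm_smul_right] at h4
    rw [h3]
    have h5 : stdForm n u v = Real.exp T * (r / R * (r / R * stdForm n u v)) := by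
      linear_combination (- stdForm n u v) * hexp
    rw [h5, ← h4]
    change Ω.form (extendMap φ₀ x) _ = Ω.form (g x) _
    rw [hφ₀ x hx]
    rfl

/-- A smooth family of symplectic embeddings of balls of varying radius gives rise to a path of
symplectic embeddings of a fixed ball. -/
theorem pushJoined_of_family (hX : IsLiouvilleField Ω X) (hψ : IsForwardFlow X ψ) {b : ℝ}
    (hb : 0 < b) {P : Type} [NormedAddCommGroup P] [NormedSpace ℝ P] {Q : Set P}
    (hQ : UniqueDiffOn ℝ Q) {F : P × Euc n → M} {r₀ : ℝ}
    (hF : ContMDiffOn 𝓘(ℝ, P × Euc n) (𝓡 (2 * n)) ∞ F (Q ×ˢ closedBall 0 r₀))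
    {c : unitInterval → P} (hc : Continuous c) (hcQ : ∀ t, c t ∈ Q)
    {ρ : unitInterval → ℝ} (hρ : Continuous ρ) (hρ0 : ∀ t, 0 < ρ t) (hρr : ∀ t, ρ t ≤ r₀)
    (hρb : ∀ t, ρ t ≤ √(b / Real.pi)) (hs : ∀ t, IsSymplecticOn Ω (fun x => F (c t, x)) (ρ t)) :
    PushJoined Ω ψ b (fun x => F (c 0, x)) (ρ 0) (fun x => F (c 1, x)) (ρ 1) := by
  set R := √(b / Real.pi) with hRdef
  have hR : 0 < R := Real.sqrt_pos.2 (div_pos hb Real.pi_pos)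
  choose φ hφ using fun t => (hs t).exists_push hX hψ (hρ0 t) (hρb t)
  let τ : ℝ → ℝ := fun s => 2 * Real.log (R / s)
  -- The radius is one more parameter. `G` is smooth in all parameters together, so the path `t ↦ (c
  -- t, ρ t)` only has to be continuous.
  let G : (P × ℝ) × Euc n → M := fun w => ψ (τ w.1.2) (F (w.1.1, (w.1.2 / R) • w.2))
  set S : Set ((P × ℝ) × Euc n) := (Q ×ˢ Ioc 0 (min r₀ R)) ×ˢ symplBall n b with hS
  have hτ : ContDiffOn ℝ ∞ (fun w : (P × ℝ) × Euc n => τ w.1.2) S := by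
    have h1 : ContDiffOn ℝ ∞ (fun w : (P × ℝ) × Euc n => w.1.2) S :=
      (contDiff_snd.comp contDiff_fst).contDiffOn
    exact contDiffOn_const.mul ((contDiffOn_const.div h1 fun w hw => hw.1.2.1.ne').log
      fun w hw => (div_pos hR hw.1.2.1).ne')
  have hsc : ContDiff ℝ ∞ (fun w : (P × ℝ) × Euc n => (w.1.1, (w.1.2 / R) • w.2)) := by
    fun_prop
  have hG : ContMDiffOn 𝓘(ℝ, (P × ℝ) × Euc n) (𝓡 (2 * n)) ∞ G S := by
    refine (hψ.contMDiffOn hX).comp (hτ.contMDiffOn.prodMk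
      (hF.comp hsc.contMDiff.contMDiffOn fun w hw => ⟨hw.1.1,
        smul_mem_closedBall_of_le hw.1.2.1.le hR (hw.1.2.2.trans (min_le_left _ _)) hw.2⟩))
      fun w hw => ⟨?_, mem_univ _⟩
    have h1 := Real.log_nonneg ((one_le_div hw.1.2.1).2 (hw.1.2.2.trans (min_le_right _ _)))
    change 0 ≤ 2 * Real.log (R / w.1.2)
    positivity
  have hcont : Continuous fun t => (φ t).1 :=
    continuous_of_smooth_family (c := fun t => (c t, ρ t)) hb (hQ.prod (uniqueDiffOn_Ioc _ _)) hG
      (hc.prodMk hρ) (fun t => ⟨hcQ t, hρ0 t, le_min (hρr t) (hρb t)⟩) hφ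
  exact ⟨φ 0, φ 1, hφ 0, hφ 1, ⟨⟨⟨φ, hcont.subtype_mk fun t => (φ t).2⟩, rfl, rfl⟩⟩⟩

lemma IsSymplecticOn.pushJoined_radius (hX : IsLiouvilleField Ω X) (hψ : IsForwardFlow X ψ) {b : ℝ}
    (hb : 0 < b) {f : Euc n → M} {r r' : ℝ} (hf : IsSymplecticOn Ω f r) (hr' : 0 < r')
    (hrr : r' ≤ r) (hrb : r ≤ √(b / Real.pi)) : PushJoined Ω ψ b f r f r' := by
  have h := pushJoined_of_family hX hψ hb (Q := (univ : Set ℝ)) uniqueDiffOn_univ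
    (F := fun w => f w.2) (r₀ := r)
    (hf.smooth.comp contDiff_snd.contMDiff.contMDiffOn fun w hw => hw.2)
    (c := fun _ => 0) continuous_const (fun _ => mem_univ _) (ρ := fun t => r + t * (r' - r))
    (by fun_prop) (fun t => by nlinarith [t.2.1, t.2.2]) (fun t => by nlinarith [t.2.1, t.2.2])
    (fun t => by nlinarith [t.2.1, t.2.2])
    (fun t => hf.mono (by nlinarith [t.2.1, t.2.2]))
  simpa using h

end Push

/-! ### Hadamard's lemma -/

section Hadamard

open unitInterval

/-- The difference quotient `(h (t x) - h 0) / t` of a smooth map extends smoothly to `t = 0`. -/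
theorem exists_smooth_quotient {E : Type} [NormedAddCommGroup E] [NormedSpace ℝ E] [CompleteSpace E]
    {h : E → E} (hh : ContDiff ℝ ∞ h) : ∃ H : ℝ × E → E, ContDiff ℝ ∞ H ∧
      (∀ t x, t • H (t, x) = h (t • x) - h 0) ∧ ∀ x, H (0, x) = fderiv ℝ h 0 x := by
  have hv : ContDiff ℝ ∞ (fun z : ℝ × E => fderiv ℝ h (z.1 • z.2) z.2) :=
    ((hh.fderiv_right (m := ∞) (by simp)).comp (contDiff_fst.smul contDiff_snd)).clm_apply
      contDiff_snd
  let v : C(ℝ × E, E) := ⟨fun z => fderiv ℝ h (z.1 • z.2) z.2, hv.continuous⟩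
  let κ : C(I, ℝ × E) := ⟨fun s => ((s : ℝ), 0), by fun_prop⟩
  let cst : ℝ × E →L[ℝ] C(I, ℝ × E) := ContinuousLinearMap.const ℝ I ∘L .inr ℝ ℝ E ∘L .snd ℝ ℝ E
  -- `H (t, x) = ∫₀¹ Dh(s t x) x ds`, written as postcomposition with `v` along the curve `s ↦ (s t,
  -- x)` followed by a linear map, so that `contDiff_postcomp` gives smoothness.
  let H : ℝ × E → E := fun z => integralOp (v.comp (z.1 • κ + cst z)) 1
  have hH : ∀ t x, H (t, x) = ∫ s in (0 : ℝ)..1, fderiv ℝ h ((s * t) • x) x := by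
    intro t x
    change ∫ s in (0 : ℝ)..((1 : I) : ℝ), _ = _
    rw [Icc.coe_one]
    refine intervalIntegral.integral_congr fun s hs => ?_
    rw [uIcc_of_le zero_le_one] at hs
    simp only [IccExtend_of_mem _ _ hs]
    change fderiv ℝ h ((t * s + 0) • (t • (0 : E) + x)) (t • (0 : E) + x) = _
    rw [add_zero, smul_zero, zero_add, mul_comm]
  refine ⟨H, ?_, fun t x => ?_, fun x => by simp [hH]⟩
  · have h1 : ContDiff ℝ ∞ (fun z : ℝ × E => (z.1 • κ + cst z : C(I, ℝ × E))) :=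
      (contDiff_fst.smul contDiff_const).add cst.contDiff
    have h2 : ContDiff ℝ ∞ (fun γ : C(I, E) => integralOp γ 1) :=
      ((ContinuousMap.evalCLM ℝ (1 : I) : C(I, E) →L[ℝ] E) ∘L integralOp).contDiff
    exact h2.comp ((contDiff_postcomp (K := I) (v := v) hv).comp h1)
  · have hd : ∀ s : ℝ, HasDerivAt (fun s : ℝ => h ((s * t) • x))
        (t • fderiv ℝ h ((s * t) • x) x) s := by
      intro s
      have h1 : HasDerivAt (fun s : ℝ => (s * t) • x) (t • x) s := by
        simpa using ((hasDerivAt_id s).mul_const t).smul_const x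
      have h2 := ((hh.differentiable (by simp)) ((s * t) • x)).hasFDerivAt.comp_hasDerivAt s h1
      rwa [map_smul] at h2
    have hc : Continuous fun s : ℝ => t • fderiv ℝ h ((s * t) • x) x := by
      have := hh.continuous_fderiv (by simp)
      fun_prop
    have := intervalIntegral.integral_eq_sub_of_hasDerivAt (fun s _ => hd s)
      (hc.intervalIntegrable 0 1)
    rw [hH, ← intervalIntegral.integral_smul, this]
    simp

end Hadamard

/-! ### Embeddings into a Darboux chart -/

section Chart

variable {n : ℕ} {M : Type*} [TopologicalSpace M] [ChartedSpace (Euc n) M]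

lemma IsDarbouxChart.isSymplecticOn {Ω : SymplecticForm n M} {e : OpenPartialHomeomorph (Euc n) M}
    (he : IsDarbouxChart Ω e) {h : Euc n → Euc n} {r : ℝ} (hh : ContDiff ℝ ∞ h)
    (hm : ∀ x ∈ closedBall (0 : Euc n) r, h x ∈ e.source) (hi : InjOn h (closedBall 0 r))
    (hs : ∀ x ∈ closedBall (0 : Euc n) r, fderiv ℝ h x ∈ linearSymplectic n) :
    IsSymplecticOn Ω (fun x => e (h x)) r where
  smooth := fun x hx => ((he.smooth _ (hm x hx)).comp x hh.contMDiff.contMDiffAt).contMDiffWithinAt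
  injOn := fun x hx y hy hxy => hi hx hy (e.injOn (hm x hx) (hm y hy) hxy)
  pullback_eq := fun x hx => ⟨_, (((he.smooth _ (hm x hx)).mdifferentiableAt
    (by simp)).hasMFDerivAt.comp x
      (hh.differentiable (by simp) x).hasFDerivAt.hasMFDerivAt).hasMFDerivWithinAt,
    fun u v => (he.pullback_eq _ (hm x hx) _ _).trans (hs x hx u v)⟩

lemma IsDarbouxChart.isSymplecticOn_self {Ω : SymplecticForm n M}
    {e : OpenPartialHomeomorph (Euc n) M} (he : IsDarbouxChart Ω e) {r : ℝ}
    (hr : closedBall 0 r ⊆ e.source) : IsSymplecticOn Ω e r :=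
  he.isSymplecticOn contDiff_id hr (injOn_id _) fun x _ u v => by simp

lemma injective_of_mem_linearSymplectic {A : Euc n →L[ℝ] Euc n} (hA : A ∈ linearSymplectic n) :
    Function.Injective A := by
  refine (injective_iff_map_eq_zero A).2 fun u hu => stdForm_nondegenerate fun v => ?_
  rw [← hA u v, hu, ← stdBilin_apply, map_zero, zero_apply]

/-- Near the centre of the ball, a symplectic embedding is read in a Darboux chart as a smooth map
that is defined on the whole space. -/
lemma IsSymplecticOn.exists_inChart [IsManifold (𝓡 (2 * n)) ∞ M] {Ω : SymplecticForm n M}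
    {e : OpenPartialHomeomorph (Euc n) M} (he : IsDarbouxChart Ω e) {s : ℝ}
    (hse : ball 0 s ⊆ e.source) {f : Euc n → M} {r : ℝ} (hr : 0 < r) (hf : IsSymplecticOn Ω f r)
    (hf0 : f 0 ∈ e '' ball 0 s) : ∃ h : Euc n → Euc n, ∃ r₁ ∈ Ioc 0 r, ContDiff ℝ ∞ h ∧
      ∀ x ∈ closedBall (0 : Euc n) r₁, h x ∈ ball 0 s ∧ f x = e (h x) ∧
        fderiv ℝ h x ∈ linearSymplectic n := by
  have hfs : ∀ x ∈ ball (0 : Euc n) r, ContMDiffAt (𝓡 (2 * n)) (𝓡 (2 * n)) ∞ f x := fun x hx =>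
    (hf.smooth x (ball_subset_closedBall hx)).contMDiffAt
      (mem_of_superset (isOpen_ball.mem_nhds hx) ball_subset_closedBall)
  set V : Set M := e '' ball 0 s with hV
  have hVo : IsOpen V := e.isOpen_image_of_subset_source isOpen_ball hse
  have hVt : V ⊆ e.target := by
    rintro _ ⟨z, hz, rfl⟩
    exact e.map_source (hse hz)
  have hVs : ∀ x ∈ V, e.symm x ∈ ball 0 s := by
    rintro _ ⟨z, hz, rfl⟩
    rwa [e.left_inv (hse hz)]
  set U := ball (0 : Euc n) r ∩ f ⁻¹' V with hU
  have hUo : IsOpen U := ContinuousOn.isOpen_inter_preimage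
    (fun x hx => (hfs x hx).continuousAt.continuousWithinAt) isOpen_ball hVo
  obtain ⟨δ, hδ, hδU⟩ := Metric.isOpen_iff.1 hUo 0 ⟨mem_ball_self hr, hf0⟩
  have hr₁ : closedBall (0 : Euc n) (δ / 2) ⊆ U :=
    (closedBall_subset_ball (half_lt_self hδ)).trans hδU
  have hsm : ContDiffOn ℝ ∞ (fun x => e.symm (f x)) U := fun x hx =>
    (((he.smooth_symm _ (hVt hx.2)).comp x (hfs x hx.1)).contDiffAt).contDiffWithinAt
  obtain ⟨h, hh, hhe⟩ := exists_contDiff_eventuallyEq hUo isClosed_closedBall hr₁ hsm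
  refine ⟨h, min (δ / 2) r, ⟨by positivity, min_le_right _ _⟩, hh, fun x hx => ?_⟩
  have hx' : x ∈ closedBall (0 : Euc n) (δ / 2) := closedBall_subset_closedBall (min_le_left _ _) hx
  obtain ⟨hxr, hxV⟩ := hr₁ hx'
  have hev : ∀ᶠ y in 𝓝 x, h y = e.symm (f y) := (eventually_nhdsSet_iff_forall.1 hhe) x hx'
  have hfe : ∀ᶠ y in 𝓝 x, f y = e (h y) := by
    filter_upwards [hev, hUo.mem_nhds (hr₁ hx')] with y hy hyU
    rw [hy, e.right_inv (hVt hyU.2)]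
  have hhx : h x ∈ ball 0 s := by
    rw [hev.self_of_nhds]
    exact hVs _ hxV
  refine ⟨hhx, hfe.self_of_nhds, fun u v => ?_⟩
  obtain ⟨D, hD, hDs⟩ := hf.pullback_eq x (ball_subset_closedBall hxr)
  have hD' := (hD.hasMFDerivAt (mem_of_superset (isOpen_ball.mem_nhds hxr)
    ball_subset_closedBall)).congr_of_eventuallyEq (hfe.mono fun y hy => hy.symm)
  have hD₂ : HasMFDerivAt (𝓡 (2 * n)) (𝓡 (2 * n)) (fun y => e (h y)) x
      ((mfderiv (𝓡 (2 * n)) (𝓡 (2 * n)) e (h x)).comp (fderiv ℝ h x)) :=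
    ((he.smooth _ (hse hhx)).mdifferentiableAt (by simp)).hasMFDerivAt.comp x
      (hh.differentiable (by simp) x).hasFDerivAt.hasMFDerivAt
  have heq := hasMFDerivAt_unique hD' hD₂
  rw [← he.pullback_eq _ (hse hhx), ← hDs]
  rw [heq]
  have := hfe.self_of_nhds
  change Ω.form (e (h x)) _ = Ω.form (f x) _
  rw [this]
  rfl

variable [IsManifold (𝓡 (2 * n)) ∞ M] [T2Space M] {Ω : SymplecticForm n M}
  {X : (x : M) → TangentSpace (𝓡 (2 * n)) x} {ψ : ℝ → M → M}

/-- Alexander's trick: an embedding into a Darboux chart is isotopic to an affine one. -/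
lemma pushJoined_affine (hX : IsLiouvilleField Ω X) (hψ : IsForwardFlow X ψ) {b : ℝ} (hb : 0 < b)
    {e : OpenPartialHomeomorph (Euc n) M} (he : IsDarbouxChart Ω e) {s : ℝ}
    (hse : ball 0 s ⊆ e.source) {h : Euc n → Euc n} {r : ℝ} (hr : 0 < r) (hrb : r ≤ √(b / Real.pi))
    (hh : ContDiff ℝ ∞ h) (hm : ∀ x ∈ closedBall (0 : Euc n) r, h x ∈ ball 0 s)
    (hi : InjOn h (closedBall 0 r))
    (hs : ∀ x ∈ closedBall (0 : Euc n) r, fderiv ℝ h x ∈ linearSymplectic n) :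
    ∃ δ ∈ Ioc 0 r, ∀ r' ∈ Ioc 0 δ,
      PushJoined Ω ψ b (fun x => e (h x)) r' (fun x => e (h 0 + fderiv ℝ h 0 x)) r' := by
  obtain ⟨H, hH, hHt, hH0⟩ := exists_smooth_quotient hh
  have h0r : (0 : Euc n) ∈ closedBall 0 r := mem_closedBall_self hr.le
  have hHzero : ∀ t, H (t, 0) = 0 := fun t => by
    rcases eq_or_ne t 0 with rfl | ht
    · rw [hH0, map_zero]
    · have := hHt t 0
      rw [smul_zero, sub_self] at this
      exact (smul_eq_zero.1 this).resolve_left ht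
  -- The rescaled maps `x ↦ (h (t x) - h 0) / t` have derivative `Dh(t x)` at `x`, so they remain
  -- symplectic.
  have hHd : ∀ t x, HasFDerivAt (fun x => H (t, x)) (fderiv ℝ h (t • x)) x := fun t x => by
    rcases eq_or_ne t 0 with rfl | ht
    · simp only [hH0, zero_smul]
      exact (fderiv ℝ h 0).hasFDerivAt
    · have e1 : (fun x => H (t, x)) = fun x => t⁻¹ • (h (t • x) - h 0) := by
        funext y
        rw [← hHt, inv_smul_smul₀ ht]
      have e2 : HasFDerivAt (fun x => t⁻¹ • (h (t • x) - h 0))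
          (t⁻¹ • (fderiv ℝ h (t • x) ∘L (t • ContinuousLinearMap.id ℝ (Euc n)))) x :=
        (((hh.differentiable (by simp) (t • x)).hasFDerivAt.comp x
          ((hasFDerivAt_id x).const_smul t)).sub_const (h 0)).const_smul t⁻¹
      rw [e1]
      convert e2 using 1
      ext1 u
      simp [inv_smul_smul₀ ht]
  set O : Set (ℝ × Euc n) := {w | h 0 + H w ∈ ball (0 : Euc n) s} with hO
  have hOo : IsOpen O := isOpen_ball.preimage (continuous_const.add hH.continuous)
  obtain ⟨Q, N, hQ, hN, hIQ, hN0, hQN⟩ := generalized_tube_lemma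
    -- All rescaled maps send the centre to `h 0`, so a single small ball stays in the chart for
    -- every `t ∈ [0, 1]`.
    (isCompact_Icc (a := (0 : ℝ)) (b := 1)) (isCompact_singleton (x := (0 : Euc n))) hOo (by
      rintro ⟨t, x⟩ ⟨-, rfl⟩
      change h 0 + H (t, 0) ∈ ball (0 : Euc n) s
      rw [hHzero, add_zero]
      exact hm 0 h0r)
  obtain ⟨δ, hδ, hδN⟩ := Metric.isOpen_iff.1 hN 0 (singleton_subset_iff.1 hN0)
  refine ⟨min (δ / 2) r, ⟨by positivity, min_le_right _ _⟩, fun r' ⟨hr', hr'δ⟩ => ?_⟩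
  have hr'r := hr'δ.trans (min_le_right _ _)
  have hrN : closedBall (0 : Euc n) r' ⊆ N :=
    (closedBall_subset_ball ((hr'δ.trans (min_le_left _ _)).trans_lt (half_lt_self hδ))).trans hδN
  have hQm : ∀ t ∈ Q, ∀ x ∈ closedBall (0 : Euc n) r', h 0 + H (t, x) ∈ e.source := fun t ht x hx =>
    hse (hQN ⟨ht, hrN hx⟩)
  have hts : ∀ t ∈ Icc (0 : ℝ) 1, ∀ x ∈ closedBall (0 : Euc n) r',
      t • x ∈ closedBall (0 : Euc n) r := by
    intro t ht x hx
    rw [mem_closedBall_zero_iff] at hx ⊢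
    rw [norm_smul, Real.norm_of_nonneg ht.1]
    calc t * ‖x‖ ≤ 1 * ‖x‖ := by gcongr; exact ht.2
      _ ≤ r := by rw [one_mul]; exact hx.trans hr'r
  have hsl : ∀ t, ContDiff ℝ ∞ fun x => h 0 + H (t, x) := fun t =>
    contDiff_const.add (hH.comp (contDiff_const.prodMk contDiff_id))
  have hinj : ∀ t ∈ Icc (0 : ℝ) 1, InjOn (fun x => h 0 + H (t, x)) (closedBall 0 r') := by
    intro t ht x hx y hy hxy
    have hxy' : H (t, x) = H (t, y) := add_left_cancel hxy
    rcases eq_or_ne t 0 with rfl | ht0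
    · rw [hH0, hH0] at hxy'
      exact injective_of_mem_linearSymplectic (hs 0 h0r) hxy'
    · have h1 := congrArg (fun z => t • z) hxy'
      simp only [hHt, sub_left_inj] at h1
      exact smul_right_injective _ ht0 (hi (hts t ht x hx) (hts t ht y hy) h1)
  have hF : ContMDiffOn 𝓘(ℝ, ℝ × Euc n) (𝓡 (2 * n)) ∞ (fun w : ℝ × Euc n => e (h 0 + H w))
      (Q ×ˢ closedBall 0 r') := fun w hw =>
    ((he.smooth _ (hQm w.1 hw.1 w.2 hw.2)).comp w
      (contDiff_const.add hH).contMDiff.contMDiffAt).contMDiffWithinAt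
  have key := pushJoined_of_family hX hψ hb hQ.uniqueDiffOn hF
    (c := fun t => 1 - (t : ℝ)) (by fun_prop)
    (fun t => hIQ ⟨by linarith [t.2.2], by linarith [t.2.1]⟩)
    (ρ := fun _ => r') continuous_const (fun _ => hr') (fun _ => le_rfl)
    (fun _ => hr'r.trans hrb) (fun t => by
      have ht : (1 - t : ℝ) ∈ Icc (0 : ℝ) 1 := ⟨by linarith [t.2.2], by linarith [t.2.1]⟩
      refine he.isSymplecticOn (hsl _) (hQm _ (hIQ ht)) (hinj _ ht) fun x hx => ?_
      rw [((hHd _ x).const_add (h 0)).fderiv]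
      exact hs _ (hts _ ht x hx))
  have e1 : ∀ x, h 0 + H (1, x) = h x := fun x => by
    have := hHt 1 x
    rw [one_smul, one_smul] at this
    rw [this, add_sub_cancel]
  simpa [hH0, e1] using key

/-- The affine symplectic embeddings of small balls into a Darboux chart are isotopic. -/
lemma pushJoined_affine_id (hX : IsLiouvilleField Ω X) (hψ : IsForwardFlow X ψ) {b : ℝ} (hb : 0 < b)
    {e : OpenPartialHomeomorph (Euc n) M} (he : IsDarbouxChart Ω e) {s : ℝ}
    (hse : ball 0 s ⊆ e.source) {z : Euc n} (hz : z ∈ ball 0 s) {A : Euc n →L[ℝ] Euc n}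
    (hA : A ∈ linearSymplectic n) :
    ∃ δ > 0, ∀ r, 0 < r → r ≤ δ → r ≤ √(b / Real.pi) →
      PushJoined Ω ψ b (fun x => e (z + A x)) r e r := by
  obtain ⟨γ, hγ⟩ := joinedIn_linearSymplectic hA
  obtain ⟨C, hC⟩ := isCompact_univ.exists_bound_of_continuousOn (f := γ) γ.continuous.continuousOn
  have hC0 : 0 ≤ C := (norm_nonneg _).trans (hC 0 (mem_univ _))
  rw [mem_ball_zero_iff] at hz
  -- `C` bounds the norms along the path of linear maps, and this radius gives `‖z‖ + C r < s`,
  -- which keeps the images in the chart.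
  refine ⟨(s - ‖z‖) / (2 * (C + 1)), div_pos (by linarith) (by linarith), fun r hr hrδ hrb => ?_⟩
  have hrC : ‖z‖ + C * r < s := by
    rw [le_div_iff₀ (by linarith)] at hrδ
    nlinarith
  -- The parameters are all affine maps that send the ball into the chart. The family is smooth in
  -- them, so a merely continuous path in the symplectic group is enough.
  let Q : Set (Euc n × (Euc n →L[ℝ] Euc n)) := {w | ‖w.1‖ + ‖w.2‖ * r < s}
  have hQ : IsOpen Q := isOpen_lt (by fun_prop) continuous_const
  have hQm : ∀ q ∈ Q, ∀ x ∈ closedBall (0 : Euc n) r, q.1 + q.2 x ∈ e.source := by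
    intro q hq x hx
    rw [mem_closedBall_zero_iff] at hx
    refine hse (mem_ball_zero_iff.2 (lt_of_le_of_lt ?_ hq))
    exact (norm_add_le _ _).trans (add_le_add_right ((q.2.le_opNorm x).trans (by gcongr)) _)
  have hg : ContDiff ℝ ∞
      (fun w : (Euc n × (Euc n →L[ℝ] Euc n)) × Euc n => w.1.1 + w.1.2 w.2) :=
    (contDiff_fst.comp contDiff_fst).add ((contDiff_snd.comp contDiff_fst).clm_apply contDiff_snd)
  have hF : ContMDiffOn 𝓘(ℝ, (Euc n × (Euc n →L[ℝ] Euc n)) × Euc n) (𝓡 (2 * n)) ∞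
      (fun w : (Euc n × (Euc n →L[ℝ] Euc n)) × Euc n => e (w.1.1 + w.1.2 w.2))
      (Q ×ˢ closedBall 0 r) := fun w hw =>
    ((he.smooth _ (hQm w.1 hw.1 w.2 hw.2)).comp w hg.contMDiff.contMDiffAt).contMDiffWithinAt
  have hcQ : ∀ t : unitInterval, ((1 - t : ℝ) • z, γ t) ∈ Q := by
    intro t
    have h1 : ‖(1 - t : ℝ) • z‖ ≤ ‖z‖ := by
      rw [norm_smul, Real.norm_of_nonneg (by linarith [t.2.2])]
      nlinarith [norm_nonneg z, t.2.1]
    have h2 : ‖γ t‖ * r ≤ C * r := by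
      gcongr
      exact hC t (mem_univ _)
    exact lt_of_le_of_lt (add_le_add h1 h2) hrC
  have key := pushJoined_of_family hX hψ hb hQ.uniqueDiffOn hF
    (c := fun t => ((1 - t : ℝ) • z, γ t)) (by fun_prop) hcQ (ρ := fun _ => r) continuous_const
    (fun _ => hr) (fun _ => le_rfl) (fun _ => hrb) (fun t => by
      have hd : ∀ x, HasFDerivAt (fun x => (1 - t : ℝ) • z + γ t x) (γ t) x := fun x =>
        (γ t).hasFDerivAt.const_add _
      refine he.isSymplecticOn (contDiff_const.add (γ t).contDiff) (hQm _ (hcQ t)) ?_ fun x _ => ?_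
      · exact fun x _ y _ hxy => injective_of_mem_linearSymplectic (hγ t) (add_left_cancel hxy)
      · rw [(hd x).fderiv]
        exact hγ t)
  simpa using key

/-- A symplectic embedding of a ball whose centre is mapped into a Darboux chart is isotopic to the
chart. -/
theorem IsSymplecticOn.pushJoined_chart (hX : IsLiouvilleField Ω X) (hψ : IsForwardFlow X ψ) {b : ℝ}
    (hb : 0 < b) {e : OpenPartialHomeomorph (Euc n) M} (he : IsDarbouxChart Ω e) {s : ℝ}
    (hse : ball 0 s ⊆ e.source) {f : Euc n → M} {r : ℝ} (hr : 0 < r) (hrb : r ≤ √(b / Real.pi))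
    (hf : IsSymplecticOn Ω f r) (hf0 : f 0 ∈ e '' ball 0 s) {ρ : ℝ} (hρ : 0 < ρ) (hρs : ρ < s)
    (hρb : ρ ≤ √(b / Real.pi)) : PushJoined Ω ψ b f r e ρ := by
  obtain ⟨h, r₁, hr₁, hh, hfh⟩ := hf.exists_inChart he hse hr hf0
  have hinj : InjOn h (closedBall 0 r₁) := fun x hx y hy hxy => by
    have hs := closedBall_subset_closedBall (x := (0 : Euc n)) hr₁.2
    refine hf.injOn (hs hx) (hs hy) ?_
    rw [(hfh x hx).2.1, (hfh y hy).2.1, hxy]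
  obtain ⟨r₂, hr₂, h2⟩ := pushJoined_affine hX hψ hb he hse hr₁.1 (hr₁.2.trans hrb) hh
    (fun x hx => (hfh x hx).1) hinj (fun x hx => (hfh x hx).2.2)
  have h0 : (0 : Euc n) ∈ closedBall 0 r₁ := mem_closedBall_self hr₁.1.le
  obtain ⟨δ, hδ, h3⟩ := pushJoined_affine_id hX hψ hb he hse (hfh 0 h0).1 (hfh 0 h0).2.2
  have hr₂0 := hr₂.1
  -- A radius small enough for both deformations and below `ρ`: the embedding is shrunk to it, made
  -- affine, moved to the chart, and the chart is enlarged back to `ρ`.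
  set r₃ := min (min r₂ δ) ρ
  have hr₃ : 0 < r₃ := by positivity
  have hr₃₂ : r₃ ≤ r₂ := (min_le_left _ _).trans (min_le_left _ _)
  have hr₃r : r₃ ≤ r := hr₃₂.trans (hr₂.2.trans hr₁.2)
  have e1 := hf.pushJoined_radius hX hψ hb hr₃ hr₃r hrb
  have e2 := (h2 r₃ ⟨hr₃, hr₃₂⟩).congr_left hr₃.le (f' := f) fun x hx =>
    (hfh x (closedBall_subset_closedBall (hr₃₂.trans hr₂.2) hx)).2.1.symm
  have e3 := h3 r₃ hr₃ ((min_le_left _ _).trans (min_le_right _ _)) (hr₃r.trans hrb)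
  have e4 := (he.isSymplecticOn_self ((closedBall_subset_ball hρs).trans hse)).pushJoined_radius
    hX hψ hb hr₃ (min_le_right _ _) hρb
  exact ((e1.trans e2).trans e3).trans e4.symm

end Chart

/-! ### Connectedness of the space of symplectic embeddings -/

/-- `IsSymplecticOn.pushJoined_chart` is used twice. Applied to the Darboux ball at a point `y` near
`x`, it shows that the relation between centres holds locally, hence everywhere on the connected
`M`. Applied to an arbitrary embedding, it joins it to the Darboux ball at the image of its centre.
-/
theorem nonempty_and_pathConnectedSpace_emb {n : ℕ} {M : Type*} [TopologicalSpace M]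
    [ChartedSpace (Euc n) M] [IsManifold (𝓡 (2 * n)) ∞ M] [T2Space M] [ConnectedSpace M]
    {Ω : SymplecticForm n M} {X : (x : M) → TangentSpace (𝓡 (2 * n)) x}
    (hX : IsLiouvilleField Ω X) (hc : IsForwardComplete X) {b : ℝ} (hb : 0 < b) :
    Nonempty (Emb Ω b) ∧ PathConnectedSpace (Emb Ω b) := by
  obtain ⟨ψ, hψ⟩ := hc.exists_flow
  have hR : 0 < √(b / Real.pi) := Real.sqrt_pos.2 (div_pos hb Real.pi_pos)
  have hchart : ∀ x : M, ∃ (e : OpenPartialHomeomorph (Euc n) M) (s ρ : ℝ), IsDarbouxChart Ω e ∧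
      e 0 = x ∧ ball 0 s ⊆ e.source ∧ 0 < ρ ∧ ρ < s ∧ ρ ≤ √(b / Real.pi) := by
    intro x
    obtain ⟨e, he, h0, hx⟩ := exists_darbouxChart hX x
    obtain ⟨s, hs, hse⟩ := Metric.isOpen_iff.1 e.open_source 0 h0
    exact ⟨e, s, min (s / 2) (√(b / Real.pi)), he, hx, hse, by positivity,
      (min_le_left _ _).trans_lt (half_lt_self hs), min_le_right _ _⟩
  choose e s ρ he hex hse hρ hρs hρb using hchart
  have hes : ∀ x, IsSymplecticOn Ω (e x) (ρ x) := fun x =>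
    (he x).isSymplecticOn_self ((closedBall_subset_ball (hρs x)).trans (hse x))
  have hmem : ∀ x, x ∈ e x '' ball 0 (s x) := fun x =>
    ⟨0, mem_ball_self ((hρ x).trans (hρs x)), hex x⟩
  have hall : ∀ x y : M, PushJoined Ω ψ b (e x) (ρ x) (e y) (ρ y) := by
    let J : M → M → Prop := fun x y => PushJoined Ω ψ b (e x) (ρ x) (e y) (ρ y)
    have hJ : IsTrans M J := ⟨fun _ _ _ => PushJoined.trans⟩
    have : Std.Symm J := ⟨fun _ _ => PushJoined.symm⟩
    refine PreconnectedSpace.induction₂ J (fun x => ?_) hJ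
    have hnhds : e x '' ball 0 (s x) ∈ 𝓝 x :=
      ((e x).isOpen_image_of_subset_source isOpen_ball (hse x)).mem_nhds (hmem x)
    filter_upwards [hnhds] with y hy
    exact ((hes y).pushJoined_chart hX hψ hb (he x) (hse x) (hρ y) (hρb y) (by rwa [hex y])
      (hρ x) (hρs x) (hρb x)).symm
  have hemb : ∀ φ : Emb Ω b, ∃ x, PushJoined Ω ψ b (extendMap φ.1.toFun) (√(b / Real.pi))
      (e x) (ρ x) := fun φ =>
    ⟨_, (isSymplecticOn_of_emb φ).pushJoined_chart hX hψ hb (he _) (hse _) hR le_rfl (hmem _)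
      (hρ _) (hρs _) (hρb _)⟩
  have hne : Nonempty (Emb Ω b) := by
    obtain ⟨x⟩ : Nonempty M := inferInstance
    obtain ⟨φ, -⟩ := (hes x).exists_push hX hψ (hρ x) (hρb x)
    exact ⟨φ⟩
  refine ⟨hne, ⟨hne, fun φ φ' => ?_⟩⟩
  obtain ⟨x, hx⟩ := hemb φ
  obtain ⟨y, hy⟩ := hemb φ'
  exact ((hx.trans (hall x y)).trans hy.symm).joined (isPush_of_emb hψ.zero hb φ)
    (isPush_of_emb hψ.zero hb φ')

end SymplecticBall

end

theorem proposition5p2 (n : ℕ) {M : Type*} [TopologicalSpace M]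
    [ChartedSpace (SymplecticBall.Euc n) M] [IsManifold (𝓡 (2 * n)) ∞ M]
    [T2Space M] [SecondCountableTopology M] [ConnectedSpace M]
    (Ω : SymplecticBall.SymplecticForm n M)
    (hΩ : SymplecticBall.IsForwardCompleteLiouville Ω) (b : ℝ) (hb : 0 < b) :
    Nonempty (SymplecticBall.Emb Ω b) ∧ PathConnectedSpace (SymplecticBall.Emb Ω b) := by
  obtain ⟨X, hX, hc⟩ := hΩ
  exact SymplecticBall.nonempty_and_pathConnectedSpace_emb hX hc hb
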